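/- **Setting.** Let $L_1,L_2$ be such that the number of faces $n_F=(L_1-1)(L_2-1)$ of the $L_1\times L_2$ square lattice is odd, and let $m=L_1L_2$. The vertices are $(x,y)$ with $0\le x<L_1$, $0\le y<L_2$ ($x$ is the column, $y$ the row, rows numbered upwards), and the faces are labelled even/odd like a checkerboard so that there is one more even face than odd faces (case II; the corner faces are even). *Fermions.* $F_m=\bigoplus_{n=0}^m\wedge^n\mathbb C^m$ is the fermionic Fock space with one mode per vertex, $F_m^E$ its even-particle-number part, $a_i,a_i^\dagger$ are the annihilation and creation operators, $\gamma_i=a_i+a_i^\dagger$, $\bar\gamma_i=(a_i-a_i^\dagger)/\mathrm i$, and $E_{ij}=-\mathrm i\,\gamma_i\gamma_j$ (for adjacent $i,j$), $V_i=-\mathrm i\,\gamma_i\bar\gamma_i$. *Qubits.* Put one qubit on each vertex and one on each odd face. Orient the edges so that all edges of a row point the same way and all edges of a column point the same way, with directions alternating from row to row and from column to column, in the (two, mutually reversed) ways for which the edges circulate around every even face; the sense of circulation then alternates between neighbouring rows of faces. For an edge pointing from $i$ to $j$ set $$\tilde E_{ij}=\begin{cases}X_iY_jX_f&\text{edge pointing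 down}\\-X_iY_jX_f&\text{edge pointing up}\\X_iY_jY_f&\text{edge horizontal,}\end{cases}\qquad \tilde E_{ji}=-\tilde E_{ij},\qquad \tilde V_i=Z_i,$$ where $f$ is the unique odd face adjacent to the edge (the face Pauli is omitted if there is none). For a face with corners $p_1,p_2,p_3,p_4$ in cyclic order its loop operator is $\mathrm i^4\tilde E_{p_1p_2}\tilde E_{p_2p_3}\tilde E_{p_3p_4}\tilde E_{p_4p_1}$. The non-trivial stabilizers are the face loop operators different from the identity, and $\mathcal L$ is their joint $+1$ eigenspace. $L(S)$ denotes the $*$-algebra of linear operators on $S$. **Theorem (case II).** For either of the two orientations: 1. There is one more even face than odd faces, the number of qubits is $m+\lfloor n_F/2\rfloor$, so that $\mathcal L\subset(\mathbb C^2)^{\otimes(m+\lfloor n_F/2\rfloor)}$, and there are exactly $\lceil n_F/2\rceil$ non-trivial stabilizers. 2. $\dim\mathcal L=2^{m-1}=\dim F_m^E$. 3. The operators $E_{ij},V_i$ leave $F_m^E$ invariant, the operators $\tilde E_{ij},\tilde V_i$ leave $\mathcal L$ invariant, and $\prod_iV_i=\mathbb I$ on $F_m^E$, $\prod_i\tilde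 V_i=\mathbb I$ on $\mathcal L$. 4. There is exactly one $*$-isomorphism $\mu:L(F_m^E)\to L(\mathcal L)$ with $\mu(E_{ij}|_{F_m^E})=\tilde E_{ij}|_{\mathcal L}$ for all adjacent $i,j$ and $\mu(V_i|_{F_m^E})=\tilde V_i|_{\mathcal L}$ for all $i$. 5. There is an isometry $J:F_m^E\to\mathcal L$, which is onto, with $\mu(A)=JAJ^\dagger$ for all $A\in L(F_m^E)$; it is unique up to a global phase. -/

import Mathlib

open scoped BigOperators

noncomputable section

namespace CompactEncoding

/-- `L(E)`: the algebra of linear operators on the (finite-dimensional) Hilbert space `E`; its `*` is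
the adjoint. -/
abbrev Op (E : Type) [NormedAddCommGroup E] [InnerProductSpace ℂ E] : Type := E →ₗ[ℂ] E

/-- The restriction `T|_S` of an operator `T` to an invariant subspace `S`. -/
def restrictTo {E : Type} [NormedAddCommGroup E] [InnerProductSpace ℂ E] (S : Submodule ℂ E)
    (T : Op E) (h : ∀ ψ ∈ S, T ψ ∈ S) : Op S where
  toFun ψ := ⟨T ψ, h ψ ψ.2⟩
  map_add' a b := by
    ext
    simp
  map_smul' c a := by
    ext
    simp

/-- The operator `J A J†` for an isometry `J`. -/
def conjBy {E F : Type} [NormedAddCommGroup E] [InnerProductSpace ℂ E] [FiniteDimensional ℂ E]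
    [NormedAddCommGroup F] [InnerProductSpace ℂ F] [FiniteDimensional ℂ F]
    (J : E →ₗᵢ[ℂ] F) (A : Op E) : Op F :=
  J.toLinearMap ∘ₗ A ∘ₗ LinearMap.adjoint J.toLinearMap

/-! ## The fermionic Fock space and its operators -/

section Fermions

/-- Configurations `(i₁, …, iₙ)` of `n ≤ |ι|` labelled particles on the set of modes `ι`. -/
abbrev Config (ι : Type) [Fintype ι] : Type :=
  (n : Fin (Fintype.card ι + 1)) × (Fin n → ι)

/-- The Hilbert space `⨁ₙ (ℂ^ι)^{⊗ n}`, `0 ≤ n ≤ |ι|`.  A vector is given by its coefficients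
`ψ ⟨n, (i₁, …, iₙ)⟩` in the orthonormal basis `e_{i₁} ⊗ ⋯ ⊗ e_{iₙ}`. -/
abbrev TensorFock (ι : Type) [Fintype ι] : Type := EuclideanSpace ℂ (Config ι)

variable (ι : Type) [Fintype ι]

/-- The full fermionic Fock space `F_m = ⨁ₙ Λⁿ ℂ^ι`, with `m = |ι|`: the subspace of
`⨁ₙ (ℂ^ι)^{⊗ n}` of those vectors each of whose components is a totally antisymmetric tensor. -/
def Fock : Submodule ℂ (TensorFock ι) where
  carrier := {ψ | ∀ (n : Fin (Fintype.card ι + 1)) (σ : Equiv.Perm (Fin n)) (x : Fin n → ι),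
    ψ ⟨n, x ∘ σ⟩ = ((Equiv.Perm.sign σ : ℤ) : ℂ) * ψ ⟨n, x⟩}
  add_mem' := by
    intro a b ha hb n σ x
    simp only [PiLp.add_apply, ha n σ x, hb n σ x, mul_add]
  zero_mem' := by
    intro n σ x
    simp
  smul_mem' := by
    intro c a ha n σ x
    simp only [PiLp.smul_apply, ha n σ x, smul_eq_mul]
    ring

/-- The space `F_m` as a Hilbert space in its own right. -/
def FockSpace : Type := Fock ι

instance : NormedAddCommGroup (FockSpace ι) := inferInstanceAs (NormedAddCommGroup (Fock ι))

instance : InnerProductSpace ℂ (FockSpace ι) := inferInstanceAs (InnerProductSpace ℂ (Fock ι))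

instance : FiniteDimensional ℂ (FockSpace ι) := inferInstanceAs (FiniteDimensional ℂ (Fock ι))

/-- The wave function of a vector of `F_m`, i.e. the inclusion of `F_m` in `⨁ₙ (ℂ^ι)^{⊗ n}`. -/
def wave : FockSpace ι →ₗ[ℂ] TensorFock ι := (Fock ι).subtype

/-- The even-parity Fock space `F_m^E`: only even particle numbers occur. -/
def evenFock : Submodule ℂ (FockSpace ι) where
  carrier := {ψ | ∀ (n : Fin (Fintype.card ι + 1)) (x : Fin n → ι),
    Odd (n : ℕ) → wave ι ψ ⟨n, x⟩ = 0}
  add_mem' := by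
    intro a b ha hb n x hn
    simp [ha n x hn, hb n x hn]
  zero_mem' := by
    intro n x hn
    simp
  smul_mem' := by
    intro c a ha n x hn
    simp [ha n x hn]

variable {ι}

/-- The action of the annihilation operator on coefficients:
`(a_i ψ)(x₁, …, xₙ) = √(n+1) ψ(i, x₁, …, xₙ)` (and `0` when there is no `n+1` particle sector). -/
def annihFun (i : ι) (ψ : TensorFock ι) : TensorFock ι :=
  WithLp.toLp 2 fun c : Config ι =>
    if h : (c.1 : ℕ) < Fintype.card ι then
      ((Real.sqrt ((c.1 : ℕ) + 1) : ℝ) : ℂ) *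
        ψ ⟨⟨(c.1 : ℕ) + 1, Nat.succ_lt_succ h⟩, (Fin.cons i c.2 : Fin ((c.1 : ℕ) + 1) → ι)⟩
    else 0

/-- Annihilation operators preserve antisymmetry. -/
theorem annihFun_mem (i : ι) {ψ : TensorFock ι} (hψ : ψ ∈ Fock ι) : annihFun i ψ ∈ Fock ι := by
  intro n σ x
  by_cases h : (n : ℕ) < Fintype.card ι
  · have key := hψ ⟨(n : ℕ) + 1, Nat.succ_lt_succ h⟩ (Equiv.Perm.decomposeFin.symm (0, σ))
      (Fin.cons i x : Fin ((n : ℕ) + 1) → ι)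
    have hc : (Fin.cons i x : Fin ((n : ℕ) + 1) → ι) ∘ (Equiv.Perm.decomposeFin.symm (0, σ)) =
        (Fin.cons i (x ∘ σ) : Fin ((n : ℕ) + 1) → ι) := by
      funext k
      refine Fin.cases ?_ (fun k => ?_) k
      · simp
      · simp
    rw [Equiv.Perm.decomposeFin.symm_sign] at key
    simp only [if_true, one_mul] at key
    simp only [annihFun, h, dif_pos]
    rw [← hc, key]
    ring
  · simp [annihFun, h]

/-- The annihilation operator `a_i` on the fermionic Fock space. -/
def annih (i : ι) : Op (FockSpace ι) where
  toFun ψ := (⟨annihFun i (wave ι ψ), annihFun_mem i (Subtype.property ψ)⟩ : Fock ι)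
  map_add' a b := by
    refine Subtype.ext ?_
    change annihFun i (wave ι (a + b)) = annihFun i (wave ι a) + annihFun i (wave ι b)
    ext c
    by_cases h : (c.1 : ℕ) < Fintype.card ι
    · simp [annihFun, h, mul_add]
    · simp [annihFun, h]
  map_smul' z a := by
    refine Subtype.ext ?_
    change annihFun i (wave ι (z • a)) = z • annihFun i (wave ι a)
    ext c
    by_cases h : (c.1 : ℕ) < Fintype.card ι
    · simp [annihFun, h]
      ring
    · simp [annihFun, h]

/-- The creation operator `a_i†`. -/
def creat (i : ι) : Op (FockSpace ι) := LinearMap.adjoint (annih i)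

/-- The Majorana operator `γ_i = a_i + a_i†`. -/
def majorana (i : ι) : Op (FockSpace ι) := annih i + creat i

/-- The Majorana operator `γ̄_i = (a_i - a_i†) / i`. -/
def majoranaBar (i : ι) : Op (FockSpace ι) := (Complex.I)⁻¹ • (annih i - creat i)

/-- The fermionic edge operator `E_{ij} = -i γ_i γ_j`. -/
def edgeOp (i j : ι) : Op (FockSpace ι) := (-Complex.I) • (majorana i * majorana j)

/-- The fermionic vertex operator `V_i = -i γ_i γ̄_i`. -/
def vertexOp (i : ι) : Op (FockSpace ι) := (-Complex.I) • (majorana i * majoranaBar i)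

end Fermions

/-! ## Qubits and Pauli operators -/

section Qubits

/-- The Hilbert space `(ℂ²)^{⊗ Q}` of qubits labelled by `Q`, in the computational basis. -/
abbrev QubitSpace (Q : Type) [Fintype Q] : Type := EuclideanSpace ℂ (Q → Fin 2)

variable {Q : Type} [Fintype Q] [DecidableEq Q]

/-- The single-qubit operator `M` applied to the qubit `q`. -/
def onQubit (M : Matrix (Fin 2) (Fin 2) ℂ) (q : Q) : Op (QubitSpace Q) where
  toFun ψ := WithLp.toLp 2 fun b => ∑ c : Fin 2, M (b q) c * ψ (Function.update b q c)
  map_add' a b := by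
    ext c
    simp [mul_add]
    ring
  map_smul' z a := by
    ext c
    simp
    ring

/-- The Pauli operator `X_q`. -/
def pauliX (q : Q) : Op (QubitSpace Q) := onQubit !![0, 1; 1, 0] q

/-- The Pauli operator `Y_q`. -/
def pauliY (q : Q) : Op (QubitSpace Q) := onQubit !![0, -Complex.I; Complex.I, 0] q

/-- The Pauli operator `Z_q`. -/
def pauliZ (q : Q) : Op (QubitSpace Q) := onQubit !![1, 0; 0, -1] q

end Qubits

/-! ## The square lattice and the encoded operators -/

section Lattice

/-- The vertices `(x, y)` of the `L₁ × L₂` lattice: column `x`, row `y` (rows numbered upwards). -/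
abbrev Vertex (L₁ L₂ : ℕ) : Type := Fin L₁ × Fin L₂

/-- The square lattice as a graph. -/
abbrev lattice (L₁ L₂ : ℕ) : SimpleGraph (Vertex L₁ L₂) :=
  SimpleGraph.boxProd (SimpleGraph.pathGraph L₁) (SimpleGraph.pathGraph L₂)

/-- The faces; `(a, b)` is the unit square with lower left corner `(a, b)`. -/
abbrev Face (L₁ L₂ : ℕ) : Type := Fin (L₁ - 1) × Fin (L₂ - 1)

/-- The checkerboard labelling of the faces in which the lower left corner face is even.  If the
number of faces is odd, this is the labelling with one more even face than odd faces. -/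
abbrev IsOddFace {L₁ L₂ : ℕ} (f : Face L₁ L₂) : Prop := Odd ((f.1 : ℕ) + (f.2 : ℕ))

/-- The odd faces of the lattice. -/
abbrev OddFace (L₁ L₂ : ℕ) : Type := {f : Face L₁ L₂ // IsOddFace f}

/-- The even faces of the lattice. -/
abbrev EvenFace (L₁ L₂ : ℕ) : Type := {f : Face L₁ L₂ // ¬ IsOddFace f}

/-- One qubit for every vertex and one for every odd face. -/
abbrev Qubit (L₁ L₂ : ℕ) : Type := Vertex L₁ L₂ ⊕ OddFace L₁ L₂

variable {L₁ L₂ : ℕ}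

/-- The four corners of a face: lower left, lower right, upper right, upper left. -/
def corner (f : Face L₁ L₂) : Fin 4 → Vertex L₁ L₂ :=
  let x : Fin L₁ := ⟨f.1, by have := f.1.2; omega⟩
  let x' : Fin L₁ := ⟨(f.1 : ℕ) + 1, by have := f.1.2; omega⟩
  let y : Fin L₂ := ⟨f.2, by have := f.2.2; omega⟩
  let y' : Fin L₂ := ⟨(f.2 : ℕ) + 1, by have := f.2.2; omega⟩
  ![(x, y), (x', y), (x', y'), (x, y')]

/-- The orientation of the edges: `Arrow cw i j` says that `{i, j}` is an edge and that it points
from `i` to `j`.  Edges in one row all point the same way, and so do edges in one column, with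
directions alternating from row to row and from column to column.  Hence edges circulate around
each even face, in opposite senses in neighbouring rows of faces; the sense in the bottom row is
clockwise for `cw = true` and counterclockwise for `cw = false`. -/
def Arrow (cw : Bool) (i j : Vertex L₁ L₂) : Prop :=
  (lattice L₁ L₂).Adj i j ∧
    ((i.2 = j.2 ∧ (i.1 < j.1 ↔ (Odd (i.2 : ℕ) ↔ cw = true))) ∨
     (i.1 = j.1 ∧ (i.2 < j.2 ↔ (Even (i.1 : ℕ) ↔ cw = true))))

open Classical in
/-- The Pauli operator `P` at the (unique) odd face adjacent to the edge `{i, j}`; the identity if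
the edge lies on the boundary and is not adjacent to an odd face. -/
def facePauli (P : Qubit L₁ L₂ → Op (QubitSpace (Qubit L₁ L₂)))
    (i j : Vertex L₁ L₂) : Op (QubitSpace (Qubit L₁ L₂)) :=
  if h : ∃ f : OddFace L₁ L₂, i ∈ Set.range (corner f.1) ∧ j ∈ Set.range (corner f.1) then
    P (Sum.inr h.choose)
  else 1

/-- The encoded edge operator of an edge that points from `i` to `j`: `X` at the tail, `Y` at the
head, and `Y` (horizontal edge) or `X` (vertical edge) at the adjacent odd face, with a minus sign
if the edge points upwards. -/
def arrowOp (i j : Vertex L₁ L₂) : Op (QubitSpace (Qubit L₁ L₂)) :=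
  if i.2 = j.2 then pauliX (Sum.inl i) * pauliY (Sum.inl j) * facePauli pauliY i j
  else if j.2 < i.2 then pauliX (Sum.inl i) * pauliY (Sum.inl j) * facePauli pauliX i j
  else -(pauliX (Sum.inl i) * pauliY (Sum.inl j) * facePauli pauliX i j)

open Classical in
/-- The encoded edge operators `Ẽ_{ij}`, with `Ẽ_{ji} = -Ẽ_{ij}` (and `0` off the edges). -/
def encEdge (cw : Bool) (i j : Vertex L₁ L₂) : Op (QubitSpace (Qubit L₁ L₂)) :=
  if Arrow cw i j then arrowOp i j else if Arrow cw j i then -arrowOp j i else 0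

/-- The encoded vertex operators `Ṽ_i = Z_i`. -/
def encVertex (i : Vertex L₁ L₂) : Op (QubitSpace (Qubit L₁ L₂)) :=
  pauliZ (Sum.inl i)

/-- The encoded loop operator `i^{|p|-1} ∏ₖ Ẽ_{pₖ pₖ₊₁}` of the closed path `p` (with `|p| = 5`)
around the face `f`. -/
def faceLoop (cw : Bool) (f : Face L₁ L₂) : Op (QubitSpace (Qubit L₁ L₂)) :=
  Complex.I ^ 4 • (encEdge cw (corner f 0) (corner f 1) * encEdge cw (corner f 1) (corner f 2) *
    encEdge cw (corner f 2) (corner f 3) * encEdge cw (corner f 3) (corner f 0))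

variable (L₁ L₂)

/-- The non-trivial stabilizers: the face loop operators other than the identity. -/
def stabilizers (cw : Bool) : Set (Op (QubitSpace (Qubit L₁ L₂))) :=
  {S | S ≠ 1 ∧ ∃ f : Face L₁ L₂, S = faceLoop cw f}

/-- The code space `𝓛`: the joint `+1` eigenspace of the non-trivial stabilizers. -/
def codeSpace (cw : Bool) : Submodule ℂ (QubitSpace (Qubit L₁ L₂)) where
  carrier := {ψ | ∀ S ∈ stabilizers L₁ L₂ cw, S ψ = ψ}
  add_mem' := by
    intro a b ha hb S hS
    rw [map_add, ha S hS, hb S hS]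
  zero_mem' := by
    intro S hS
    simp
  smul_mem' := by
    intro c a ha S hS
    rw [map_smul, ha S hS]

end Lattice

end CompactEncoding

end

/-! Both sides represent one algebra. Edge and vertex operators satisfy local relations
(`EdgeRelations`): they are unitary or hermitian involutions, and two of them commute up to a sign
that counts shared vertices. If moreover all face loops and the product of all `V i` are the
identity, these relations determine the representation of dimension `2 ^ (m - 1)` up to unitary
equivalence.

To see this, fix the corner vertex `o` and follow a comb-shaped spanning tree. The product of edges
along the path to `v`, suitably normalised, behaves like `-i γ_o γ_v` (`pathOp`). For `v ≠ o` these
`m - 1` operators are anticommuting involutions, and each anticommutes with its own `V v` and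
commutes with the others (`cliffordPair`). In dimension `2 ^ (m - 1)` the common fixed vectors of
the `V v` form a line. Words in the path operators applied to a unit vector of that line form an
orthonormal basis on which everything acts by universal signs. Hence there is an intertwiner, and
the commutant is trivial. The trivial loops recover the edges outside the tree (`edge_eq_pathOp`),
and the parity relation recovers `V o` (`vertex_eq_prod`).

It remains to check that both sides qualify. For fermions the relations follow from the canonical
anticommutation relations, and parity splits the `2 ^ m`-dimensional Fock space in half
(`finrank_evenFock`). For qubits the vertex Paulis give only some of the required signs; the Paulis
on odd faces supply the rest exactly because edges circulate around even faces
(`exists_common_oddFace_iff`, `arrowOp_commuteBy`). Odd-face loops are the identity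
(`faceLoop_odd`). Each even-face loop can be flipped alone by a diagonal string of `X` operators
(`flipper_faceLoop`), so every even face halves the dimension; there is one more even face than odd
faces, which gives `2 ^ (m - 1)`. Parity on the code space holds because the faces in even rows and
even columns tile the vertices (`prod_encVertex`).

The intertwiner is `J`, and `μ` is conjugation by it. Uniqueness of `μ` follows from the trivial
commutant and the innerness of automorphisms; uniqueness of `J` follows because the centre of the
operator algebra is scalar. -/

noncomputable section

set_option linter.unusedSectionVars false

namespace CompactEncoding

/-! ### Dimension of the joint fixed space of commuting involutions. -/

section JointEigenspace

variable {H : Type} [NormedAddCommGroup H] [InnerProductSpace ℂ H] [FiniteDimensional ℂ H]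
variable {ι : Type}

/-- The vectors fixed by all the operators `S i`, `i ∈ l`. -/
def jointFixed (S : ι → Op H) (l : List ι) : Submodule ℂ H where
  carrier := {ψ | ∀ i ∈ l, S i ψ = ψ}
  add_mem' := by
    intro a b ha hb i hi
    rw [map_add, ha i hi, hb i hi]
  zero_mem' := by
    intro i _
    simp
  smul_mem' := by
    intro c a ha i hi
    rw [map_smul, ha i hi]

theorem mem_jointFixed {S : ι → Op H} {l : List ι} {ψ : H} :
    ψ ∈ jointFixed S l ↔ ∀ i ∈ l, S i ψ = ψ := Iff.rfl

/-- The involution `S` splits `M` into its `+1` and `-1` parts, and the anticommuting `D` maps each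
part injectively into the other, so the two have equal dimension. -/
theorem finrank_half (M : Submodule ℂ H) (S D : Op H)
    (hSM : ∀ ψ ∈ M, S ψ ∈ M) (hDM : ∀ ψ ∈ M, D ψ ∈ M) (hS : ∀ ψ, S (S ψ) = ψ)
    (hD : Function.Injective D) (hDS : ∀ ψ, D (S ψ) = -S (D ψ)) :
    2 * Module.finrank ℂ (M ⊓ LinearMap.ker (S - 1) : Submodule ℂ H) = Module.finrank ℂ M := by
  set P : Submodule ℂ H := M ⊓ LinearMap.ker (S - 1) with hP
  set N : Submodule ℂ H := M ⊓ LinearMap.ker (S + 1) with hN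
  have memP : ∀ ψ, ψ ∈ P ↔ ψ ∈ M ∧ S ψ = ψ := by
    intro ψ
    simp [hP, sub_eq_zero]
  have memN : ∀ ψ, ψ ∈ N ↔ ψ ∈ M ∧ S ψ = -ψ := by
    intro ψ
    simp [hN, add_eq_zero_iff_eq_neg]
  have h1 : P ⊔ N = M := by
    apply le_antisymm
    · exact sup_le inf_le_left inf_le_left
    · intro ψ hψ
      rw [Submodule.mem_sup]
      refine ⟨(1 / 2 : ℂ) • (ψ + S ψ), ?_, (1 / 2 : ℂ) • (ψ - S ψ), ?_, ?_⟩
      · rw [memP]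
        refine ⟨M.smul_mem _ (M.add_mem hψ (hSM _ hψ)), ?_⟩
        rw [map_smul, map_add, hS, add_comm]
      · rw [memN]
        refine ⟨M.smul_mem _ (M.sub_mem hψ (hSM _ hψ)), ?_⟩
        rw [map_smul, map_sub, hS, ← smul_neg, neg_sub]
      · rw [← smul_add]
        have : ψ + S ψ + (ψ - S ψ) = (2 : ℂ) • ψ := by
          rw [two_smul]
          abel
        rw [this, smul_smul]
        norm_num
  have h2 : P ⊓ N = ⊥ := by
    rw [Submodule.eq_bot_iff]
    rintro ψ ⟨hp, hn⟩
    have e1 := ((memP ψ).1 hp).2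
    have e2 := ((memN ψ).1 hn).2
    have e3 : (2 : ℂ) • ψ = 0 := by
      rw [two_smul]
      exact add_eq_zero_iff_eq_neg.2 (e1.symm.trans e2)
    exact (smul_eq_zero.1 e3).resolve_left two_ne_zero
  have hPN : Module.finrank ℂ P ≤ Module.finrank ℂ N := by
    rw [(Submodule.equivMapOfInjective D hD P).finrank_eq]
    apply Submodule.finrank_mono
    rintro _ ⟨ψ, hψ, rfl⟩
    have h := (memP ψ).1 hψ
    refine (memN _).2 ⟨hDM _ h.1, ?_⟩
    have := hDS ψ
    rw [h.2] at this
    exact (neg_eq_iff_eq_neg.2 this).symm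
  have hNP : Module.finrank ℂ N ≤ Module.finrank ℂ P := by
    rw [(Submodule.equivMapOfInjective D hD N).finrank_eq]
    apply Submodule.finrank_mono
    rintro _ ⟨ψ, hψ, rfl⟩
    have h := (memN ψ).1 hψ
    refine (memP _).2 ⟨hDM _ h.1, ?_⟩
    have := hDS ψ
    rw [h.2, map_neg] at this
    exact (neg_injective this).symm
  have h3 := Submodule.finrank_sup_add_finrank_inf_eq P N
  rw [h1, h2, finrank_bot] at h3
  omega

/-- Commuting involutions `S i`, each of which is flipped by an operator `D i` that commutes with
the others, have a joint fixed space of dimension `2⁻ⁿ dim H`. -/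
theorem two_pow_mul_finrank_jointFixed (S D : ι → Op H) (l : List ι) (hl : l.Nodup)
    (hSS : ∀ i j, S i * S j = S j * S i) (hS : ∀ i, S i * S i = 1)
    (hD : ∀ i, Function.Injective (D i)) (hDS : ∀ i, D i * S i = -(S i * D i))
    (hDS' : ∀ i j, i ≠ j → D i * S j = S j * D i) :
    2 ^ l.length * Module.finrank ℂ (jointFixed S l) = Module.finrank ℂ H := by
  induction l with
  | nil =>
    have : jointFixed S ([] : List ι) = ⊤ := by
      ext ψ
      simp [mem_jointFixed]
    rw [this]
    simp
  | cons i l ih =>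
    rw [List.nodup_cons] at hl
    have key : jointFixed S (i :: l) = jointFixed S l ⊓ LinearMap.ker (S i - 1) := by
      ext ψ
      simp [mem_jointFixed, sub_eq_zero, and_comm]
    rw [← ih hl.2, key, ← finrank_half (jointFixed S l) (S i) (D i), List.length_cons, pow_succ,
      mul_assoc]
    · intro ψ hψ j hj
      have := LinearMap.congr_fun (hSS j i) ψ
      rw [Module.End.mul_apply, Module.End.mul_apply, hψ j hj] at this
      exact this
    · intro ψ hψ j hj
      have := LinearMap.congr_fun (hDS' i j (fun h => hl.1 (h ▸ hj))) ψ
      rw [Module.End.mul_apply, Module.End.mul_apply, hψ j hj] at this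
      exact this.symm
    · intro ψ
      exact LinearMap.congr_fun (hS i) ψ
    · exact hD i
    · intro ψ
      exact LinearMap.congr_fun (hDS i) ψ

end JointEigenspace

/-! ### Clifford-type representations of minimal dimension: equivalence and irreducibility. -/

section CliffordPairs

variable {H H' : Type} [NormedAddCommGroup H] [InnerProductSpace ℂ H] [FiniteDimensional ℂ H]
  [NormedAddCommGroup H'] [InnerProductSpace ℂ H'] [FiniteDimensional ℂ H']
variable {W : Type} [DecidableEq W]

/-- Anticommuting unitary involutions `G v` together with commuting hermitian involutions `V v`,
where `V v` anticommutes with `G v` and commutes with the other `G w`. -/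
structure CliffordPair (G V : W → Op H) : Prop where
  G_sq : ∀ v, G v * G v = 1
  V_sq : ∀ v, V v * V v = 1
  G_norm : ∀ v ψ, ‖G v ψ‖ = ‖ψ‖
  V_symm : ∀ v, (V v).IsSymmetric
  G_anticomm : ∀ v w, v ≠ w → G v * G w = -(G w * G v)
  V_comm : ∀ v w, V v * V w = V w * V v
  GV_self : ∀ v, G v * V v = -(V v * G v)
  GV_comm : ∀ v w, v ≠ w → G v * V w = V w * G v

/-- The product of the `G v`, `v ∈ S`, in the order of the list `l`, applied to `ψ`. -/
def word (G : W → Op H) (S : Finset W) (ψ : H) : List W → H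
  | [] => ψ
  | v :: l => if v ∈ S then G v (word G S ψ l) else word G S ψ l

/-- The sign picked up when `G v` is sorted into the product over `S`. -/
def wordSign (v : W) (S : Finset W) : List W → ℂ
  | [] => 1
  | w :: l => if v = w then 1 else (if w ∈ S then -1 else 1) * wordSign v S l

theorem word_congr (G : W → Op H) {S T : Finset W} (ψ : H) :
    ∀ l : List W, (∀ v ∈ l, v ∈ S ↔ v ∈ T) → word G S ψ l = word G T ψ l
  | [], _ => rfl
  | v :: l, h => by
    have h1 := h v (by simp)
    have h2 := word_congr G ψ l (fun w hw => h w (by simp [hw]))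
    by_cases hv : v ∈ S
    · simp only [word, hv, h1.1 hv, if_true, h2]
    · have : v ∉ T := fun h' => hv (h1.2 h')
      simp only [word, hv, this, if_false, h2]

namespace CliffordPair

variable {G V : W → Op H} (h : CliffordPair G V)

theorem norm_word (h : CliffordPair G V) (S : Finset W) (ψ : H) :
    ∀ l : List W, ‖word G S ψ l‖ = ‖ψ‖
  | [] => rfl
  | v :: l => by
    by_cases hv : v ∈ S
    · simp only [word, hv, if_true, h.G_norm, norm_word h S ψ l]
    · simp only [word, hv, if_false, norm_word h S ψ l]

/-- `V v` passes every letter of the word except `G v`, where it picks up `-1`; `Nodup` ensures that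
this letter occurs at most once. The joint eigenvalues thus read off the set `S`. -/
theorem V_word (h : CliffordPair G V) (S : Finset W) (ψ : H) (hψ : ∀ v, V v ψ = ψ) (v : W) :
    ∀ l : List W, l.Nodup →
      V v (word G S ψ l) = (if v ∈ S ∧ v ∈ l then (-1 : ℂ) else 1) • word G S ψ l
  | [], _ => by simp [word, hψ]
  | w :: l, hl => by
    rw [List.nodup_cons] at hl
    have ih := V_word h S ψ hψ v l hl.2
    by_cases hw : w ∈ S
    · simp only [word, hw, if_true]
      by_cases hvw : v = w
      · subst hvw
        have e := LinearMap.congr_fun (h.GV_self v) (word G S ψ l)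
        simp only [Module.End.mul_apply, LinearMap.neg_apply] at e
        rw [ih] at e
        simp only [hl.1, and_false, if_false, one_smul] at e
        rw [← neg_eq_iff_eq_neg] at e
        rw [if_pos ⟨hw, by simp⟩, neg_one_smul, e]
      · have e := LinearMap.congr_fun (h.GV_comm w v (Ne.symm hvw)) (word G S ψ l)
        simp only [Module.End.mul_apply] at e
        rw [← e, ih, map_smul]
        simp [hvw]
    · simp only [word, hw, if_false]
      rw [ih]
      by_cases hvw : v = w
      · subst hvw
        simp [hw]
      · simp [hvw]

/-- `G v` moves to its own slot, anticommuting with the letters in front of it, and there it is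
inserted or cancels against itself. Sign and new set depend on `v`, `S` and `l` alone, which is what
makes two representations comparable. -/
theorem G_word (h : CliffordPair G V) (S : Finset W) (ψ : H) (v : W) :
    ∀ l : List W, l.Nodup → v ∈ l →
      G v (word G S ψ l) = wordSign v S l • word G (symmDiff S {v}) ψ l
  | [], _, hv => by simp at hv
  | w :: l, hl, hv => by
    rw [List.nodup_cons] at hl
    by_cases hvw : v = w
    · subst hvw
      have hc : word G S ψ l = word G (symmDiff S {v}) ψ l := by
        apply word_congr
        intro u hu
        have : u ≠ v := fun e => hl.1 (e ▸ hu)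
        simp [Finset.mem_symmDiff, this]
      have hm : v ∈ symmDiff S {v} ↔ v ∉ S := by simp [Finset.mem_symmDiff]
      by_cases hS : v ∈ S
      · simp only [word, wordSign, hS, hm, not_true, if_true, if_false, one_smul, ← hc]
        exact LinearMap.congr_fun (h.G_sq v) _
      · simp only [word, wordSign, hS, hm, not_false_iff, if_true, if_false, one_smul, ← hc]
    · have hv' : v ∈ l := by simpa [hvw] using hv
      have ih := G_word h S ψ v l hl.2 hv'
      have hm : w ∈ symmDiff S {v} ↔ w ∈ S := by
        simp [Finset.mem_symmDiff, Ne.symm hvw]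
      by_cases hS : w ∈ S
      · simp only [word, wordSign, hS, hm, hvw, if_true, if_false]
        have e := LinearMap.congr_fun (h.G_anticomm v w hvw) (word G S ψ l)
        simp only [Module.End.mul_apply, LinearMap.neg_apply] at e
        rw [e, ih, map_smul, neg_one_mul, neg_smul]
      · simp only [word, wordSign, hS, hm, hvw, if_false, one_mul]
        exact ih

variable [Fintype W]

/-- The space of vectors fixed by all `V v` is one-dimensional in a representation of dimension
`2 ^ |W|`. -/
theorem finrank_fixed (h : CliffordPair G V)
    (hdim : Module.finrank ℂ H = 2 ^ Fintype.card W) :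
    Module.finrank ℂ (jointFixed V (Finset.univ : Finset W).toList) = 1 := by
  have key := two_pow_mul_finrank_jointFixed V G (Finset.univ : Finset W).toList
    (Finset.nodup_toList _) h.V_comm h.V_sq
    (fun v x y hxy => by
      have hx := LinearMap.congr_fun (h.G_sq v) x
      have hy := LinearMap.congr_fun (h.G_sq v) y
      simp only [Module.End.mul_apply, Module.End.one_apply] at hx hy
      rw [← hx, hxy, hy]) h.GV_self h.GV_comm
  rw [hdim, Finset.length_toList, Finset.card_univ] at key
  exact Nat.eq_of_mul_eq_mul_left (by positivity) (key.trans (mul_one _).symm)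

theorem exists_fixed (h : CliffordPair G V)
    (hdim : Module.finrank ℂ H = 2 ^ Fintype.card W) :
    ∃ Ω : H, ‖Ω‖ = 1 ∧ (∀ v, V v Ω = Ω) ∧
      ∀ ψ : H, (∀ v, V v ψ = ψ) → ∃ c : ℂ, ψ = c • Ω := by
  have h1 := h.finrank_fixed hdim
  rw [finrank_eq_one_iff'] at h1
  obtain ⟨⟨ω, hω⟩, hne, hspan⟩ := h1
  have hne' : ω ≠ 0 := fun e => hne (Subtype.ext e)
  have hn : (‖ω‖ : ℂ) ≠ 0 := by
    exact_mod_cast norm_ne_zero_iff.2 hne'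
  refine ⟨((‖ω‖ : ℂ)⁻¹) • ω, ?_, ?_, ?_⟩
  · rw [norm_smul, norm_inv, Complex.norm_real, norm_norm]
    exact inv_mul_cancel₀ (norm_ne_zero_iff.2 hne')
  · intro v
    rw [map_smul, hω v (by simp)]
  · intro ψ hψ
    obtain ⟨c, hc⟩ := hspan ⟨ψ, fun v _ => hψ v⟩
    refine ⟨c * ‖ω‖, ?_⟩
    rw [smul_smul, mul_assoc, mul_inv_cancel₀ hn, mul_one]
    exact (congrArg Subtype.val hc).symm

/-- Two distinct sets differ in some `v`, and then the two words are eigenvectors of the symmetric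
`V v` for the eigenvalues `-1` and `1`. -/
theorem orthonormal_word (h : CliffordPair G V) {Ω : H} (hΩ : ‖Ω‖ = 1) (hV : ∀ v, V v Ω = Ω) :
    Orthonormal ℂ (fun S : Finset W => word G S Ω (Finset.univ : Finset W).toList) := by
  refine ⟨fun S => by rw [h.norm_word, hΩ], ?_⟩
  have key : ∀ (S T : Finset W) (v : W), v ∈ S → v ∉ T →
      inner ℂ (word G S Ω (Finset.univ : Finset W).toList)
        (word G T Ω (Finset.univ : Finset W).toList) = 0 := by
    intro S T v hS hT
    have e := h.V_symm v (word G S Ω (Finset.univ : Finset W).toList)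
      (word G T Ω (Finset.univ : Finset W).toList)
    rw [h.V_word S Ω hV v _ (Finset.nodup_toList _),
      h.V_word T Ω hV v _ (Finset.nodup_toList _)] at e
    simp only [hS, hT, Finset.mem_toList, Finset.mem_univ, and_true, if_true, if_false, neg_smul,
      one_smul, inner_neg_left] at e
    exact self_eq_neg.1 e.symm
  intro S T hST
  by_cases hsub : S ⊆ T
  · obtain ⟨v, hv, hv'⟩ : ∃ v ∈ T, v ∉ S := by
      by_contra! hcon
      exact hST (Finset.Subset.antisymm hsub hcon)
    exact inner_eq_zero_symm.1 (key T S v hv hv')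
  · obtain ⟨v, hv, hv'⟩ := Finset.not_subset.1 hsub
    exact key S T v hv hv'

/-- The orthonormal basis of a representation obtained by applying words in the `G v` to a vector
fixed by all `V v`. -/
def wordBasis (h : CliffordPair G V) (hdim : Module.finrank ℂ H = 2 ^ Fintype.card W) {Ω : H}
    (hΩ : ‖Ω‖ = 1) (hV : ∀ v, V v Ω = Ω) : OrthonormalBasis (Finset W) ℂ H :=
  OrthonormalBasis.mk (h.orthonormal_word hΩ hV) (by
    have := (basisOfOrthonormalOfCardEqFinrank (h.orthonormal_word hΩ hV)
      (by rw [hdim, Fintype.card_finset])).span_eq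
    rw [coe_basisOfOrthonormalOfCardEqFinrank] at this
    exact this.ge)

theorem wordBasis_apply (h : CliffordPair G V) (hdim : Module.finrank ℂ H = 2 ^ Fintype.card W)
    {Ω : H} (hΩ : ‖Ω‖ = 1) (hV : ∀ v, V v Ω = Ω) (S : Finset W) :
    h.wordBasis hdim hΩ hV S = word G S Ω (Finset.univ : Finset W).toList := by
  simp [wordBasis]

theorem G_wordBasis (h : CliffordPair G V) (hdim : Module.finrank ℂ H = 2 ^ Fintype.card W)
    {Ω : H} (hΩ : ‖Ω‖ = 1) (hV : ∀ v, V v Ω = Ω) (S : Finset W) (v : W) :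
    G v (h.wordBasis hdim hΩ hV S) =
      wordSign v S (Finset.univ : Finset W).toList • h.wordBasis hdim hΩ hV (symmDiff S {v}) := by
  rw [wordBasis_apply, wordBasis_apply]
  exact h.G_word S Ω v _ (Finset.nodup_toList _) (by simp)

theorem V_wordBasis (h : CliffordPair G V) (hdim : Module.finrank ℂ H = 2 ^ Fintype.card W)
    {Ω : H} (hΩ : ‖Ω‖ = 1) (hV : ∀ v, V v Ω = Ω) (S : Finset W) (v : W) :
    V v (h.wordBasis hdim hΩ hV S) =
      (if v ∈ S then (-1 : ℂ) else 1) • h.wordBasis hdim hΩ hV S := by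
  rw [wordBasis_apply, h.V_word S Ω hV v _ (Finset.nodup_toList _)]
  simp

/-- Two representations of dimension `2 ^ |W|` are unitarily equivalent. -/
theorem exists_intertwiner (h : CliffordPair G V) {G' V' : W → Op H'} (h' : CliffordPair G' V')
    (hdim : Module.finrank ℂ H = 2 ^ Fintype.card W)
    (hdim' : Module.finrank ℂ H' = 2 ^ Fintype.card W) :
    ∃ J : H ≃ₗᵢ[ℂ] H', (∀ v ψ, J (G v ψ) = G' v (J ψ)) ∧ ∀ v ψ, J (V v ψ) = V' v (J ψ) := by
  obtain ⟨Ω, hΩ, hV, -⟩ := h.exists_fixed hdim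
  obtain ⟨Ω', hΩ', hV', -⟩ := h'.exists_fixed hdim'
  set b := h.wordBasis hdim hΩ hV with hb
  set b' := h'.wordBasis hdim' hΩ' hV' with hb'
  have hJ : ∀ S, b.equiv b' (Equiv.refl _) (b S) = b' S := by
    intro S
    rw [OrthonormalBasis.equiv_apply_basis]
    rfl
  -- Identifying the word bases intertwines everything, since the coefficients in `G_wordBasis` and
  -- `V_wordBasis` do not depend on the representation.
  refine ⟨b.equiv b' (Equiv.refl _), fun v => ?_, fun v => ?_⟩
  · have : (b.equiv b' (Equiv.refl _)).toLinearEquiv.toLinearMap ∘ₗ G v =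
        G' v ∘ₗ (b.equiv b' (Equiv.refl _)).toLinearEquiv.toLinearMap := by
      refine b.toBasis.ext fun S => ?_
      simp only [OrthonormalBasis.coe_toBasis, LinearMap.comp_apply, LinearEquiv.coe_coe,
        LinearIsometryEquiv.coe_toLinearEquiv]
      rw [hJ, h.G_wordBasis, map_smul, hJ, h'.G_wordBasis]
    exact LinearMap.congr_fun this
  · have : (b.equiv b' (Equiv.refl _)).toLinearEquiv.toLinearMap ∘ₗ V v =
        V' v ∘ₗ (b.equiv b' (Equiv.refl _)).toLinearEquiv.toLinearMap := by
      refine b.toBasis.ext fun S => ?_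
      simp only [OrthonormalBasis.coe_toBasis, LinearMap.comp_apply, LinearEquiv.coe_coe,
        LinearIsometryEquiv.coe_toLinearEquiv]
      rw [hJ, h.V_wordBasis, map_smul, hJ, h'.V_wordBasis]
    exact LinearMap.congr_fun this

/-- A representation of dimension `2 ^ |W|` is irreducible: its commutant consists of scalars. -/
theorem commutant (h : CliffordPair G V) (hdim : Module.finrank ℂ H = 2 ^ Fintype.card W)
    (X : Op H) (hG : ∀ v, X * G v = G v * X) (hV : ∀ v, X * V v = V v * X) :
    ∃ c : ℂ, ∀ ψ, X ψ = c • ψ := by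
  obtain ⟨Ω, hΩ, hVΩ, hspan⟩ := h.exists_fixed hdim
  -- `X Ω` is again fixed by all `V v`, hence lies on the line of `Ω`; the scalar then propagates
  -- along words.
  obtain ⟨c, hc⟩ := hspan (X Ω) (fun v => by
    have := LinearMap.congr_fun (hV v) Ω
    rw [Module.End.mul_apply, Module.End.mul_apply, hVΩ] at this
    exact this.symm)
  refine ⟨c, ?_⟩
  have hw : ∀ (S : Finset W) (l : List W), X (word G S Ω l) = c • word G S Ω l := by
    intro S l
    induction l with
    | nil => exact hc
    | cons v l ih =>
      by_cases hv : v ∈ S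
      · simp only [word, hv, if_true]
        have := LinearMap.congr_fun (hG v) (word G S Ω l)
        rw [Module.End.mul_apply, Module.End.mul_apply, ih, map_smul] at this
        exact this
      · simp only [word, hv, if_false]
        exact ih
  have : X = c • (1 : Op H) := by
    refine (h.wordBasis hdim hΩ hVΩ).toBasis.ext fun S => ?_
    simp only [OrthonormalBasis.coe_toBasis, wordBasis_apply, hw]
    simp
  intro ψ
  rw [this]
  simp

end CliffordPair

end CliffordPairs

/-! ### Calculus of operators that commute up to a scalar. -/

section SignCommutation

variable {H : Type} [NormedAddCommGroup H] [InnerProductSpace ℂ H]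

/-- `A` and `B` commute up to the scalar `s`. -/
def CommuteBy (s : ℂ) (A B : Op H) : Prop := A * B = s • (B * A)

theorem CommuteBy.mul_right {s t : ℂ} {A B C : Op H} (h : CommuteBy s A B)
    (h' : CommuteBy t A C) : CommuteBy (s * t) A (B * C) := by
  unfold CommuteBy at *
  rw [← mul_assoc, h, smul_mul_assoc, mul_assoc, h', mul_smul_comm, smul_smul, mul_assoc]

theorem CommuteBy.mul_left {s t : ℂ} {A B C : Op H} (h : CommuteBy s A C)
    (h' : CommuteBy t B C) : CommuteBy (s * t) (A * B) C := by
  unfold CommuteBy at *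
  rw [mul_assoc, h', mul_smul_comm, ← mul_assoc, h, smul_mul_assoc, smul_smul, mul_assoc,
    mul_comm t s]

theorem CommuteBy.smul_left {s : ℂ} {A B : Op H} (h : CommuteBy s A B) (c : ℂ) :
    CommuteBy s (c • A) B := by
  unfold CommuteBy at *
  rw [smul_mul_assoc, h, mul_smul_comm, smul_comm]

theorem CommuteBy.smul_right {s : ℂ} {A B : Op H} (h : CommuteBy s A B) (c : ℂ) :
    CommuteBy s A (c • B) := by
  unfold CommuteBy at *
  rw [mul_smul_comm, h, smul_mul_assoc, smul_comm]

theorem CommuteBy.neg_left {s : ℂ} {A B : Op H} (h : CommuteBy s A B) :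
    CommuteBy s (-A) B := by
  have := h.smul_left (-1)
  rwa [neg_one_smul] at this

theorem CommuteBy.neg_right {s : ℂ} {A B : Op H} (h : CommuteBy s A B) :
    CommuteBy s A (-B) := by
  have := h.smul_right (-1)
  rwa [neg_one_smul] at this

theorem CommuteBy.symm {s : ℂ} {A B : Op H} (h : CommuteBy s A B) (hs : s * s = 1) :
    CommuteBy s B A := by
  unfold CommuteBy at *
  rw [h, smul_smul, hs, one_smul]

theorem CommuteBy.one_left (A : Op H) : CommuteBy 1 1 A := by
  simp [CommuteBy]

theorem CommuteBy.one_right (A : Op H) : CommuteBy 1 A 1 := by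
  simp [CommuteBy]

theorem CommuteBy.self (A : Op H) : CommuteBy 1 A A := by
  simp [CommuteBy]

theorem CommuteBy.commute {A B : Op H} (h : CommuteBy 1 A B) : A * B = B * A := by
  simpa [CommuteBy] using h

theorem CommuteBy.anticommute {A B : Op H} (h : CommuteBy (-1) A B) : A * B = -(B * A) := by
  simpa [CommuteBy] using h

theorem CommuteBy.list_prod {ι : Type} {s : ι → ℂ} {A : Op H} {B : ι → Op H}
    (h : ∀ i, CommuteBy (s i) A (B i)) (l : List ι) :
    CommuteBy (l.map s).prod A (l.map B).prod := by
  induction l with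
  | nil => simpa using CommuteBy.one_right A
  | cons i l ih => simpa using (h i).mul_right ih

/-- The sign `-1` if `a = b` and `1` otherwise. -/
def eqSign {α : Type} [DecidableEq α] (a b : α) : ℂ := if a = b then -1 else 1

variable {α : Type} [DecidableEq α]

theorem eqSign_self (a : α) : eqSign a a = -1 := by simp [eqSign]

theorem eqSign_of_ne {a b : α} (h : a ≠ b) : eqSign a b = 1 := by simp [eqSign, h]

theorem eqSign_sq (a b : α) : eqSign a b * eqSign a b = 1 := by
  by_cases h : a = b <;> simp [eqSign, h]

theorem eqSign_comm (a b : α) : eqSign a b = eqSign b a := by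
  simp [eqSign, eq_comm]

theorem prod_eqSign [Fintype α] (a : α) :
    ((Finset.univ : Finset α).toList.map (eqSign a)).prod = -1 := by
  rw [Finset.prod_map_toList]
  rw [Finset.prod_eq_single a]
  · exact eqSign_self a
  · intro b _ hb
    exact eqSign_of_ne hb.symm
  · simp

end SignCommutation

/-! ### Edge and vertex relations on the lattice, and their reduction to a Clifford pair. -/

section EdgeRelations

variable {L₁ L₂ : ℕ} {H H' : Type} [NormedAddCommGroup H] [InnerProductSpace ℂ H]
  [FiniteDimensional ℂ H] [NormedAddCommGroup H'] [InnerProductSpace ℂ H']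
  [FiniteDimensional ℂ H']

/-- The local relations of edge and vertex operators on the lattice. -/
structure EdgeRelations (E : Vertex L₁ L₂ → Vertex L₁ L₂ → Op H) (V : Vertex L₁ L₂ → Op H) :
    Prop where
  E_sq : ∀ i j, (lattice L₁ L₂).Adj i j → E i j * E i j = 1
  E_anti : ∀ i j, (lattice L₁ L₂).Adj i j → E j i = -E i j
  E_norm : ∀ i j, (lattice L₁ L₂).Adj i j → ∀ ψ, ‖E i j ψ‖ = ‖ψ‖
  V_sq : ∀ i, V i * V i = 1
  V_symm : ∀ i, (V i).IsSymmetric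
  V_comm : ∀ i j, V i * V j = V j * V i
  EE : ∀ i j k l, (lattice L₁ L₂).Adj i j → (lattice L₁ L₂).Adj k l →
    CommuteBy (eqSign i k * eqSign i l * (eqSign j k * eqSign j l)) (E i j) (E k l)
  EV : ∀ i j k, (lattice L₁ L₂).Adj i j → CommuteBy (eqSign i k * eqSign j k) (E i j) (V k)

/-- The loop operators of all faces are trivial. -/
def TrivialLoops (E : Vertex L₁ L₂ → Vertex L₁ L₂ → Op H) : Prop :=
  ∀ f : Face L₁ L₂, E (corner f 0) (corner f 1) * E (corner f 1) (corner f 2) *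
    E (corner f 2) (corner f 3) * E (corner f 3) (corner f 0) = 1

theorem lattice_adj_iff (u v : Vertex L₁ L₂) : (lattice L₁ L₂).Adj u v ↔
    (((u.1 : ℕ) + 1 = v.1 ∨ (v.1 : ℕ) + 1 = u.1) ∧ u.2 = v.2) ∨
    (((u.2 : ℕ) + 1 = v.2 ∨ (v.2 : ℕ) + 1 = u.2) ∧ u.1 = v.1) := by
  simp only [lattice, SimpleGraph.boxProd_adj, SimpleGraph.pathGraph_adj]

/-- The edges of the comb-shaped spanning tree: the bottom row and all columns. -/
def TreeEdge (u v : Vertex L₁ L₂) : Prop :=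
  ((u.1 : ℕ) + 1 = v.1 ∧ u.2 = v.2 ∧ (u.2 : ℕ) = 0) ∨ ((u.2 : ℕ) + 1 = v.2 ∧ u.1 = v.1)

theorem TreeEdge.adj {u v : Vertex L₁ L₂} (h : TreeEdge u v) : (lattice L₁ L₂).Adj u v := by
  rw [lattice_adj_iff]
  unfold TreeEdge at h
  tauto

/-- The operator of the path along the bottom row. -/
def rowOp (E : Vertex L₁ L₂ → Vertex L₁ L₂ → Op H) (hy : 0 < L₂) : ∀ x, x < L₁ → Op H
  -- The model is `-i γ_o γ_v`, which equals `-i` at `v = o`. The factor `i` in each step preserves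
  -- this form: `i (-i γ_o γ_u) (-i γ_u γ_v) = -i γ_o γ_v`.
  | 0, _ => -Complex.I • 1
  | x + 1, h => Complex.I • (rowOp E hy x (Nat.lt_of_succ_lt h) *
      E (⟨x, Nat.lt_of_succ_lt h⟩, ⟨0, hy⟩) (⟨x + 1, h⟩, ⟨0, hy⟩))

/-- The operator of the path along the bottom row and then up the column `x`. -/
def columnOp (E : Vertex L₁ L₂ → Vertex L₁ L₂ → Op H) (x : Fin L₁) : ∀ y, y < L₂ → Op H
  | 0, h => rowOp E h x x.2
  | y + 1, h => Complex.I • (columnOp E x y (Nat.lt_of_succ_lt h) *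
      E (x, ⟨y, Nat.lt_of_succ_lt h⟩) (x, ⟨y + 1, h⟩))

/-- The operator of the path in the spanning tree from the lower left corner to `v`. -/
def pathOp (E : Vertex L₁ L₂ → Vertex L₁ L₂ → Op H) (v : Vertex L₁ L₂) : Op H :=
  columnOp E v.1 v.2 v.2.2

theorem pathOp_tree (E : Vertex L₁ L₂ → Vertex L₁ L₂ → Op H) {u v : Vertex L₁ L₂}
    (h : TreeEdge u v) : pathOp E v = Complex.I • (pathOp E u * E u v) := by
  obtain ⟨⟨ux, hux⟩, ⟨uy, huy⟩⟩ := u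
  obtain ⟨⟨vx, hvx⟩, ⟨vy, hvy⟩⟩ := v
  rcases h with ⟨h1, h2, h3⟩ | ⟨h1, h2⟩
  · simp only [Fin.mk.injEq] at h1 h2 h3
    subst h1 h2 h3
    rfl
  · simp only [Fin.mk.injEq] at h1 h2
    subst h1 h2
    rfl

theorem pathOp_origin (E : Vertex L₁ L₂ → Vertex L₁ L₂ → Op H) (o : Vertex L₁ L₂)
    (h1 : (o.1 : ℕ) = 0) (h2 : (o.2 : ℕ) = 0) : pathOp E o = -Complex.I • 1 := by
  obtain ⟨⟨ux, hux⟩, ⟨uy, huy⟩⟩ := o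
  simp only at h1 h2
  subst h1 h2
  rfl

theorem tree_induction {P : Vertex L₁ L₂ → Prop} (o : Vertex L₁ L₂) (h1 : (o.1 : ℕ) = 0)
    (h2 : (o.2 : ℕ) = 0) (h0 : P o) (hstep : ∀ u v, TreeEdge u v → P u → P v) : ∀ v, P v := by
  have hrow : ∀ x (hx : x < L₁), P (⟨x, hx⟩, o.2) := by
    intro x
    induction x with
    | zero =>
      intro hx
      have : o = (⟨0, hx⟩, o.2) := Prod.ext (Fin.ext h1) rfl
      rwa [← this]
    | succ x ih =>
      intro hx
      exact hstep (⟨x, Nat.lt_of_succ_lt hx⟩, o.2) _ (Or.inl ⟨rfl, rfl, h2⟩) (ih _)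
  have hcol : ∀ y (hy : y < L₂) (x : Fin L₁), P (x, ⟨y, hy⟩) := by
    intro y
    induction y with
    | zero =>
      intro hy x
      have : o.2 = ⟨0, hy⟩ := Fin.ext h2
      rw [← this]
      exact hrow x x.2
    | succ y ih =>
      intro hy x
      exact hstep (x, ⟨y, Nat.lt_of_succ_lt hy⟩) _ (Or.inr ⟨rfl, rfl⟩) (ih _ x)
  exact fun v => hcol v.2 v.2.2 v.1

namespace EdgeRelations

variable {E : Vertex L₁ L₂ → Vertex L₁ L₂ → Op H} {V : Vertex L₁ L₂ → Op H}

/-- Only the endpoints `o` and `v` of the path matter: an intermediate vertex belongs to two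
consecutive edges, and its sign appears squared. -/
theorem pathOp_edge (h : EdgeRelations E V) (o : Vertex L₁ L₂) (h1 : (o.1 : ℕ) = 0)
    (h2 : (o.2 : ℕ) = 0) {k l : Vertex L₁ L₂} (hkl : (lattice L₁ L₂).Adj k l) (v) :
    CommuteBy (eqSign o k * eqSign o l * (eqSign v k * eqSign v l)) (pathOp E v) (E k l) := by
  induction v using tree_induction o h1 h2 with
  | h0 =>
    rw [pathOp_origin E o h1 h2]
    have : eqSign o k * eqSign o l * (eqSign o k * eqSign o l) = 1 := by
      linear_combination eqSign o l * eqSign o l * eqSign_sq o k + eqSign_sq o l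
    rw [this]
    exact (CommuteBy.one_left _).smul_left _
  | hstep u v huv ih =>
    rw [pathOp_tree E huv]
    have := (ih.mul_left (h.EE u v k l huv.adj hkl)).smul_left Complex.I
    convert this using 1
    linear_combination -(eqSign o k * eqSign o l * eqSign v k * eqSign v l *
      (eqSign u l * eqSign u l * eqSign_sq u k + eqSign_sq u l))

theorem pathOp_vertex (h : EdgeRelations E V) (o : Vertex L₁ L₂) (h1 : (o.1 : ℕ) = 0)
    (h2 : (o.2 : ℕ) = 0) (k v : Vertex L₁ L₂) :
    CommuteBy (eqSign o k * eqSign v k) (pathOp E v) (V k) := by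
  induction v using tree_induction o h1 h2 with
  | h0 =>
    rw [pathOp_origin E o h1 h2, eqSign_sq]
    exact (CommuteBy.one_left _).smul_left _
  | hstep u v huv ih =>
    rw [pathOp_tree E huv]
    have := (ih.mul_left (h.EV u v k huv.adj)).smul_left Complex.I
    convert this using 1
    linear_combination -(eqSign o k * eqSign v k * eqSign_sq u k)

theorem pathOp_sq (h : EdgeRelations E V) (o : Vertex L₁ L₂) (h1 : (o.1 : ℕ) = 0)
    (h2 : (o.2 : ℕ) = 0) (v : Vertex L₁ L₂) : pathOp E v * pathOp E v = eqSign o v • 1 := by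
  induction v using tree_induction o h1 h2 with
  | h0 =>
    rw [pathOp_origin E o h1 h2, eqSign_self, smul_mul_smul_comm, one_mul, neg_mul_neg,
      Complex.I_mul_I]
  | hstep u v huv ih =>
    have e := h.pathOp_edge o h1 h2 huv.adj u
    have hne : u ≠ v := huv.adj.ne
    rw [eqSign_self, eqSign_of_ne hne, mul_one] at e
    rw [pathOp_tree E huv, smul_mul_smul_comm, Complex.I_mul_I]
    have e2 : pathOp E u * E u v * (pathOp E u * E u v) = -eqSign o v • 1 := by
      have e3 := (e.symm (by
        linear_combination eqSign o v * eqSign o v * eqSign_sq o u + eqSign_sq o v))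
      unfold CommuteBy at e3
      calc pathOp E u * E u v * (pathOp E u * E u v)
          = pathOp E u * (E u v * pathOp E u) * E u v := by simp only [mul_assoc]
        _ = (eqSign o u * eqSign o v * -1) • (pathOp E u * pathOp E u * (E u v * E u v)) := by
            rw [e3, mul_smul_comm, smul_mul_assoc]
            simp only [mul_assoc]
        _ = -eqSign o v • 1 := by
            rw [ih, h.E_sq u v huv.adj, mul_one, smul_smul]
            congr 1
            linear_combination -eqSign o v * eqSign_sq o u
    rw [e2, smul_smul]
    congr 1
    ring

/-- The sign is that of `-i γ_o γ_v` against `-i γ_o γ_w`: it is `-1` when `o`, `v`, `w` are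
pairwise distinct and `1` otherwise. -/
theorem pathOp_pathOp (h : EdgeRelations E V) (o : Vertex L₁ L₂) (h1 : (o.1 : ℕ) = 0)
    (h2 : (o.2 : ℕ) = 0) (v w : Vertex L₁ L₂) :
    CommuteBy (-(eqSign v o * eqSign o w * eqSign v w)) (pathOp E v) (pathOp E w) := by
  induction w using tree_induction o h1 h2 with
  | h0 =>
    rw [pathOp_origin E o h1 h2, eqSign_self]
    have : -(eqSign v o * -1 * eqSign v o) = 1 := by linear_combination eqSign_sq v o
    rw [this]
    exact (CommuteBy.one_right _).smul_right _
  | hstep u w huw ih =>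
    rw [pathOp_tree E huw]
    have := (ih.mul_right (h.pathOp_edge o h1 h2 huw.adj v)).smul_right Complex.I
    convert this using 1
    linear_combination (eqSign v o * eqSign o w * eqSign v w *
      (eqSign v u * eqSign v u * eqSign_sq o u + eqSign_sq v u))

theorem norm_pathOp (h : EdgeRelations E V) (o : Vertex L₁ L₂) (h1 : (o.1 : ℕ) = 0)
    (h2 : (o.2 : ℕ) = 0) (v : Vertex L₁ L₂) : ∀ ψ, ‖pathOp E v ψ‖ = ‖ψ‖ := by
  induction v using tree_induction o h1 h2 with
  | h0 =>
    intro ψ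
    rw [pathOp_origin E o h1 h2]
    simp [norm_smul]
  | hstep u v huv ih =>
    intro ψ
    rw [pathOp_tree E huv]
    simp [norm_smul, ih, h.E_norm u v huv.adj]

/-- Every edge operator is determined by the path operators. -/
theorem edge_eq_pathOp (h : EdgeRelations E V) (hloop : TrivialLoops E) (o : Vertex L₁ L₂)
    (h1 : (o.1 : ℕ) = 0) (h2 : (o.2 : ℕ) = 0) {u v : Vertex L₁ L₂}
    (huv : (lattice L₁ L₂).Adj u v) :
    E u v = (-Complex.I * eqSign o u) • (pathOp E u * pathOp E v) := by
  -- The factor `eqSign o u` handles the origin, where `pathOp` is a scalar: in the model `E u v =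
  -- -i γ_u γ_v`, and `pathOp E u * pathOp E v` is `γ_u γ_v` for `u ≠ o` but `-γ_u γ_v` for `u = o`.
  have hflip : ∀ u v, (lattice L₁ L₂).Adj u v →
      E u v = (-Complex.I * eqSign o u) • (pathOp E u * pathOp E v) →
      E v u = (-Complex.I * eqSign o v) • (pathOp E v * pathOp E u) := by
    intro u v huv e
    have e2 := h.pathOp_pathOp o h1 h2 u v
    unfold CommuteBy at e2
    rw [eqSign_of_ne huv.ne, mul_one] at e2
    rw [h.E_anti u v huv, e, e2, smul_smul, ← neg_smul]
    congr 1
    rw [eqSign_comm u o]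
    linear_combination (-Complex.I * eqSign o v) * eqSign_sq o u
  have htree : ∀ u v, TreeEdge u v →
      E u v = (-Complex.I * eqSign o u) • (pathOp E u * pathOp E v) := by
    intro u v huv
    rw [pathOp_tree E huv, mul_smul_comm, ← mul_assoc, h.pathOp_sq o h1 h2, smul_mul_assoc,
      one_mul, smul_smul, smul_smul]
    have : -Complex.I * eqSign o u * (Complex.I * eqSign o u) = 1 := by
      linear_combination -(eqSign o u * eqSign o u) * Complex.I_mul_I + eqSign_sq o u
    rw [mul_assoc (-Complex.I * eqSign o u), this, one_smul]
  -- Horizontal edges above the bottom row are not in the tree. Going upwards, the face below such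
  -- an edge has its bottom edge known by induction and its two sides in the tree, so its trivial
  -- loop determines the fourth edge.
  have hhor : ∀ y (hy : y < L₂) (x : ℕ) (hx : x + 1 < L₁),
      E (⟨x, Nat.lt_of_succ_lt hx⟩, ⟨y, hy⟩) (⟨x + 1, hx⟩, ⟨y, hy⟩) =
        (-Complex.I * eqSign o (⟨x, Nat.lt_of_succ_lt hx⟩, ⟨y, hy⟩)) •
          (pathOp E (⟨x, Nat.lt_of_succ_lt hx⟩, ⟨y, hy⟩) * pathOp E (⟨x + 1, hx⟩, ⟨y, hy⟩)) := by
    intro y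
    induction y with
    | zero =>
      intro hy x hx
      exact htree _ _ (Or.inl ⟨rfl, rfl, rfl⟩)
    | succ y ih =>
      intro hy x hx
      have l := hloop (⟨x, by omega⟩, ⟨y, by omega⟩)
      set p : Vertex L₁ L₂ := (⟨x, Nat.lt_of_succ_lt hx⟩, ⟨y, Nat.lt_of_succ_lt hy⟩) with hp
      set q : Vertex L₁ L₂ := (⟨x + 1, hx⟩, ⟨y, Nat.lt_of_succ_lt hy⟩) with hq
      set r : Vertex L₁ L₂ := (⟨x + 1, hx⟩, ⟨y + 1, hy⟩) with hr
      set s : Vertex L₁ L₂ := (⟨x, Nat.lt_of_succ_lt hx⟩, ⟨y + 1, hy⟩) with hs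
      have hpq : (lattice L₁ L₂).Adj p q := by
        rw [lattice_adj_iff]
        exact Or.inl ⟨Or.inl rfl, rfl⟩
      have hrs : (lattice L₁ L₂).Adj r s := by
        rw [lattice_adj_iff]
        exact Or.inl ⟨Or.inr rfl, rfl⟩
      have tqr : TreeEdge q r := Or.inr ⟨rfl, rfl⟩
      have tps : TreeEdge p s := Or.inr ⟨rfl, rfl⟩
      change E p q * E q r * E r s * E s p = 1 at l
      apply hflip r s hrs
      have e1 := ih (Nat.lt_of_succ_lt hy) x hx
      rw [← hp, ← hq] at e1
      have e2 := htree _ _ tqr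
      have e3 := hflip _ _ tps.adj (htree _ _ tps)
      -- the products of the three known edges on both sides
      have k1 : E r s = E q r * E p q * E s p := by
        have a1 := h.E_sq p q hpq
        have a2 := h.E_sq q r tqr.adj
        have a3 := h.E_sq s p tps.adj.symm
        calc E r s = (E q r * (E p q * E p q) * E q r) * E r s * (E s p * E s p) := by
              rw [a1, a3, mul_one, mul_one, a2, one_mul]
          _ = E q r * E p q * (E p q * E q r * E r s * E s p) * E s p := by
              simp only [mul_assoc]
          _ = _ := by rw [l, mul_one]
      have sq := h.pathOp_sq o h1 h2
      have c1 : CommuteBy (-(eqSign q o * eqSign o r * eqSign q r)) (pathOp E q) (pathOp E r) :=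
        h.pathOp_pathOp o h1 h2 q r
      have c2 : CommuteBy (-(eqSign p o * eqSign o q * eqSign p q)) (pathOp E p) (pathOp E q) :=
        h.pathOp_pathOp o h1 h2 p q
      have c3 : CommuteBy (-(eqSign s o * eqSign o p * eqSign s p)) (pathOp E s) (pathOp E p) :=
        h.pathOp_pathOp o h1 h2 s p
      rw [eqSign_of_ne tqr.adj.ne, mul_one] at c1
      rw [eqSign_of_ne hpq.ne, mul_one] at c2
      rw [eqSign_of_ne tps.adj.ne.symm, mul_one] at c3
      unfold CommuteBy at c1 c2 c3
      rw [k1, e1, e2, e3, c1, c2, c3]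
      simp only [smul_mul_assoc, mul_smul_comm, smul_smul]
      have e4 : pathOp E r * pathOp E q * (pathOp E q * pathOp E p) *
          (pathOp E p * pathOp E s) = (eqSign o p * eqSign o q) • (pathOp E r * pathOp E s) := by
        calc _ = pathOp E r * (pathOp E q * pathOp E q) * (pathOp E p * pathOp E p) *
              pathOp E s := by simp only [mul_assoc]
          _ = _ := by
            rw [sq, sq]
            simp only [smul_mul_assoc, mul_smul_comm, smul_smul, mul_one]
      rw [e4, smul_smul]
      congr 1
      rw [eqSign_comm q o, eqSign_comm p o, eqSign_comm s o]
      have i3 : Complex.I * Complex.I * Complex.I = -Complex.I := by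
        rw [Complex.I_mul_I, neg_one_mul]
      have qp := eqSign_sq o p
      have qq := eqSign_sq o q
      have qs := eqSign_sq o s
      generalize eqSign o p = a at *
      generalize eqSign o q = b at *
      generalize eqSign o r = c at *
      generalize eqSign o s = d at *
      -- Every sign occurs squared except that of `r`, the tail of the new edge.
      trans Complex.I * Complex.I * Complex.I * (a * a) * (a * a) * (b * b) * (b * b) * (d * d) * c
      · ring
      · rw [i3, qp, qq, qs]
        ring
  rw [lattice_adj_iff] at huv
  obtain ⟨⟨ux, hux⟩, ⟨uy, huy⟩⟩ := u
  obtain ⟨⟨vx, hvx⟩, ⟨vy, hvy⟩⟩ := v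
  simp only [Fin.mk.injEq] at huv
  rcases huv with ⟨hx | hx, rfl⟩ | ⟨hy | hy, rfl⟩
  · subst hx
    exact hhor _ _ _ _
  · subst hx
    apply hflip _ _ _ (hhor _ huy _ _)
    rw [lattice_adj_iff]
    exact Or.inl ⟨Or.inl rfl, rfl⟩
  · subst hy
    exact htree _ _ (Or.inr ⟨rfl, rfl⟩)
  · subst hy
    exact hflip _ _ (TreeEdge.adj (Or.inr ⟨rfl, rfl⟩)) (htree _ _ (Or.inr ⟨rfl, rfl⟩))

/-- The path operators and the vertex operators away from the origin. -/
theorem cliffordPair (h : EdgeRelations E V) (o : Vertex L₁ L₂) (h1 : (o.1 : ℕ) = 0)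
    (h2 : (o.2 : ℕ) = 0) :
    CliffordPair (fun v : {v : Vertex L₁ L₂ // v ≠ o} => pathOp E v.1) (fun v => V v.1) where
  G_sq v := by
    rw [h.pathOp_sq o h1 h2, eqSign_of_ne v.2.symm, one_smul]
  V_sq v := h.V_sq v
  G_norm v := h.norm_pathOp o h1 h2 v
  V_symm v := h.V_symm v
  G_anticomm v w hvw := by
    have := h.pathOp_pathOp o h1 h2 v w
    rw [eqSign_of_ne v.2, eqSign_of_ne w.2.symm,
      eqSign_of_ne (fun e => hvw (Subtype.ext e))] at this
    exact CommuteBy.anticommute (by simpa using this)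
  V_comm v w := h.V_comm v w
  GV_self v := by
    have := h.pathOp_vertex o h1 h2 v v
    rw [eqSign_of_ne v.2.symm, eqSign_self, one_mul] at this
    exact this.anticommute
  GV_comm v w hvw := by
    have := h.pathOp_vertex o h1 h2 w v
    rw [eqSign_of_ne w.2.symm, eqSign_of_ne (fun e => hvw (Subtype.ext e)), one_mul] at this
    exact this.commute

/-- The parity constraint makes the vertex operator at `o` redundant. This is why the Clifford pair
is indexed by `v ≠ o` and the dimension is `2 ^ (m - 1)`. -/
theorem vertex_eq_prod (h : EdgeRelations E V)
    (hprod : ((Finset.univ : Finset (Vertex L₁ L₂)).toList.map V).prod = 1) (o : Vertex L₁ L₂) :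
    V o = (((Finset.univ : Finset (Vertex L₁ L₂)).toList.erase o).map V).prod := by
  have hperm : List.Perm ((Finset.univ : Finset (Vertex L₁ L₂)).toList.map V)
      ((o :: (Finset.univ : Finset (Vertex L₁ L₂)).toList.erase o).map V) :=
    (List.perm_cons_erase (by simp)).map V
  have e := hperm.prod_eq' (by
    rw [List.pairwise_map]
    exact List.pairwise_of_forall fun x y => h.V_comm x y)
  rw [hprod, List.map_cons, List.prod_cons] at e
  calc V o = V o * (V o * (((Finset.univ : Finset (Vertex L₁ L₂)).toList.erase o).map V).prod) := by
        rw [← e, mul_one]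
    _ = _ := by rw [← mul_assoc, h.V_sq, one_mul]

theorem card_ne (o : Vertex L₁ L₂) :
    Fintype.card {v : Vertex L₁ L₂ // v ≠ o} = L₁ * L₂ - 1 := by
  rw [Fintype.card_subtype_compl, Fintype.card_subtype_eq, Fintype.card_prod, Fintype.card_fin,
    Fintype.card_fin]

/-- Representations of dimension `2 ^ (m - 1)` of the edge, loop and parity relations are unitarily
equivalent. -/
theorem exists_intertwiner (h : EdgeRelations E V)
    {E' : Vertex L₁ L₂ → Vertex L₁ L₂ → Op H'} {V' : Vertex L₁ L₂ → Op H'}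
    (h' : EdgeRelations E' V') (hloop : TrivialLoops E) (hloop' : TrivialLoops E')
    (hprod : ((Finset.univ : Finset (Vertex L₁ L₂)).toList.map V).prod = 1)
    (hprod' : ((Finset.univ : Finset (Vertex L₁ L₂)).toList.map V').prod = 1)
    (hdim : Module.finrank ℂ H = 2 ^ (L₁ * L₂ - 1))
    (hdim' : Module.finrank ℂ H' = 2 ^ (L₁ * L₂ - 1)) (hL₁ : 0 < L₁) (hL₂ : 0 < L₂) :
    ∃ J : H ≃ₗᵢ[ℂ] H',
      (∀ i j, (lattice L₁ L₂).Adj i j → ∀ ψ, J (E i j ψ) = E' i j (J ψ)) ∧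
      ∀ i ψ, J (V i ψ) = V' i (J ψ) := by
  set o : Vertex L₁ L₂ := (⟨0, hL₁⟩, ⟨0, hL₂⟩) with ho
  obtain ⟨J, hG, hV⟩ := (h.cliffordPair o rfl rfl).exists_intertwiner (h'.cliffordPair o rfl rfl)
    (by rw [hdim, card_ne]) (by rw [hdim', card_ne])
  have hG' : ∀ v ψ, J (pathOp E v ψ) = pathOp E' v (J ψ) := by
    intro v ψ
    by_cases hv : v = o
    · rw [hv, pathOp_origin E o rfl rfl, pathOp_origin E' o rfl rfl]
      simp
    · exact hG ⟨v, hv⟩ ψ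
  refine ⟨J, fun i j hij ψ => ?_, fun i ψ => ?_⟩
  · rw [h.edge_eq_pathOp hloop o rfl rfl hij, h'.edge_eq_pathOp hloop' o rfl rfl hij]
    simp [hG']
  · by_cases hi : i = o
    · rw [hi, h.vertex_eq_prod hprod o, h'.vertex_eq_prod hprod' o]
      have hnd : ∀ v ∈ (Finset.univ : Finset (Vertex L₁ L₂)).toList.erase o, v ≠ o := by
        intro v hv
        exact ((Finset.nodup_toList _).mem_erase_iff.1 hv).1
      generalize (Finset.univ : Finset (Vertex L₁ L₂)).toList.erase o = l at hnd
      induction l with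
      | nil => simp
      | cons v l ih =>
        rw [List.map_cons, List.map_cons, List.prod_cons, List.prod_cons, Module.End.mul_apply,
          Module.End.mul_apply, hV ⟨v, hnd v (by simp)⟩, ih fun w hw => hnd w (by simp [hw])]
    · exact hV ⟨i, hi⟩ ψ

/-- Path operators are products of edge operators, so `X` commutes with the whole Clifford pair,
which is irreducible in this dimension. -/
theorem commutant (h : EdgeRelations E V) (hdim : Module.finrank ℂ H = 2 ^ (L₁ * L₂ - 1))
    (hL₁ : 0 < L₁) (hL₂ : 0 < L₂) (X : Op H)
    (hE : ∀ i j, (lattice L₁ L₂).Adj i j → X * E i j = E i j * X)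
    (hV : ∀ i, X * V i = V i * X) : ∃ c : ℂ, ∀ ψ, X ψ = c • ψ := by
  set o : Vertex L₁ L₂ := (⟨0, hL₁⟩, ⟨0, hL₂⟩) with ho
  refine (h.cliffordPair o rfl rfl).commutant (by rw [hdim, card_ne]) X (fun v => ?_)
    fun v => hV v
  obtain ⟨v, hv⟩ := v
  simp only
  clear hv
  induction v using tree_induction o rfl rfl with
  | h0 =>
    rw [pathOp_origin E o rfl rfl]
    simp
  | hstep u v huv ih =>
    rw [pathOp_tree E huv, mul_smul_comm, smul_mul_assoc, ← mul_assoc, ih, mul_assoc,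
      hE u v huv.adj, mul_assoc]

end EdgeRelations

end EdgeRelations

/-! ### Canonical anticommutation relations, Majorana and parity operators on Fock space. -/

section FockOperators

variable {ι : Type} [Fintype ι] [DecidableEq ι]

/-- The `n`-particle wave function of a vector of the Fock space, for every natural number `n`. -/
def amp (ψ : FockSpace ι) (n : ℕ) (x : Fin n → ι) : ℂ :=
  -- Antisymmetric tensors with more particles than modes vanish, so the default `0` is the correct
  -- value and the truncation of the particle number disappears from later formulas.
  if h : n < Fintype.card ι + 1 then wave ι ψ ⟨⟨n, h⟩, x⟩ else 0

theorem amp_of_lt (ψ : FockSpace ι) {n : ℕ} (h : n < Fintype.card ι + 1) (x : Fin n → ι) :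
    amp ψ n x = wave ι ψ ⟨⟨n, h⟩, x⟩ := by
  simp [amp, h]

theorem amp_fin (ψ : FockSpace ι) (n : Fin (Fintype.card ι + 1)) (x : Fin n → ι) :
    amp ψ n x = wave ι ψ ⟨n, x⟩ := amp_of_lt ψ n.2 x

theorem amp_of_card_lt (ψ : FockSpace ι) {n : ℕ} (h : Fintype.card ι < n) (x : Fin n → ι) :
    amp ψ n x = 0 := by
  have : ¬ n < Fintype.card ι + 1 := by omega
  simp [amp, this]

theorem amp_ext {ψ φ : FockSpace ι} (h : ∀ n x, amp ψ n x = amp φ n x) : ψ = φ := by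
  refine Subtype.ext ?_
  change wave ι ψ = wave ι φ
  ext c
  obtain ⟨n, x⟩ := c
  rw [← amp_fin, ← amp_fin, h]

theorem amp_add (ψ φ : FockSpace ι) (n : ℕ) (x : Fin n → ι) :
    amp (ψ + φ) n x = amp ψ n x + amp φ n x := by
  unfold amp
  split_ifs <;> simp

theorem amp_smul (c : ℂ) (ψ : FockSpace ι) (n : ℕ) (x : Fin n → ι) :
    amp (c • ψ) n x = c * amp ψ n x := by
  unfold amp
  split_ifs <;> simp

theorem amp_zero (n : ℕ) (x : Fin n → ι) : amp (0 : FockSpace ι) n x = 0 := by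
  unfold amp
  split_ifs <;> simp

theorem amp_perm (ψ : FockSpace ι) (n : ℕ) (σ : Equiv.Perm (Fin n)) (x : Fin n → ι) :
    amp ψ n (x ∘ σ) = ((Equiv.Perm.sign σ : ℤ) : ℂ) * amp ψ n x := by
  unfold amp
  split_ifs with h
  · exact ψ.2 ⟨n, h⟩ σ x
  · simp

/-- Pauli exclusion: swapping two particles in the same mode changes the sign but not the
configuration. -/
theorem amp_not_injective (ψ : FockSpace ι) {n : ℕ} {x : Fin n → ι}
    (hx : ¬ Function.Injective x) : amp ψ n x = 0 := by
  simp only [Function.Injective, not_forall] at hx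
  obtain ⟨i, j, hij, hne⟩ := hx
  have h := amp_perm ψ n (Equiv.swap i j) x
  have hc : x ∘ Equiv.swap i j = x := by
    funext k
    by_cases hi : k = i
    · subst hi
      simp [hij]
    · by_cases hj : k = j
      · subst hj
        simp [hij]
      · simp [Equiv.swap_apply_of_ne_of_ne hi hj]
  rw [hc, Equiv.Perm.sign_swap hne] at h
  have : (2 : ℂ) * amp ψ n x = 0 := by
    push_cast at h
    linear_combination h
  simpa using this

theorem amp_annih (i : ι) (ψ : FockSpace ι) (n : ℕ) (x : Fin n → ι) :
    amp (annih i ψ) n x = ((Real.sqrt (n + 1) : ℝ) : ℂ) * amp ψ (n + 1) (Fin.cons i x) := by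
  by_cases h : n < Fintype.card ι + 1
  · rw [amp_of_lt _ h]
    change annihFun i (wave ι ψ) ⟨⟨n, h⟩, x⟩ = _
    by_cases h' : n < Fintype.card ι
    · rw [amp_of_lt _ (Nat.succ_lt_succ h')]
      simp only [annihFun, h', dif_pos]
    · rw [amp_of_card_lt _ (by omega)]
      simp [annihFun, h']
  · rw [amp_of_card_lt _ (by omega), amp_of_card_lt _ (by omega), mul_zero]

/-- The action of the creation operator on coefficients. -/
def creatFun (j : ι) (f : ∀ n : ℕ, (Fin n → ι) → ℂ) : ∀ n : ℕ, (Fin n → ι) → ℂ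
  | 0, _ => 0
  | n + 1, x => ((Real.sqrt (n + 1) : ℝ) : ℂ)⁻¹ *
      ∑ k : Fin (n + 1), (if x k = j then ((Equiv.Perm.sign (Equiv.swap 0 k) : ℤ) : ℂ) *
        f n (Fin.tail (x ∘ Equiv.swap 0 k)) else 0)

theorem sign_mul_self_complex {α : Type} [Fintype α] [DecidableEq α] (σ : Equiv.Perm α) :
    ((Equiv.Perm.sign σ : ℤ) : ℂ) * ((Equiv.Perm.sign σ : ℤ) : ℂ) = 1 := by
  rcases Int.units_eq_one_or (Equiv.Perm.sign σ) with h | h <;> simp [h]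

theorem amp_tail_perm (ψ : FockSpace ι) (n : ℕ) (ρ : Equiv.Perm (Fin (n + 1))) (hρ : ρ 0 = 0)
    (y : Fin (n + 1) → ι) : amp ψ n (Fin.tail (y ∘ ρ)) =
      ((Equiv.Perm.sign ρ : ℤ) : ℂ) * amp ψ n (Fin.tail y) := by
  obtain ⟨⟨p, e⟩, rfl⟩ := Equiv.Perm.decomposeFin.symm.surjective ρ
  rw [Equiv.Perm.decomposeFin_symm_apply_zero] at hρ
  subst hρ
  have : Fin.tail (y ∘ Equiv.Perm.decomposeFin.symm (0, e)) = Fin.tail y ∘ e := by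
    funext k
    simp [Fin.tail]
  rw [this, amp_perm, Equiv.Perm.decomposeFin.symm_sign]
  simp

theorem creatFun_perm (j : ι) (ψ : FockSpace ι) (n : ℕ) (σ : Equiv.Perm (Fin n)) (x : Fin n → ι) :
    creatFun j (amp ψ) n (x ∘ σ) =
      ((Equiv.Perm.sign σ : ℤ) : ℂ) * creatFun j (amp ψ) n x := by
  cases n with
  | zero => simp [creatFun]
  | succ n =>
    simp only [creatFun]
    rw [mul_left_comm]
    congr 1
    rw [Finset.mul_sum, ← Equiv.sum_comp σ (fun k => ((Equiv.Perm.sign σ : ℤ) : ℂ) * _)]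
    refine Finset.sum_congr rfl fun k _ => ?_
    simp only [Function.comp_apply]
    split_ifs with hk
    -- `ρ` compares bringing slot `k` of `x ∘ σ` to the front with bringing slot `σ k` of `x` there.
    -- It fixes `0`, so it only permutes the other particles and contributes its sign.
    · set ρ : Equiv.Perm (Fin (n + 1)) := Equiv.swap 0 (σ k) * σ * Equiv.swap 0 k with hρ
      have h0 : ρ 0 = 0 := by simp [hρ]
      have hy : (x ∘ σ) ∘ Equiv.swap 0 k = (x ∘ Equiv.swap 0 (σ k)) ∘ ρ := by
        funext a
        simp [hρ]
      rw [hy, amp_tail_perm ψ n ρ h0, hρ]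
      simp only [Equiv.Perm.sign_mul, Units.val_mul, Int.cast_mul]
      linear_combination (((Equiv.Perm.sign (Equiv.swap 0 (σ k)) : ℤ) : ℂ) *
        ((Equiv.Perm.sign σ : ℤ) : ℂ) * amp ψ n (Fin.tail (x ∘ Equiv.swap 0 (σ k)))) *
        sign_mul_self_complex (Equiv.swap 0 k)
    · simp

theorem creatFun_not_injective (j : ι) (ψ : FockSpace ι) {n : ℕ} {x : Fin n → ι}
    (hx : ¬ Function.Injective x) : creatFun j (amp ψ) n x = 0 := by
  simp only [Function.Injective, not_forall] at hx
  obtain ⟨a, b, hab, hne⟩ := hx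
  have h := creatFun_perm j ψ n (Equiv.swap a b) x
  have hc : x ∘ Equiv.swap a b = x := by
    funext k
    by_cases hi : k = a
    · subst hi
      simp [hab]
    · by_cases hj : k = b
      · subst hj
        simp [hab]
      · simp [Equiv.swap_apply_of_ne_of_ne hi hj]
  rw [hc, Equiv.Perm.sign_swap hne] at h
  have : (2 : ℂ) * creatFun j (amp ψ) n x = 0 := by
    push_cast at h
    linear_combination h
  simpa using this

/-- The vector obtained from `ψ` by creating a particle in the mode `j`. -/
def creatVec (j : ι) (ψ : FockSpace ι) : FockSpace ι :=
  (⟨WithLp.toLp 2 fun c : Config ι => creatFun j (amp ψ) c.1 c.2,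
    fun n σ x => creatFun_perm j ψ n σ x⟩ : Fock ι)

theorem amp_creatVec (j : ι) (ψ : FockSpace ι) (n : ℕ) (x : Fin n → ι) :
    amp (creatVec j ψ) n x = creatFun j (amp ψ) n x := by
  by_cases h : n < Fintype.card ι + 1
  · rw [amp_of_lt _ h]
    rfl
  -- With more particles than modes no configuration is injective, so the formula for creation
  -- vanishes as well.
  · rw [amp_of_card_lt _ (by omega), creatFun_not_injective]
    intro hx
    have := Fintype.card_le_of_injective x hx
    rw [Fintype.card_fin] at this
    omega

theorem inner_eq_sum_amp (φ ψ : FockSpace ι) : inner ℂ φ ψ =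
    ∑ n ∈ Finset.range (Fintype.card ι + 1), ∑ x : Fin n → ι,
      starRingEnd ℂ (amp φ n x) * amp ψ n x := by
  change inner ℂ (wave ι φ) (wave ι ψ) = _
  rw [PiLp.inner_apply, Fintype.sum_sigma, ← Fin.sum_univ_eq_sum_range
    (fun n => ∑ x : Fin n → ι, starRingEnd ℂ (amp φ n x) * amp ψ n x)]
  refine Finset.sum_congr rfl fun n _ => Finset.sum_congr rfl fun x _ => ?_
  rw [amp_fin, amp_fin, RCLike.inner_apply, mul_comm]

/-- Adjointness sector by sector. By antisymmetry the `n + 1` slots for the created particle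
contribute equally, and `(n + 1) / √(n + 1) = √(n + 1)` is the factor of the annihilation operator.
-/
theorem sum_amp_creatFun (j : ι) (φ ψ : FockSpace ι) (n : ℕ) :
    ∑ y : Fin (n + 1) → ι, starRingEnd ℂ (amp φ (n + 1) y) * creatFun j (amp ψ) (n + 1) y =
      ∑ x : Fin n → ι, starRingEnd ℂ (amp (annih j φ) n x) * amp ψ n x := by
  have hterm : ∀ k : Fin (n + 1), ∑ y : Fin (n + 1) → ι, starRingEnd ℂ (amp φ (n + 1) y) *
      (if y k = j then ((Equiv.Perm.sign (Equiv.swap 0 k) : ℤ) : ℂ) *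
        amp ψ n (Fin.tail (y ∘ Equiv.swap 0 k)) else 0) =
      ∑ x : Fin n → ι, starRingEnd ℂ (amp φ (n + 1) (Fin.cons j x)) * amp ψ n x := by
    intro k
    -- Reindexing brings slot `k` to the front; the sign this produces from `φ` cancels the explicit
    -- one.
    rw [← Equiv.sum_comp (Equiv.arrowCongr (Equiv.swap 0 k) (Equiv.refl ι))]
    have h1 : ∀ y : Fin (n + 1) → ι,
        Equiv.arrowCongr (Equiv.swap 0 k) (Equiv.refl ι) y = y ∘ Equiv.swap 0 k := by
      intro y
      funext a
      simp [Equiv.arrowCongr]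
    have h2 : ∀ y : Fin (n + 1) → ι, (y ∘ Equiv.swap 0 k) ∘ Equiv.swap 0 k = y := by
      intro y
      funext a
      simp
    simp only [h1, h2, amp_perm, Function.comp_apply, Equiv.swap_apply_right, map_mul,
      map_intCast]
    have h3 : ∀ (b : ι) (x : Fin n → ι),
        Fin.consEquiv (fun _ : Fin (n + 1) => ι) (b, x) = Fin.cons b x := fun _ _ => rfl
    rw [← Equiv.sum_comp (Fin.consEquiv fun _ => ι), Fintype.sum_prod_type,
      Finset.sum_eq_single j]
    · refine Finset.sum_congr rfl fun x _ => ?_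
      simp only [h3, Fin.cons_zero, Fin.tail_cons, if_true]
      linear_combination (starRingEnd ℂ (amp φ (n + 1) (Fin.cons j x)) * amp ψ n x) *
        sign_mul_self_complex (Equiv.swap 0 k)
    · intro b _ hb
      simp [h3, hb]
    · simp
  have hs : ((Real.sqrt (n + 1) : ℝ) : ℂ)⁻¹ * (n + 1 : ℂ) = ((Real.sqrt (n + 1) : ℝ) : ℂ) := by
    have h0 : (0 : ℝ) < n + 1 := by positivity
    have h1 : ((Real.sqrt (n + 1) : ℝ) : ℂ) ≠ 0 := by
      exact_mod_cast (Real.sqrt_pos.2 h0).ne'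
    rw [inv_mul_eq_iff_eq_mul₀ h1, ← Complex.ofReal_mul, Real.mul_self_sqrt h0.le]
    push_cast
    rfl
  simp only [creatFun]
  calc ∑ y : Fin (n + 1) → ι, starRingEnd ℂ (amp φ (n + 1) y) *
        (((Real.sqrt (n + 1) : ℝ) : ℂ)⁻¹ *
          ∑ k : Fin (n + 1), (if y k = j then ((Equiv.Perm.sign (Equiv.swap 0 k) : ℤ) : ℂ) *
            amp ψ n (Fin.tail (y ∘ Equiv.swap 0 k)) else 0))
      = ((Real.sqrt (n + 1) : ℝ) : ℂ)⁻¹ * ∑ k : Fin (n + 1), ∑ y : Fin (n + 1) → ι,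
          starRingEnd ℂ (amp φ (n + 1) y) *
          (if y k = j then ((Equiv.Perm.sign (Equiv.swap 0 k) : ℤ) : ℂ) *
            amp ψ n (Fin.tail (y ∘ Equiv.swap 0 k)) else 0) := by
        rw [Finset.sum_comm, Finset.mul_sum]
        refine Finset.sum_congr rfl fun y _ => ?_
        rw [← Finset.mul_sum]
        ring
    _ = _ := by
        simp only [hterm, Finset.sum_const, Finset.card_univ, Fintype.card_fin, nsmul_eq_mul]
        rw [← mul_assoc]
        push_cast
        rw [hs, Finset.mul_sum]
        refine Finset.sum_congr rfl fun x _ => ?_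
        rw [amp_annih, map_mul, Complex.conj_ofReal]
        ring

/-- The two inner products match after a shift by one particle; the unmatched terms, the top sector
of `annih j φ` and the vacuum sector of `creatVec j ψ`, vanish. -/
theorem creat_apply (j : ι) (ψ : FockSpace ι) : creat j ψ = creatVec j ψ := by
  refine ext_inner_left ℂ fun φ => ?_
  rw [creat, LinearMap.adjoint_inner_right, inner_eq_sum_amp, inner_eq_sum_amp,
    Finset.sum_range_succ, Finset.sum_range_succ' (fun n => ∑ x : Fin n → ι,
      starRingEnd ℂ (amp φ n x) * amp (creatVec j ψ) n x)]
  congr 1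
  · refine Finset.sum_congr rfl fun n _ => ?_
    simp only [amp_creatVec]
    rw [sum_amp_creatFun]
  · simp only [amp_creatVec, creatFun, mul_zero, Finset.sum_const_zero, amp_annih]
    refine Finset.sum_eq_zero fun x _ => ?_
    rw [amp_of_card_lt φ (Nat.lt_succ_self _)]
    simp

theorem annih_annih (i j : ι) : annih i * annih j + annih j * annih i = (0 : Op (FockSpace ι)) := by
  refine LinearMap.ext fun ψ => amp_ext fun n x => ?_
  simp only [LinearMap.add_apply, Module.End.mul_apply, amp_add, LinearMap.zero_apply, amp_zero,
    amp_annih]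
  have h : (Fin.cons j (Fin.cons i x : Fin (n + 1) → ι) : Fin (n + 2) → ι) =
      (Fin.cons i (Fin.cons j x : Fin (n + 1) → ι) : Fin (n + 2) → ι) ∘ Equiv.swap 0 1 := by
    funext k
    refine Fin.cases ?_ (fun k => Fin.cases ?_ (fun k => ?_) k) k
    · simp
    · simp
    · rw [Function.comp_apply, Equiv.swap_apply_of_ne_of_ne (by simp)
        (by simp [Fin.ext_iff])]
      simp
  rw [h, amp_perm, Equiv.Perm.sign_swap (by simp)]
  push_cast
  ring

theorem sqrt_succ_ne_zero (n : ℕ) : ((Real.sqrt (n + 1) : ℝ) : ℂ) ≠ 0 := by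
  have h0 : (0 : ℝ) < n + 1 := by positivity
  exact_mod_cast (Real.sqrt_pos.2 h0).ne'

theorem amp_creat_annih (i j : ι) (ψ : FockSpace ι) (n : ℕ) (x : Fin n → ι) :
    amp (creat j (annih i ψ)) n x =
      ∑ k : Fin n, if x k = j then amp ψ n (Function.update x k i) else 0 := by
  rw [creat_apply, amp_creatVec]
  cases n with
  | zero => simp [creatFun]
  | succ n =>
    simp only [creatFun]
    rw [Finset.mul_sum]
    refine Finset.sum_congr rfl fun k _ => ?_
    split_ifs with hk
    · rw [amp_annih]
      have : (Fin.cons i (Fin.tail (x ∘ Equiv.swap 0 k)) : Fin (n + 1) → ι) =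
          Function.update x k i ∘ Equiv.swap 0 k := by
        funext a
        refine Fin.cases ?_ (fun a => ?_) a
        · simp
        · simp only [Fin.cons_succ, Fin.tail, Function.comp_apply]
          rw [Function.update_of_ne]
          intro h
          have h2 := congrArg (Equiv.swap 0 k) h
          simp at h2
      rw [this, amp_perm]
      have h0 := sqrt_succ_ne_zero n
      field_simp
      linear_combination (amp ψ (n + 1) (Function.update x k i)) *
        sign_mul_self_complex (Equiv.swap 0 k)
    · simp

/-- The front slot gives the Kronecker delta. For any other slot the transposition to the front has
sign `-1`, giving the terms of `amp_creat_annih` negated, so that they cancel in the anticommutator.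
-/
theorem amp_annih_creat (i j : ι) (ψ : FockSpace ι) (n : ℕ) (x : Fin n → ι) :
    amp (annih i (creat j ψ)) n x = (if i = j then amp ψ n x else 0) -
      ∑ k : Fin n, if x k = j then amp ψ n (Function.update x k i) else 0 := by
  rw [amp_annih, creat_apply, amp_creatVec]
  simp only [creatFun]
  rw [← mul_assoc, mul_inv_cancel₀ (sqrt_succ_ne_zero n), one_mul, Fin.sum_univ_succ, sub_eq_add_neg,
    ← Finset.sum_neg_distrib]
  congr 1
  · have : (Fin.cons i x : Fin (n + 1) → ι) ∘ Equiv.swap 0 0 = Fin.cons i x := by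
      simp
    rw [this]
    simp
  · refine Finset.sum_congr rfl fun k _ => ?_
    rw [Fin.cons_succ]
    split_ifs with hk
    · rw [Equiv.Perm.sign_swap (Fin.succ_ne_zero k).symm]
      have : Fin.tail ((Fin.cons i x : Fin (n + 1) → ι) ∘ Equiv.swap 0 k.succ) =
          Function.update x k i := by
        funext a
        simp only [Fin.tail, Function.comp_apply]
        by_cases ha : a = k
        · subst ha
          simp
        · rw [Function.update_of_ne ha, Equiv.swap_apply_of_ne_of_ne (Fin.succ_ne_zero a)
            (fun h => ha (Fin.succ_injective _ h)), Fin.cons_succ]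
      rw [this]
      push_cast
      ring
    · simp

theorem annih_creat (i j : ι) : annih i * creat j + creat j * annih i =
    (if i = j then 1 else 0 : Op (FockSpace ι)) := by
  refine LinearMap.ext fun ψ => amp_ext fun n x => ?_
  simp only [LinearMap.add_apply, Module.End.mul_apply, amp_add, amp_annih_creat, amp_creat_annih]
  by_cases h : i = j
  · simp [h]
  · simp [h, amp_zero]

theorem creat_creat (i j : ι) : creat i * creat j + creat j * creat i = (0 : Op (FockSpace ι)) := by
  have h := congrArg LinearMap.adjoint (annih_annih j i)
  simp only [map_add, map_zero, Module.End.mul_eq_comp, LinearMap.adjoint_comp] at h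
  exact h

theorem majorana_sq (i : ι) : majorana i * majorana i = (1 : Op (FockSpace ι)) := by
  have h1 := annih_annih i i
  have h2 := creat_creat i i
  have h3 := annih_creat i i
  rw [if_pos rfl] at h3
  rw [← two_smul ℂ, smul_eq_zero] at h1 h2
  have h1' := h1.resolve_left two_ne_zero
  have h2' := h2.resolve_left two_ne_zero
  rw [majorana, add_mul, mul_add, mul_add, h1', h2', ← h3]
  abel

theorem majorana_majorana (i j : ι) :
    CommuteBy (-eqSign i j) (majorana i : Op (FockSpace ι)) (majorana j) := by
  by_cases hij : i = j
  · subst hij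
    rw [eqSign_self, neg_neg]
    exact CommuteBy.self _
  · rw [eqSign_of_ne hij, CommuteBy, neg_one_smul, ← add_eq_zero_iff_eq_neg]
    have h1 := annih_annih i j
    have h2 := creat_creat i j
    have h3 := annih_creat i j
    have h4 := annih_creat j i
    rw [if_neg hij] at h3
    rw [if_neg (Ne.symm hij)] at h4
    calc majorana i * majorana j + majorana j * majorana i =
        (annih i * annih j + annih j * annih i) + (creat i * creat j + creat j * creat i) +
        (annih i * creat j + creat j * annih i) + (annih j * creat i + creat i * annih j) := by
          simp only [majorana, add_mul, mul_add]
          abel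
      _ = 0 := by rw [h1, h2, h3, h4]; simp

theorem majorana_majoranaBar (i j : ι) :
    CommuteBy (-1) (majorana i : Op (FockSpace ι)) (majoranaBar j) := by
  refine CommuteBy.smul_right ?_ _
  rw [CommuteBy, neg_one_smul, ← add_eq_zero_iff_eq_neg]
  have h1 := annih_annih i j
  have h2 := creat_creat i j
  have h3 := annih_creat i j
  have h4 := annih_creat j i
  calc (majorana i : Op (FockSpace ι)) * (annih j - creat j) + (annih j - creat j) * majorana i =
      (annih i * annih j + annih j * annih i) - (creat i * creat j + creat j * creat i) -
      (annih i * creat j + creat j * annih i) + (annih j * creat i + creat i * annih j) := by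
        simp only [majorana, add_mul, mul_add, sub_mul, mul_sub]
        abel
    _ = 0 := by
      rw [h1, h2, h3, h4]
      by_cases hij : i = j
      · simp [hij]
      · simp [hij, Ne.symm hij]

theorem vertexOp_eq (i : ι) : vertexOp i = (1 : Op (FockSpace ι)) - (2 : ℂ) • (creat i * annih i) := by
  have h1 := annih_annih i i
  have h2 := creat_creat i i
  have h3 := annih_creat i i
  rw [if_pos rfl] at h3
  rw [← two_smul ℂ, smul_eq_zero] at h1 h2
  have h1' := h1.resolve_left two_ne_zero
  have h2' := h2.resolve_left two_ne_zero
  have hI : -Complex.I * Complex.I⁻¹ = -1 := by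
    rw [neg_mul, mul_inv_cancel₀ Complex.I_ne_zero]
  rw [vertexOp, majoranaBar, majorana, mul_smul_comm, smul_smul, hI, add_mul, mul_sub, mul_sub,
    h1', h2', ← h3, two_smul, neg_one_smul]
  abel

/-- `V_i = 1 - 2 a_i† a_i` is diagonal because, by exclusion, the occupation of mode `i` is `0` or
`1`. -/
theorem amp_vertexOp (i : ι) (ψ : FockSpace ι) (n : ℕ) (x : Fin n → ι) :
    amp (vertexOp i ψ) n x = (if i ∈ Set.range x then -1 else 1) * amp ψ n x := by
  by_cases hx : Function.Injective x
  · have h : vertexOp i ψ = ψ + (-2 : ℂ) • creat i (annih i ψ) := by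
      rw [vertexOp_eq]
      simp [sub_eq_add_neg]
    rw [h, amp_add, amp_smul, amp_creat_annih]
    split_ifs with hi
    · obtain ⟨k, rfl⟩ := hi
      rw [Finset.sum_eq_single k]
      · simp
        ring
      · intro l _ hl
        rw [if_neg (fun e => hl (hx e))]
      · simp
    · rw [Finset.sum_eq_zero]
      · ring
      · intro k _
        rw [if_neg (fun e => hi ⟨k, e⟩)]
  · rw [amp_not_injective _ hx, amp_not_injective _ hx, mul_zero]

theorem vertexOp_sq (i : ι) : vertexOp i * vertexOp i = (1 : Op (FockSpace ι)) := by
  refine LinearMap.ext fun ψ => amp_ext fun n x => ?_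
  rw [Module.End.mul_apply, Module.End.one_apply, amp_vertexOp, amp_vertexOp]
  split_ifs <;> ring

theorem vertexOp_comm (i j : ι) :
    vertexOp i * vertexOp j = (vertexOp j * vertexOp i : Op (FockSpace ι)) := by
  refine LinearMap.ext fun ψ => amp_ext fun n x => ?_
  simp only [Module.End.mul_apply, amp_vertexOp]
  ring

theorem majorana_symm (i : ι) : (majorana i : Op (FockSpace ι)).IsSymmetric := by
  intro φ ψ
  simp only [majorana, creat, LinearMap.add_apply, inner_add_left, inner_add_right,
    LinearMap.adjoint_inner_left, LinearMap.adjoint_inner_right]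
  ring

theorem vertexOp_symm (i : ι) : (vertexOp i : Op (FockSpace ι)).IsSymmetric := by
  intro φ ψ
  rw [vertexOp_eq]
  simp only [creat, LinearMap.sub_apply, LinearMap.smul_apply, Module.End.mul_apply,
    Module.End.one_apply, inner_sub_left, inner_sub_right, inner_smul_left, inner_smul_right,
    LinearMap.adjoint_inner_left, LinearMap.adjoint_inner_right, Complex.conj_ofNat]

theorem norm_majorana (i : ι) (ψ : FockSpace ι) : ‖majorana i ψ‖ = ‖ψ‖ := by
  have h := majorana_symm i ψ (majorana i ψ)
  have h2 : majorana i (majorana i ψ) = ψ := LinearMap.congr_fun (majorana_sq i) ψ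
  rw [h2, inner_self_eq_norm_sq_to_K, inner_self_eq_norm_sq_to_K] at h
  have h3 : ‖majorana i ψ‖ ^ 2 = ‖ψ‖ ^ 2 := by exact_mod_cast h
  exact (pow_left_inj₀ (norm_nonneg _) (norm_nonneg _) two_ne_zero).1 h3

theorem majorana_vertexOp (i k : ι) :
    CommuteBy (eqSign i k) (majorana i : Op (FockSpace ι)) (vertexOp k) := by
  have := ((majorana_majorana i k).mul_right (majorana_majoranaBar i k)).smul_right (-Complex.I)
  rwa [mul_neg_one, neg_neg] at this

theorem edgeOp_vertexOp (i j k : ι) :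
    CommuteBy (eqSign i k * eqSign j k) (edgeOp i j : Op (FockSpace ι)) (vertexOp k) :=
  ((majorana_vertexOp i k).mul_left (majorana_vertexOp j k)).smul_left _

theorem edgeOp_edgeOp (i j k l : ι) :
    CommuteBy (eqSign i k * eqSign i l * (eqSign j k * eqSign j l))
      (edgeOp i j : Op (FockSpace ι)) (edgeOp k l) := by
  have := ((((majorana_majorana i k).mul_right (majorana_majorana i l)).mul_left
    ((majorana_majorana j k).mul_right (majorana_majorana j l))).smul_left
      (-Complex.I)).smul_right (-Complex.I)
  simp only [neg_mul_neg] at this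
  exact this

theorem edgeOp_swap {i j : ι} (hij : i ≠ j) : edgeOp j i = (-edgeOp i j : Op (FockSpace ι)) := by
  have := majorana_majorana j i
  rw [eqSign_of_ne hij.symm] at this
  rw [edgeOp, edgeOp, this.anticommute, smul_neg]

theorem edgeOp_sq {i j : ι} (hij : i ≠ j) : edgeOp i j * edgeOp i j = (1 : Op (FockSpace ι)) := by
  have := majorana_majorana j i
  rw [eqSign_of_ne hij.symm] at this
  rw [edgeOp, smul_mul_smul_comm, neg_mul_neg, Complex.I_mul_I]
  calc (-1 : ℂ) • (majorana i * majorana j * (majorana i * majorana j) : Op (FockSpace ι)) =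
      (-1 : ℂ) • (majorana i * (majorana j * majorana i) * majorana j) := by
        simp only [mul_assoc]
    _ = (majorana i * majorana i) * (majorana j * majorana j) := by
        rw [this.anticommute, mul_neg, neg_mul, neg_one_smul, neg_neg]
        simp only [mul_assoc]
    _ = 1 := by rw [majorana_sq, majorana_sq, one_mul]

theorem norm_edgeOp (i j : ι) (ψ : FockSpace ι) : ‖edgeOp i j ψ‖ = ‖ψ‖ := by
  simp [edgeOp, norm_smul, norm_majorana]

/-- The product of all vertex operators is the fermion parity. -/
theorem amp_prod_vertexOp (ψ : FockSpace ι) (n : ℕ) (x : Fin n → ι) :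
    amp (((Finset.univ : Finset ι).toList.map vertexOp).prod ψ) n x = (-1) ^ n * amp ψ n x := by
  have key : ∀ l : List ι, amp ((l.map vertexOp).prod ψ) n x =
      (l.map fun i => if i ∈ Set.range x then (-1 : ℂ) else 1).prod * amp ψ n x := by
    intro l
    induction l with
    | nil => simp
    | cons i l ih =>
      rw [List.map_cons, List.prod_cons, Module.End.mul_apply, amp_vertexOp, ih, List.map_cons,
        List.prod_cons, mul_assoc]
  rw [key]
  by_cases hx : Function.Injective x
  · congr 1
    rw [Finset.prod_map_toList, Finset.prod_ite, Finset.prod_const, Finset.prod_const_one, mul_one]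
    congr 1
    have : (Finset.univ.filter fun i => i ∈ Set.range x) = Finset.univ.image x := by
      ext i
      simp
    rw [this, Finset.card_image_of_injective _ hx, Finset.card_univ, Fintype.card_fin]
  · rw [amp_not_injective _ hx, mul_zero, mul_zero]

theorem mem_evenFock_iff (ψ : FockSpace ι) : ψ ∈ evenFock ι ↔
    ((Finset.univ : Finset ι).toList.map vertexOp).prod ψ = ψ := by
  constructor
  · intro h
    refine amp_ext fun n x => ?_
    rw [amp_prod_vertexOp]
    rcases Nat.even_or_odd n with hn | hn
    · rw [hn.neg_one_pow, one_mul]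
    · by_cases hc : n < Fintype.card ι + 1
      · rw [amp_of_lt _ hc, h ⟨n, hc⟩ x hn, mul_zero]
      · rw [amp_of_card_lt _ (by omega), mul_zero]
  · intro h n x hn
    have e := amp_prod_vertexOp ψ n x
    rw [h, hn.neg_one_pow, amp_fin] at e
    have : (2 : ℂ) * wave ι ψ ⟨n, x⟩ = 0 := by linear_combination e
    simpa using this

/-- Each Majorana operator anticommutes with the parity, so a product of two commutes with it. -/
theorem edgeOp_mem_evenFock (i j : ι) (ψ : FockSpace ι) (hψ : ψ ∈ evenFock ι) :
    edgeOp i j ψ ∈ evenFock ι := by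
  rw [mem_evenFock_iff] at hψ ⊢
  have h := ((CommuteBy.list_prod (majorana_vertexOp i) (Finset.univ : Finset ι).toList).mul_left
    (CommuteBy.list_prod (majorana_vertexOp j) (Finset.univ : Finset ι).toList)).smul_left
      (-Complex.I)
  rw [prod_eqSign, prod_eqSign, neg_mul_neg, one_mul] at h
  have e := LinearMap.congr_fun h.commute ψ
  rw [Module.End.mul_apply, Module.End.mul_apply, hψ] at e
  exact e.symm

theorem vertexOp_mem_evenFock (i : ι) (ψ : FockSpace ι) (hψ : ψ ∈ evenFock ι) :
    vertexOp i ψ ∈ evenFock ι := by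
  intro n x hn
  rw [← amp_fin, amp_vertexOp, amp_fin, hψ n x hn, mul_zero]

/-- The vacuum vector. -/
def vacuum : FockSpace ι :=
  (⟨WithLp.toLp 2 fun c : Config ι => if (c.1 : ℕ) = 0 then 1 else 0, by
    intro n σ x
    obtain ⟨n, hn⟩ := n
    cases n with
    | zero => simp [Subsingleton.elim σ 1]
    | succ n => simp⟩ : Fock ι)

theorem amp_vacuum (n : ℕ) (x : Fin n → ι) : amp (vacuum : FockSpace ι) n x = if n = 0 then 1 else 0 := by
  by_cases h : n < Fintype.card ι + 1
  · rw [amp_of_lt _ h]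
    rfl
  · rw [amp_of_card_lt _ (by omega), if_neg (by omega)]

/-- The dimension comes from halving once per mode: `majorana i` flips `vertexOp i` alone, and the
vectors fixed by all vertex operators are the multiples of the vacuum, since an occupied mode gives
the eigenvalue `-1`. -/
theorem finrank_fockSpace : Module.finrank ℂ (FockSpace ι) = 2 ^ Fintype.card ι := by
  have hinj : ∀ i : ι, Function.Injective (majorana i : Op (FockSpace ι)) := by
    intro i x y hxy
    have hx := LinearMap.congr_fun (majorana_sq i) x
    have hy := LinearMap.congr_fun (majorana_sq i) y
    simp only [Module.End.mul_apply, Module.End.one_apply] at hx hy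
    rw [← hx, hxy, hy]
  have h := two_pow_mul_finrank_jointFixed (vertexOp : ι → Op (FockSpace ι)) majorana
    (Finset.univ : Finset ι).toList (Finset.nodup_toList _) vertexOp_comm vertexOp_sq hinj
    (fun i => by
      have := majorana_vertexOp i i
      rw [eqSign_self] at this
      exact this.anticommute)
    (fun i j hij => by
      have := majorana_vertexOp i j
      rw [eqSign_of_ne hij] at this
      exact this.commute)
  have h1 : Module.finrank ℂ
      (jointFixed (vertexOp : ι → Op (FockSpace ι)) (Finset.univ : Finset ι).toList) = 1 := by
    rw [finrank_eq_one_iff']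
    have hv : (vacuum : FockSpace ι) ∈ jointFixed vertexOp (Finset.univ : Finset ι).toList := by
      intro i _
      refine amp_ext fun n x => ?_
      rw [amp_vertexOp, amp_vacuum]
      by_cases hn : n = 0
      · subst hn
        simp
      · simp [hn]
    refine ⟨⟨vacuum, hv⟩, ?_, ?_⟩
    · intro e
      have e2 : (vacuum : FockSpace ι) = 0 := congrArg Subtype.val e
      have e3 := congrArg (fun ψ => amp ψ 0 Fin.elim0) e2
      simp [amp_vacuum, amp_zero] at e3
    · rintro ⟨ψ, hψ⟩
      refine ⟨amp ψ 0 Fin.elim0, Subtype.ext (amp_ext fun n x => ?_)⟩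
      change amp (amp ψ 0 Fin.elim0 • vacuum) n x = amp ψ n x
      rw [amp_smul, amp_vacuum]
      cases n with
      | zero => simp [Subsingleton.elim x Fin.elim0]
      | succ n =>
        have e := congrArg (fun φ => amp φ (n + 1) x) (hψ (x 0) (by simp))
        simp only [amp_vertexOp, Set.mem_range_self, if_true] at e
        have : (2 : ℂ) * amp ψ (n + 1) x = 0 := by linear_combination -e
        simp only [Nat.add_eq_zero_iff, one_ne_zero, and_false, if_false, mul_zero]
        exact ((mul_eq_zero.1 this).resolve_left two_ne_zero).symm
  rw [h1, mul_one, Finset.length_toList, Finset.card_univ] at h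
  exact h.symm

/-- Any Majorana operator exchanges the even and odd parts. -/
theorem finrank_evenFock [Nonempty ι] :
    Module.finrank ℂ (evenFock ι) = 2 ^ (Fintype.card ι - 1) := by
  obtain ⟨i⟩ := (inferInstance : Nonempty ι)
  set P : Op (FockSpace ι) := ((Finset.univ : Finset ι).toList.map vertexOp).prod with hP
  have hflip := CommuteBy.list_prod (majorana_vertexOp i) (Finset.univ : Finset ι).toList
  rw [prod_eqSign] at hflip
  have h := finrank_half (⊤ : Submodule ℂ (FockSpace ι)) P (majorana i) (by simp) (by simp)
    (fun ψ => amp_ext fun n x => by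
      rw [hP, amp_prod_vertexOp, amp_prod_vertexOp, ← mul_assoc, ← mul_pow]
      simp)
    (fun x y hxy => by
      have hx := LinearMap.congr_fun (majorana_sq i) x
      have hy := LinearMap.congr_fun (majorana_sq i) y
      simp only [Module.End.mul_apply, Module.End.one_apply] at hx hy
      rw [← hx, hxy, hy])
    (fun ψ => LinearMap.congr_fun hflip.anticommute ψ)
  have he : (⊤ ⊓ LinearMap.ker (P - 1) : Submodule ℂ (FockSpace ι)) = evenFock ι := by
    ext ψ
    rw [mem_evenFock_iff]
    simp [sub_eq_zero, hP]
  rw [he, finrank_top, finrank_fockSpace] at h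
  have hc : 0 < Fintype.card ι := Fintype.card_pos
  obtain ⟨m, hm⟩ : ∃ m, Fintype.card ι = m + 1 := ⟨_, (Nat.succ_pred_eq_of_pos hc).symm⟩
  rw [hm, pow_succ] at h
  rw [hm, Nat.add_sub_cancel]
  omega

end FockOperators

/-! ### The fermionic operators satisfy the edge and loop relations. -/

section FockRelations

variable {L₁ L₂ : ℕ}

theorem edgeRelations_fock :
    EdgeRelations (edgeOp : Vertex L₁ L₂ → Vertex L₁ L₂ → Op (FockSpace (Vertex L₁ L₂)))
      vertexOp where
  E_sq _ _ h := edgeOp_sq h.ne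
  E_anti _ _ h := edgeOp_swap h.ne
  E_norm i j _ := norm_edgeOp i j
  V_sq := vertexOp_sq
  V_symm := vertexOp_symm
  V_comm := vertexOp_comm
  EE i j k l _ _ := edgeOp_edgeOp i j k l
  EV i j k _ := edgeOp_vertexOp i j k

theorem trivialLoops_fock :
    TrivialLoops (edgeOp : Vertex L₁ L₂ → Vertex L₁ L₂ → Op (FockSpace (Vertex L₁ L₂))) := by
  intro f
  generalize corner f 0 = a, corner f 1 = b, corner f 2 = c, corner f 3 = d
  simp only [edgeOp, smul_mul_smul_comm]
  have hI : -Complex.I * -Complex.I * -Complex.I * -Complex.I = 1 := by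
    linear_combination (Complex.I * Complex.I - 1) * Complex.I_mul_I
  rw [hI, one_smul]
  calc majorana a * majorana b * (majorana b * majorana c) * (majorana c * majorana d) *
        (majorana d * majorana a)
      = majorana a * (majorana b * majorana b) * (majorana c * majorana c) *
        (majorana d * majorana d) * majorana a := by simp only [mul_assoc]
    _ = 1 := by simp only [majorana_sq, mul_one]

end FockRelations

/-! ### Pauli operators on labelled qubits. -/

section Paulis

variable {Q : Type} [Fintype Q] [DecidableEq Q]

theorem onQubit_apply (M : Matrix (Fin 2) (Fin 2) ℂ) (q : Q) (ψ : QubitSpace Q) (b : Q → Fin 2) :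
    onQubit M q ψ b = ∑ c : Fin 2, M (b q) c * ψ (Function.update b q c) := rfl

theorem onQubit_mul (M N : Matrix (Fin 2) (Fin 2) ℂ) (q : Q) :
    onQubit M q * onQubit N q = onQubit (M * N) q := by
  refine LinearMap.ext fun ψ => ?_
  ext b
  rw [Module.End.mul_apply]
  simp only [onQubit_apply, Function.update_self, Function.update_idem, Matrix.mul_apply,
    Fin.sum_univ_two]
  ring

theorem onQubit_one (q : Q) : onQubit (1 : Matrix (Fin 2) (Fin 2) ℂ) q = 1 := by
  refine LinearMap.ext fun ψ => ?_
  ext b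
  rw [onQubit_apply]
  simp [Matrix.one_apply]

theorem onQubit_smul (c : ℂ) (M : Matrix (Fin 2) (Fin 2) ℂ) (q : Q) :
    onQubit (c • M) q = c • onQubit M q := by
  refine LinearMap.ext fun ψ => ?_
  ext b
  rw [LinearMap.smul_apply, PiLp.smul_apply, onQubit_apply, onQubit_apply]
  simp only [Matrix.smul_apply, smul_eq_mul, Fin.sum_univ_two]
  ring

theorem onQubit_comm (M N : Matrix (Fin 2) (Fin 2) ℂ) {q r : Q} (h : q ≠ r) :
    onQubit M q * onQubit N r = onQubit N r * onQubit M q := by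
  refine LinearMap.ext fun ψ => ?_
  ext b
  simp only [Module.End.mul_apply, onQubit_apply, Function.update_of_ne h,
    Function.update_of_ne h.symm, Fin.sum_univ_two, Function.update_comm h]
  ring

theorem onQubit_symm (M : Matrix (Fin 2) (Fin 2) ℂ) (hM : M.IsHermitian) (q : Q) :
    (onQubit M q).IsSymmetric := by
  intro φ ψ
  simp only [PiLp.inner_apply, RCLike.inner_apply, onQubit_apply, map_sum, map_mul,
    Finset.mul_sum, Finset.sum_mul]
  rw [← Finset.sum_product', ← Finset.sum_product']
  -- The involution exchanges the row and column index of the matrix at `q`, turning each summand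
  -- into the one for the conjugate transpose.
  refine Finset.sum_nbij' (fun p => (Function.update p.1 q p.2, p.1 q))
    (fun p => (Function.update p.1 q p.2, p.1 q)) ?_ ?_ ?_ ?_ ?_
  · simp
  · simp
  · rintro ⟨b, c⟩ _
    simp
  · rintro ⟨b, c⟩ _
    simp
  · rintro ⟨b, c⟩ _
    simp only [Function.update_self, Function.update_idem, Function.update_eq_self]
    have := hM.apply (b q) c
    rw [← this]
    simp
    ring

/-- The three Pauli matrices. -/
inductive PauliLabel : Type
  | x
  | y
  | z
  deriving DecidableEq

/-- The Pauli operator with a given label at the qubit `q`. -/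
def pauli : PauliLabel → Q → Op (QubitSpace Q)
  | .x => pauliX
  | .y => pauliY
  | .z => pauliZ

theorem pauli_sq (P : PauliLabel) (q : Q) : pauli P q * pauli P q = 1 := by
  cases P <;> simp only [pauli, pauliX, pauliY, pauliZ, onQubit_mul] <;>
    rw [← onQubit_one q] <;> congr 1 <;> ext i j <;> fin_cases i <;> fin_cases j <;> simp

theorem pauliX_mul_pauliY (q : Q) : pauliX q * pauliY q = Complex.I • pauliZ q := by
  simp only [pauliX, pauliY, pauliZ, onQubit_mul, ← onQubit_smul]
  congr 1
  ext i j
  fin_cases i <;> fin_cases j <;> simp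

theorem pauliY_mul_pauliX (q : Q) : pauliY q * pauliX q = -Complex.I • pauliZ q := by
  simp only [pauliX, pauliY, pauliZ, onQubit_mul, ← onQubit_smul]
  congr 1
  ext i j
  fin_cases i <;> fin_cases j <;> simp

/-- The sign with which two Pauli operators commute. -/
def pauliSign (P P' : PauliLabel) (q q' : Q) : ℂ := if q = q' ∧ P ≠ P' then -1 else 1

theorem pauli_commuteBy (P P' : PauliLabel) (q q' : Q) :
    CommuteBy (pauliSign P P' q q') (pauli P q) (pauli P' q') := by
  by_cases hq : q = q'
  · subst hq
    by_cases hP : P = P'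
    · subst hP
      simpa [pauliSign] using CommuteBy.self (pauli P q)
    · simp only [pauliSign, hP, ne_eq, not_false_eq_true, and_self, if_true, CommuteBy]
      cases P <;> cases P' <;>
        first
        | exact absurd rfl hP
        | (simp only [pauli, pauliX, pauliY, pauliZ, onQubit_mul, ← onQubit_smul]
           congr 1
           ext i j
           fin_cases i <;> fin_cases j <;> simp)
  · have : pauliSign P P' q q' = 1 := by simp [pauliSign, hq]
    rw [this, CommuteBy, one_smul]
    cases P <;> cases P' <;> exact onQubit_comm _ _ hq

theorem pauli_comm (P P' : PauliLabel) {q q' : Q} (h : q ≠ q') :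
    Commute (pauli P q) (pauli P' q') := by
  have := pauli_commuteBy P P' q q'
  rw [pauliSign, if_neg (fun h' => h h'.1)] at this
  exact this.commute

theorem pauli_symm (P : PauliLabel) (q : Q) : (pauli P q).IsSymmetric := by
  cases P <;> refine onQubit_symm _ ?_ q <;> ext i j <;> fin_cases i <;> fin_cases j <;> simp

theorem norm_of_symm_of_sq {H : Type} [NormedAddCommGroup H] [InnerProductSpace ℂ H] {T : Op H}
    (hs : T.IsSymmetric) (h2 : T * T = 1) (ψ : H) : ‖T ψ‖ = ‖ψ‖ := by
  have h := hs ψ (T ψ)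
  have h2 : T (T ψ) = ψ := LinearMap.congr_fun h2 ψ
  rw [h2, inner_self_eq_norm_sq_to_K, inner_self_eq_norm_sq_to_K] at h
  have h3 : ‖T ψ‖ ^ 2 = ‖ψ‖ ^ 2 := by exact_mod_cast h
  exact (pow_left_inj₀ (norm_nonneg _) (norm_nonneg _) two_ne_zero).1 h3

theorem norm_pauli (P : PauliLabel) (q : Q) (ψ : QubitSpace Q) : ‖pauli P q ψ‖ = ‖ψ‖ :=
  norm_of_symm_of_sq (pauli_symm P q) (pauli_sq P q) ψ

theorem finrank_qubitSpace : Module.finrank ℂ (QubitSpace Q) = 2 ^ Fintype.card Q := by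
  rw [finrank_euclideanSpace, Fintype.card_fun, Fintype.card_fin]

end Paulis

/-! ### The encoded operators satisfy the edge relations and preserve the code space. -/

section EncodedRelations

variable {L₁ L₂ : ℕ}

theorem vertex_eq_iff (u v : Vertex L₁ L₂) : u = v ↔ (u.1 : ℕ) = v.1 ∧ (u.2 : ℕ) = v.2 := by
  rw [Prod.ext_iff, Fin.ext_iff, Fin.ext_iff]

theorem face_eq_iff (f g : Face L₁ L₂) : f = g ↔ (f.1 : ℕ) = g.1 ∧ (f.2 : ℕ) = g.2 := by
  rw [Prod.ext_iff, Fin.ext_iff, Fin.ext_iff]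

theorem mem_range_corner (f : Face L₁ L₂) (v : Vertex L₁ L₂) : v ∈ Set.range (corner f) ↔
    ((f.1 : ℕ) ≤ v.1 ∧ (v.1 : ℕ) ≤ f.1 + 1) ∧ ((f.2 : ℕ) ≤ v.2 ∧ (v.2 : ℕ) ≤ f.2 + 1) := by
  simp only [Set.mem_range, Fin.exists_fin_succ, corner, vertex_eq_iff]
  simp
  omega

/-- `0` for the clockwise orientation and `1` for the counterclockwise one. -/
def cwBit (cw : Bool) : ℕ := if cw then 0 else 1

/-- The orientation of the edges in terms of coordinates. -/
theorem arrow_iff (cw : Bool) (i j : Vertex L₁ L₂) : Arrow cw i j ↔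
    ((i.2 : ℕ) = j.2 ∧ (((j.1 : ℕ) = i.1 + 1 ∧ ((i.2 : ℕ) + cwBit cw) % 2 = 1) ∨
      ((i.1 : ℕ) = j.1 + 1 ∧ ((i.2 : ℕ) + cwBit cw) % 2 = 0))) ∨
    ((i.1 : ℕ) = j.1 ∧ (((j.2 : ℕ) = i.2 + 1 ∧ ((i.1 : ℕ) + cwBit cw) % 2 = 0) ∨
      ((i.2 : ℕ) = j.2 + 1 ∧ ((i.1 : ℕ) + cwBit cw) % 2 = 1))) := by
  rw [Arrow, lattice_adj_iff]
  simp only [Fin.ext_iff, Fin.lt_def, Nat.odd_iff, Nat.even_iff]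
  cases cw <;> simp only [cwBit, Bool.false_eq_true, if_true, if_false, iff_true, iff_false] <;>
    omega

theorem Arrow.asymm {cw : Bool} {i j : Vertex L₁ L₂} (h : Arrow cw i j) : ¬ Arrow cw j i := by
  rw [arrow_iff] at h ⊢
  omega

theorem arrow_or_arrow (cw : Bool) {i j : Vertex L₁ L₂} (h : (lattice L₁ L₂).Adj i j) :
    Arrow cw i j ∨ Arrow cw j i := by
  rw [lattice_adj_iff] at h
  simp only [Fin.ext_iff] at h
  rw [arrow_iff, arrow_iff]
  rcases h with ⟨h1 | h1, h2⟩ | ⟨h1 | h1, h2⟩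
  · rcases Nat.mod_two_eq_zero_or_one ((i.2 : ℕ) + cwBit cw) with h | h
    · exact Or.inr (Or.inl ⟨h2.symm, Or.inr ⟨h1.symm, h2 ▸ h⟩⟩)
    · exact Or.inl (Or.inl ⟨h2, Or.inl ⟨h1.symm, h⟩⟩)
  · rcases Nat.mod_two_eq_zero_or_one ((i.2 : ℕ) + cwBit cw) with h | h
    · exact Or.inl (Or.inl ⟨h2, Or.inr ⟨h1.symm, h⟩⟩)
    · exact Or.inr (Or.inl ⟨h2.symm, Or.inl ⟨h1.symm, h2 ▸ h⟩⟩)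
  · rcases Nat.mod_two_eq_zero_or_one ((i.1 : ℕ) + cwBit cw) with h | h
    · exact Or.inl (Or.inr ⟨h2, Or.inl ⟨h1.symm, h⟩⟩)
    · exact Or.inr (Or.inr ⟨h2.symm, Or.inr ⟨h1.symm, h2 ▸ h⟩⟩)
  · rcases Nat.mod_two_eq_zero_or_one ((i.1 : ℕ) + cwBit cw) with h | h
    · exact Or.inr (Or.inr ⟨h2.symm, Or.inl ⟨h1.symm, h2 ▸ h⟩⟩)
    · exact Or.inl (Or.inr ⟨h2, Or.inr ⟨h1.symm, h⟩⟩)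

theorem encEdge_of_arrow {cw : Bool} {i j : Vertex L₁ L₂} (h : Arrow cw i j) :
    encEdge cw i j = arrowOp i j := by
  rw [encEdge, if_pos h]

theorem encEdge_of_arrow' {cw : Bool} {i j : Vertex L₁ L₂} (h : Arrow cw j i) :
    encEdge cw i j = -arrowOp j i := by
  rw [encEdge, if_neg h.asymm, if_pos h]

/-- The face `f` contains the vertices `i` and `j`. -/
abbrev FaceContains (f : OddFace L₁ L₂) (i j : Vertex L₁ L₂) : Prop :=
  i ∈ Set.range (corner f.1) ∧ j ∈ Set.range (corner f.1)

/-- Two different faces sharing an edge are neighbours, hence of opposite parity. So the face chosen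
in `facePauli` is determined by the edge. -/
theorem FaceContains.unique {f g : OddFace L₁ L₂} {i j : Vertex L₁ L₂}
    (hij : (lattice L₁ L₂).Adj i j) (hf : FaceContains f i j) (hg : FaceContains g i j) :
    f = g := by
  obtain ⟨f, of⟩ := f
  obtain ⟨g, og⟩ := g
  simp only [FaceContains, mem_range_corner] at hf hg
  rw [lattice_adj_iff] at hij
  simp only [Fin.ext_iff] at hij
  rw [Subtype.mk.injEq, face_eq_iff]
  rw [IsOddFace, Nat.odd_iff] at of og
  omega

theorem facePauli_of_contains (P : Qubit L₁ L₂ → Op (QubitSpace (Qubit L₁ L₂)))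
    {f : OddFace L₁ L₂} {i j : Vertex L₁ L₂} (hij : (lattice L₁ L₂).Adj i j)
    (hf : FaceContains f i j) : facePauli P i j = P (Sum.inr f) := by
  have h : ∃ f : OddFace L₁ L₂, i ∈ Set.range (corner f.1) ∧ j ∈ Set.range (corner f.1) := ⟨f, hf⟩
  rw [facePauli, dif_pos h, FaceContains.unique hij h.choose_spec hf]

theorem facePauli_of_forall_not (P : Qubit L₁ L₂ → Op (QubitSpace (Qubit L₁ L₂)))
    {i j : Vertex L₁ L₂} (h : ∀ f : OddFace L₁ L₂, ¬ FaceContains f i j) :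
    facePauli P i j = 1 := by
  rw [facePauli, dif_neg]
  rintro ⟨f, hf⟩
  exact h f hf

theorem facePauli_comm (P : Qubit L₁ L₂ → Op (QubitSpace (Qubit L₁ L₂))) (i j : Vertex L₁ L₂) :
    facePauli P i j = facePauli P j i := by
  unfold facePauli
  simp only [and_comm]

/-- The label of the face Pauli of an edge. -/
def edgeLabel (i j : Vertex L₁ L₂) : PauliLabel := if i.2 = j.2 then .y else .x

/-- The face Pauli operator of an edge. -/
def faceFactor (i j : Vertex L₁ L₂) : Op (QubitSpace (Qubit L₁ L₂)) :=
  facePauli (pauli (edgeLabel i j)) i j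

theorem faceFactor_comm (i j : Vertex L₁ L₂) : faceFactor i j = faceFactor j i := by
  rw [faceFactor, faceFactor, facePauli_comm, edgeLabel, edgeLabel]
  simp only [eq_comm]

/-- The sign of the edge operator of an edge from `i` to `j`. -/
def arrowCoef (i j : Vertex L₁ L₂) : ℂ := if i.2 = j.2 then 1 else if j.2 < i.2 then 1 else -1

theorem arrowCoef_sq (i j : Vertex L₁ L₂) : arrowCoef i j * arrowCoef i j = 1 := by
  unfold arrowCoef
  split_ifs <;> norm_num

theorem arrowOp_eq (i j : Vertex L₁ L₂) : arrowOp i j =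
    arrowCoef i j • (pauli .x (Sum.inl i) * pauli .y (Sum.inl j) * faceFactor i j) := by
  unfold arrowOp arrowCoef faceFactor edgeLabel
  split_ifs <;> simp [pauli]

open Classical in
theorem faceFactor_commuteBy {i j k l : Vertex L₁ L₂} (hij : (lattice L₁ L₂).Adj i j)
    (hkl : (lattice L₁ L₂).Adj k l) :
    CommuteBy (if edgeLabel i j ≠ edgeLabel k l ∧
      ∃ f : OddFace L₁ L₂, FaceContains f i j ∧ FaceContains f k l then -1 else 1)
      (faceFactor i j) (faceFactor k l) := by
  by_cases h1 : ∃ f : OddFace L₁ L₂, FaceContains f i j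
  · obtain ⟨f, hf⟩ := h1
    by_cases h2 : ∃ f : OddFace L₁ L₂, FaceContains f k l
    · obtain ⟨g, hg⟩ := h2
      rw [faceFactor, faceFactor, facePauli_of_contains _ hij hf, facePauli_of_contains _ hkl hg]
      have := pauli_commuteBy (edgeLabel i j) (edgeLabel k l) (Sum.inr f : Qubit L₁ L₂)
        (Sum.inr g)
      rw [pauliSign] at this
      have e : (edgeLabel i j ≠ edgeLabel k l ∧
          ∃ f : OddFace L₁ L₂, FaceContains f i j ∧ FaceContains f k l) ↔
          ((Sum.inr f : Qubit L₁ L₂) = Sum.inr g ∧ edgeLabel i j ≠ edgeLabel k l) := by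
        rw [Sum.inr.injEq]
        constructor
        · rintro ⟨h, f', hf', hg'⟩
          exact ⟨(FaceContains.unique hij hf hf').trans (FaceContains.unique hkl hg' hg), h⟩
        · rintro ⟨rfl, h⟩
          exact ⟨h, f, hf, hg⟩
      convert this using 2
    · rw [if_neg (fun h => h2 (h.2.imp fun _ h' => h'.2))]
      push Not at h2
      rw [faceFactor, faceFactor, facePauli_of_forall_not (i := k) (j := l) _
        h2]
      exact CommuteBy.one_right _
  · rw [if_neg (fun h => h1 (h.2.imp fun _ h' => h'.1))]
    push Not at h1
    rw [faceFactor, faceFactor, facePauli_of_forall_not (i := i) (j := j) _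
      h1]
    exact CommuteBy.one_left _

theorem pauli_vertex_faceFactor (P : PauliLabel) (v i j : Vertex L₁ L₂) :
    Commute (pauli P (Sum.inl v)) (faceFactor i j) := by
  unfold faceFactor facePauli
  split_ifs
  · exact pauli_comm _ _ (by simp)
  · exact Commute.one_right _

theorem faceFactor_sq (i j : Vertex L₁ L₂) : faceFactor i j * faceFactor i j = 1 := by
  unfold faceFactor facePauli
  split_ifs
  · exact pauli_sq _ _
  · exact one_mul _

theorem norm_faceFactor (i j : Vertex L₁ L₂) (ψ) : ‖faceFactor i j ψ‖ = ‖ψ‖ := by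
  unfold faceFactor facePauli
  split_ifs
  · exact norm_pauli _ _ _
  · rfl

/-- Two distinct oriented edges at an odd face that have the same tail or the same head are
perpendicular, and any two perpendicular edges with the same tail or head lie on an odd face. -/
theorem exists_common_oddFace_iff {cw : Bool} {i j k l : Vertex L₁ L₂} (hij : Arrow cw i j)
    (hkl : Arrow cw k l) : (edgeLabel i j ≠ edgeLabel k l ∧
      ∃ f : OddFace L₁ L₂, FaceContains f i j ∧ FaceContains f k l) ↔ ¬(i = k ↔ j = l) := by
  -- The substantial case is a horizontal against a vertical edge. For parallel edges both sides are
  -- false, since on one line all arrows agree, so tail and head determine each other.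
  have key : ∀ {i j k l : Vertex L₁ L₂}, Arrow cw i j → Arrow cw k l → (i.2 : ℕ) = j.2 →
      ¬ (k.2 : ℕ) = l.2 →
      ((∃ f : OddFace L₁ L₂, FaceContains f i j ∧ FaceContains f k l) ↔ ¬(i = k ↔ j = l)) := by
    intro i j k l hij hkl h1 h2
    rw [arrow_iff] at hij hkl
    replace hij := hij.resolve_right (by omega)
    replace hkl := hkl.resolve_left (by omega)
    rw [vertex_eq_iff, vertex_eq_iff]
    constructor
    · rintro ⟨⟨f, of⟩, hf, hg⟩
      simp only [FaceContains, mem_range_corner] at hf hg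
      rw [IsOddFace, Nat.odd_iff] at of
      rcases hij with ⟨-, h3 | h3⟩ <;> rcases hkl with ⟨h4, h5 | h5⟩ <;> omega
    · intro h
      have hi1 := i.1.2
      have hj1 := j.1.2
      have hk1 := k.2.2
      have hl1 := l.2.2
      -- This is the face spanned by two perpendicular edges that meet. It is odd because around an
      -- even face arrows meet head to tail, never tail to tail or head to head.
      refine ⟨⟨(⟨min i.1 j.1, by omega⟩, ⟨min k.2 l.2, by omega⟩), ?_⟩, ?_⟩
      · rw [IsOddFace, Nat.odd_iff]
        simp only
        rcases hij with ⟨-, h3 | h3⟩ <;> rcases hkl with ⟨h4, h5 | h5⟩ <;> omega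
      · simp only [FaceContains, mem_range_corner]
        rcases hij with ⟨-, h3 | h3⟩ <;> rcases hkl with ⟨h4, h5 | h5⟩ <;> omega
  by_cases h1 : i.2 = j.2
  · by_cases h2 : k.2 = l.2
    · have e : edgeLabel i j = edgeLabel k l := by simp [edgeLabel, h1, h2]
      simp only [e, ne_eq, not_true, false_and, false_iff, not_not]
      rw [arrow_iff] at hij hkl
      rw [vertex_eq_iff, vertex_eq_iff]
      rw [Fin.ext_iff] at h1 h2
      rcases hij.resolve_right (by omega) with ⟨-, h3 | h3⟩ <;>
        rcases hkl.resolve_right (by omega) with ⟨-, h4 | h4⟩ <;> omega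
    · have e : edgeLabel i j ≠ edgeLabel k l := by simp [edgeLabel, h1, h2]
      rw [← key hij hkl (Fin.ext_iff.1 h1) (fun h => h2 (Fin.ext h))]
      exact and_iff_right e
  · by_cases h2 : k.2 = l.2
    · have e : edgeLabel i j ≠ edgeLabel k l := by simp [edgeLabel, h1, h2]
      rw [and_iff_right e]
      have := key hkl hij (Fin.ext_iff.1 h2) (fun h => h1 (Fin.ext h))
      rw [eq_comm (a := i), eq_comm (a := j), ← this]
      exact exists_congr fun f => and_comm
    · have e : edgeLabel i j = edgeLabel k l := by simp [edgeLabel, h1, h2]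
      simp only [e, ne_eq, not_true, false_and, false_iff, not_not]
      rw [arrow_iff] at hij hkl
      rw [vertex_eq_iff, vertex_eq_iff]
      rw [Fin.ext_iff] at h1 h2
      rcases hij.resolve_left (by omega) with ⟨h5, h3 | h3⟩ <;>
        rcases hkl.resolve_left (by omega) with ⟨h6, h4 | h4⟩ <;> omega

theorem pauliSign_same (P : PauliLabel) (v w : Vertex L₁ L₂) :
    pauliSign P P (Sum.inl v : Qubit L₁ L₂) (Sum.inl w) = 1 := by
  simp [pauliSign]

theorem pauliSign_ne {P P' : PauliLabel} (h : P ≠ P') (v w : Vertex L₁ L₂) :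
    pauliSign P P' (Sum.inl v : Qubit L₁ L₂) (Sum.inl w) = eqSign v w := by
  simp [pauliSign, eqSign, h]

theorem CommuteBy.of_commute {H : Type} [NormedAddCommGroup H] [InnerProductSpace ℂ H]
    {A B : Op H} (h : Commute A B) : CommuteBy 1 A B := by
  rw [CommuteBy, one_smul]
  exact h

/-- The heart of the encoding. With `X` at tails and `Y` at heads, the vertex qubits see only a tail
meeting a head, `eqSign i l * eqSign j k`. The missing `eqSign i k * eqSign j l` comes from the
odd-face qubits. -/
theorem arrowOp_commuteBy {cw : Bool} {i j k l : Vertex L₁ L₂} (hij : Arrow cw i j)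
    (hkl : Arrow cw k l) :
    CommuteBy (eqSign i k * eqSign i l * (eqSign j k * eqSign j l)) (arrowOp i j)
      (arrowOp k l) := by
  classical
  have hF := faceFactor_commuteBy hij.1 hkl.1
  have hs : (if edgeLabel i j ≠ edgeLabel k l ∧
      ∃ f : OddFace L₁ L₂, FaceContains f i j ∧ FaceContains f k l then (-1 : ℂ) else 1) =
      eqSign i k * eqSign j l := by
    rw [if_congr (exists_common_oddFace_iff hij hkl) rfl rfl]
    unfold eqSign
    by_cases h1 : i = k <;> by_cases h2 : j = l <;> simp [h1, h2]
  rw [hs] at hF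
  have one (P : PauliLabel) (v a b : Vertex L₁ L₂) :
      CommuteBy 1 (pauli P (Sum.inl v)) (faceFactor a b) :=
    CommuteBy.of_commute (pauli_vertex_faceFactor P v a b)
  have one' (P : PauliLabel) (v a b : Vertex L₁ L₂) :
      CommuteBy 1 (faceFactor a b) (pauli P (Sum.inl v)) :=
    CommuteBy.of_commute (pauli_vertex_faceFactor P v a b).symm
  have hx := ((pauli_commuteBy .x .x (Sum.inl i : Qubit L₁ L₂) (Sum.inl k)).mul_right
    (pauli_commuteBy .x .y (Sum.inl i : Qubit L₁ L₂) (Sum.inl l))).mul_right (one .x i k l)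
  have hy := ((pauli_commuteBy .y .x (Sum.inl j : Qubit L₁ L₂) (Sum.inl k)).mul_right
    (pauli_commuteBy .y .y (Sum.inl j : Qubit L₁ L₂) (Sum.inl l))).mul_right (one .y j k l)
  have hf := ((one' .x k i j).mul_right (one' .y l i j)).mul_right hF
  rw [pauliSign_same, pauliSign_ne (by decide)] at hx hy
  have := (((hx.mul_left hy).mul_left hf).smul_left (arrowCoef i j)).smul_right (arrowCoef k l)
  rw [arrowOp_eq, arrowOp_eq]
  convert this using 1
  ring

theorem arrowOp_vertex (i j k : Vertex L₁ L₂) :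
    CommuteBy (eqSign i k * eqSign j k) (arrowOp i j) (encVertex k) := by
  have hx := pauli_commuteBy .x .z (Sum.inl i : Qubit L₁ L₂) (Sum.inl k)
  have hy := pauli_commuteBy .y .z (Sum.inl j : Qubit L₁ L₂) (Sum.inl k)
  rw [pauliSign_ne (by decide)] at hx hy
  have := ((hx.mul_left hy).mul_left
    (CommuteBy.of_commute (pauli_vertex_faceFactor .z k i j).symm)).smul_left (arrowCoef i j)
  rw [mul_one] at this
  rw [arrowOp_eq]
  exact this

theorem arrowOp_sq {i j : Vertex L₁ L₂} (hij : i ≠ j) : arrowOp i j * arrowOp i j = 1 := by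
  rw [arrowOp_eq, smul_mul_smul_comm, arrowCoef_sq, one_smul]
  have h1 := pauli_vertex_faceFactor .x i i j
  have h2 := pauli_vertex_faceFactor .y j i j
  have h3 : Commute (pauli .x (Sum.inl i : Qubit L₁ L₂)) (pauli .y (Sum.inl j)) :=
    pauli_comm _ _ (by simpa using hij)
  rw [← pow_two, (h1.mul_left h2).mul_pow, h3.mul_pow, pow_two, pow_two, pow_two, pauli_sq,
    pauli_sq, faceFactor_sq, one_mul, one_mul]

theorem norm_arrowOp (i j : Vertex L₁ L₂) (ψ) : ‖arrowOp i j ψ‖ = ‖ψ‖ := by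
  have : ‖arrowCoef i j‖ = 1 := by
    unfold arrowCoef
    split_ifs <;> simp
  rw [arrowOp_eq, LinearMap.smul_apply, norm_smul, this, one_mul, Module.End.mul_apply,
    Module.End.mul_apply, norm_pauli, norm_pauli, norm_faceFactor]

theorem edgeRelations_enc (cw : Bool) :
    EdgeRelations (encEdge cw : Vertex L₁ L₂ → Vertex L₁ L₂ → _) encVertex where
  E_sq i j hij := by
    rcases arrow_or_arrow cw hij with h | h
    · rw [encEdge_of_arrow h, arrowOp_sq hij.ne]
    · rw [encEdge_of_arrow' h, neg_mul_neg, arrowOp_sq hij.ne.symm]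
  E_anti i j hij := by
    rcases arrow_or_arrow cw hij with h | h
    · rw [encEdge_of_arrow h, encEdge_of_arrow' h]
    · rw [encEdge_of_arrow h, encEdge_of_arrow' h, neg_neg]
  E_norm i j hij ψ := by
    rcases arrow_or_arrow cw hij with h | h
    · rw [encEdge_of_arrow h, norm_arrowOp]
    · rw [encEdge_of_arrow' h, LinearMap.neg_apply, norm_neg, norm_arrowOp]
  V_sq i := pauli_sq .z _
  V_symm i := pauli_symm .z _
  V_comm i j := by
    have := pauli_commuteBy .z .z (Sum.inl i : Qubit L₁ L₂) (Sum.inl j)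
    rw [pauliSign_same] at this
    exact this.commute
  EE i j k l hij hkl := by
    rcases arrow_or_arrow cw hij with h | h <;> rcases arrow_or_arrow cw hkl with h' | h'
    · rw [encEdge_of_arrow h, encEdge_of_arrow h']
      exact arrowOp_commuteBy h h'
    · rw [encEdge_of_arrow h, encEdge_of_arrow' h']
      convert (arrowOp_commuteBy h h').neg_right using 1
      ring
    · rw [encEdge_of_arrow' h, encEdge_of_arrow h']
      convert (arrowOp_commuteBy h h').neg_left using 1
      ring
    · rw [encEdge_of_arrow' h, encEdge_of_arrow' h']
      convert (arrowOp_commuteBy h h').neg_left.neg_right using 1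
      ring
  EV i j k hij := by
    rcases arrow_or_arrow cw hij with h | h
    · rw [encEdge_of_arrow h]
      exact arrowOp_vertex i j k
    · rw [encEdge_of_arrow' h]
      convert (arrowOp_vertex j i k).neg_left using 1
      ring

theorem corner_adj (f : Face L₁ L₂) (a : Fin 4) :
    (lattice L₁ L₂).Adj (corner f a) (corner f (a + 1)) := by
  rw [lattice_adj_iff]
  fin_cases a <;> simp [corner]

theorem faceLoop_eq (cw : Bool) (f : Face L₁ L₂) : faceLoop cw f =
    encEdge cw (corner f 0) (corner f 1) * encEdge cw (corner f 1) (corner f 2) *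
    encEdge cw (corner f 2) (corner f 3) * encEdge cw (corner f 3) (corner f 0) := by
  rw [faceLoop, Complex.I_pow_four, one_smul]

/-- Every corner is an end of two edges of the loop, so each sign appears squared. -/
theorem faceLoop_comm_edge (cw : Bool) (f : Face L₁ L₂) {k l : Vertex L₁ L₂}
    (hkl : (lattice L₁ L₂).Adj k l) : Commute (faceLoop cw f) (encEdge cw k l) := by
  have h := edgeRelations_enc (L₁ := L₁) (L₂ := L₂) cw
  have := (((h.EE _ _ k l (corner_adj f 0) hkl).mul_left
    (h.EE _ _ k l (corner_adj f 1) hkl)).mul_left (h.EE _ _ k l (corner_adj f 2) hkl)).mul_left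
      (h.EE _ _ k l (corner_adj f 3) hkl)
  rw [faceLoop_eq]
  apply CommuteBy.commute
  simp only [Fin.isValue, zero_add, Fin.reduceAdd] at this
  convert this using 1
  have e (a) := eqSign_sq (corner f a) k
  have e' (a) := eqSign_sq (corner f a) l
  symm
  calc _ = (eqSign (corner f 0) k * eqSign (corner f 0) k) *
        (eqSign (corner f 0) l * eqSign (corner f 0) l) *
        (eqSign (corner f 1) k * eqSign (corner f 1) k) *
        (eqSign (corner f 1) l * eqSign (corner f 1) l) *
        (eqSign (corner f 2) k * eqSign (corner f 2) k) *
        (eqSign (corner f 2) l * eqSign (corner f 2) l) *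
        (eqSign (corner f 3) k * eqSign (corner f 3) k) *
        (eqSign (corner f 3) l * eqSign (corner f 3) l) := by ring
    _ = 1 := by simp only [e, e', mul_one]

theorem faceLoop_comm_vertex (cw : Bool) (f : Face L₁ L₂) (k : Vertex L₁ L₂) :
    Commute (faceLoop cw f) (encVertex k) := by
  have h := edgeRelations_enc (L₁ := L₁) (L₂ := L₂) cw
  have := (((h.EV _ _ k (corner_adj f 0)).mul_left
    (h.EV _ _ k (corner_adj f 1))).mul_left (h.EV _ _ k (corner_adj f 2))).mul_left
      (h.EV _ _ k (corner_adj f 3))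
  rw [faceLoop_eq]
  apply CommuteBy.commute
  simp only [Fin.isValue, zero_add, Fin.reduceAdd] at this
  convert this using 1
  have e (a) := eqSign_sq (corner f a) k
  symm
  calc _ = (eqSign (corner f 0) k * eqSign (corner f 0) k) *
        (eqSign (corner f 1) k * eqSign (corner f 1) k) *
        (eqSign (corner f 2) k * eqSign (corner f 2) k) *
        (eqSign (corner f 3) k * eqSign (corner f 3) k) := by ring
    _ = 1 := by simp only [e, mul_one]

theorem faceLoop_comm_faceLoop (cw : Bool) (f g : Face L₁ L₂) :
    Commute (faceLoop cw f) (faceLoop cw g) := by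
  rw [faceLoop_eq cw g]
  exact (((faceLoop_comm_edge cw f (corner_adj g 0)).mul_right
    (faceLoop_comm_edge cw f (corner_adj g 1))).mul_right
    (faceLoop_comm_edge cw f (corner_adj g 2))).mul_right
    (faceLoop_comm_edge cw f (corner_adj g 3))

theorem mem_codeSpace_iff (cw : Bool) (ψ : QubitSpace (Qubit L₁ L₂)) :
    ψ ∈ codeSpace L₁ L₂ cw ↔ ∀ f : Face L₁ L₂, faceLoop cw f ψ = ψ := by
  constructor
  · intro h f
    by_cases hf : faceLoop cw f = 1
    · rw [hf]
      rfl
    · exact h _ ⟨hf, f, rfl⟩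
  · rintro h _ ⟨-, f, rfl⟩
    exact h f

theorem encEdge_mem_codeSpace (cw : Bool) (i j : Vertex L₁ L₂) (ψ : QubitSpace (Qubit L₁ L₂))
    (hψ : ψ ∈ codeSpace L₁ L₂ cw) : encEdge cw i j ψ ∈ codeSpace L₁ L₂ cw := by
  by_cases hij : (lattice L₁ L₂).Adj i j
  · rw [mem_codeSpace_iff] at hψ ⊢
    intro f
    have := LinearMap.congr_fun (faceLoop_comm_edge cw f hij).eq ψ
    rw [Module.End.mul_apply, Module.End.mul_apply, hψ] at this
    exact this
  · rw [encEdge, if_neg (fun h => hij h.1), if_neg (fun h => hij h.1.symm)]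
    exact Submodule.zero_mem _

theorem encVertex_mem_codeSpace (cw : Bool) (i : Vertex L₁ L₂) (ψ : QubitSpace (Qubit L₁ L₂))
    (hψ : ψ ∈ codeSpace L₁ L₂ cw) : encVertex i ψ ∈ codeSpace L₁ L₂ cw := by
  rw [mem_codeSpace_iff] at hψ ⊢
  intro f
  have := LinearMap.congr_fun (faceLoop_comm_vertex cw f i).eq ψ
  rw [Module.End.mul_apply, Module.End.mul_apply, hψ] at this
  exact this

end EncodedRelations

/-! ### Explicit form of the face loop operators. -/

section FaceLoops

variable {L₁ L₂ : ℕ}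

theorem corner_ne (f : Face L₁ L₂) {a b : Fin 4} (h : a ≠ b) : corner f a ≠ corner f b := by
  rw [Ne, vertex_eq_iff]
  fin_cases a <;> fin_cases b <;> first | exact absurd rfl h | simp [corner]

/-- Around an even face all edges circulate counterclockwise or all clockwise. -/
theorem arrow_even_face (cw : Bool) (f : Face L₁ L₂) (hf : ¬ IsOddFace f) :
    (Arrow cw (corner f 0) (corner f 1) ∧ Arrow cw (corner f 1) (corner f 2) ∧
      Arrow cw (corner f 2) (corner f 3) ∧ Arrow cw (corner f 3) (corner f 0)) ∨
    (Arrow cw (corner f 1) (corner f 0) ∧ Arrow cw (corner f 2) (corner f 1) ∧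
      Arrow cw (corner f 3) (corner f 2) ∧ Arrow cw (corner f 0) (corner f 3)) := by
  simp only [arrow_iff]
  simp [corner, Nat.odd_iff] at hf ⊢
  omega

/-- Around an odd face the directions of the edges alternate. -/
theorem arrow_odd_face (cw : Bool) (f : Face L₁ L₂) (hf : IsOddFace f) :
    (Arrow cw (corner f 0) (corner f 1) ∧ Arrow cw (corner f 2) (corner f 1) ∧
      Arrow cw (corner f 2) (corner f 3) ∧ Arrow cw (corner f 0) (corner f 3)) ∨
    (Arrow cw (corner f 1) (corner f 0) ∧ Arrow cw (corner f 1) (corner f 2) ∧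
      Arrow cw (corner f 3) (corner f 2) ∧ Arrow cw (corner f 3) (corner f 0)) := by
  simp only [arrow_iff]
  simp [corner, Nat.odd_iff] at hf ⊢
  omega

theorem arrowCoef_corner (f : Face L₁ L₂) :
    arrowCoef (corner f 0) (corner f 1) = 1 ∧ arrowCoef (corner f 1) (corner f 0) = 1 ∧
    arrowCoef (corner f 2) (corner f 3) = 1 ∧ arrowCoef (corner f 3) (corner f 2) = 1 ∧
    arrowCoef (corner f 1) (corner f 2) = -1 ∧ arrowCoef (corner f 2) (corner f 1) = 1 ∧
    arrowCoef (corner f 0) (corner f 3) = -1 ∧ arrowCoef (corner f 3) (corner f 0) = 1 := by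
  simp [arrowCoef, corner, Fin.lt_def]

theorem edgeLabel_corner (f : Face L₁ L₂) :
    edgeLabel (corner f 0) (corner f 1) = .y ∧ edgeLabel (corner f 1) (corner f 2) = .x ∧
    edgeLabel (corner f 2) (corner f 3) = .y ∧ edgeLabel (corner f 3) (corner f 0) = .x := by
  simp [edgeLabel, corner]

/-- Where directions alternate, a corner is the tail of both its edges or the head of both. It
therefore carries the same Pauli twice, and only the face qubit survives. -/
theorem alternating_product {A : Type} [Monoid A] {p q r s y x : A} (hp : p * p = 1)
    (hq : q * q = 1) (hr : r * r = 1) (hs : s * s = 1) (hqr : Commute q r) (hps : Commute p s)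
    (hyp : Commute y p) (hyq : Commute y q) (hyr : Commute y r)
    (hys : Commute y s) (hxp : Commute x p) (hxr : Commute x r) :
    p * q * y * (r * q * x) * (r * s * y) * (p * s * x) = y * x * (y * x) := by
  have h1 : p * q * y * (r * q * x) = p * r * (y * x) := by
    calc p * q * y * (r * q * x) = p * q * (y * (r * q)) * x := by simp only [mul_assoc]
      _ = p * (q * r) * q * y * x := by rw [(hyr.mul_right hyq).eq]; simp only [mul_assoc]
      _ = p * r * (q * q) * (y * x) := by rw [hqr.eq]; simp only [mul_assoc]
      _ = _ := by rw [hq, mul_one]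
  have h2 : r * s * y * (p * s * x) = r * p * (y * x) := by
    calc r * s * y * (p * s * x) = r * s * (y * (p * s)) * x := by simp only [mul_assoc]
      _ = r * (s * p) * s * y * x := by rw [(hyp.mul_right hys).eq]; simp only [mul_assoc]
      _ = r * p * (s * s) * (y * x) := by rw [hps.symm.eq]; simp only [mul_assoc]
      _ = _ := by rw [hs, mul_one]
  have h3 : Commute (y * x) (r * p) :=
    (hyr.mul_left hxr).mul_right (hyp.mul_left hxp)
  calc p * q * y * (r * q * x) * (r * s * y) * (p * s * x)
      = p * q * y * (r * q * x) * (r * s * y * (p * s * x)) := by simp only [mul_assoc]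
    _ = p * r * (y * x * (r * p)) * (y * x) := by rw [h1, h2]; simp only [mul_assoc]
    _ = p * (r * r) * p * (y * x * (y * x)) := by rw [h3.eq]; simp only [mul_assoc]
    _ = _ := by rw [hr, mul_one, hp, one_mul]

theorem pauli_yxyx {Q : Type} [Fintype Q] [DecidableEq Q] (q : Q) :
    pauli .y q * pauli .x q * (pauli .y q * pauli .x q) = -1 := by
  have h : pauli .y q * pauli .x q = -Complex.I • pauli .z q := pauliY_mul_pauliX q
  rw [h, smul_mul_smul_comm, pauli_sq, neg_mul_neg, Complex.I_mul_I, neg_one_smul]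

/-- The loop operators of the odd faces are trivial. -/
theorem faceLoop_odd (cw : Bool) (f : Face L₁ L₂) (hf : IsOddFace f) : faceLoop cw f = 1 := by
  set g : OddFace L₁ L₂ := ⟨f, hf⟩ with hg
  have hc : ∀ a b, FaceContains g (corner f a) (corner f b) := fun a b => ⟨⟨a, rfl⟩, ⟨b, rfl⟩⟩
  obtain ⟨l0, l1, l2, l3⟩ := edgeLabel_corner f
  have a0 : (lattice L₁ L₂).Adj (corner f 0) (corner f 1) := corner_adj f 0
  have a1 : (lattice L₁ L₂).Adj (corner f 1) (corner f 2) := corner_adj f 1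
  have a2 : (lattice L₁ L₂).Adj (corner f 2) (corner f 3) := corner_adj f 2
  have a3 : (lattice L₁ L₂).Adj (corner f 3) (corner f 0) := corner_adj f 3
  have F0 : faceFactor (corner f 0) (corner f 1) = pauli .y (Sum.inr g) := by
    rw [faceFactor, facePauli_of_contains _ a0 (hc 0 1), l0]
  have F1 : faceFactor (corner f 1) (corner f 2) = pauli .x (Sum.inr g) := by
    rw [faceFactor, facePauli_of_contains _ a1 (hc 1 2), l1]
  have F2 : faceFactor (corner f 2) (corner f 3) = pauli .y (Sum.inr g) := by
    rw [faceFactor, facePauli_of_contains _ a2 (hc 2 3), l2]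
  have F3 : faceFactor (corner f 3) (corner f 0) = pauli .x (Sum.inr g) := by
    rw [faceFactor, facePauli_of_contains _ a3 (hc 3 0), l3]
  have cf : ∀ (P P' : PauliLabel) (v : Vertex L₁ L₂),
      Commute (pauli P (Sum.inr g : Qubit L₁ L₂)) (pauli P' (Sum.inl v)) :=
    fun P P' v => pauli_comm P P' (by simp)
  have cv : ∀ (P P' : PauliLabel) {a b : Fin 4}, a ≠ b →
      Commute (pauli P (Sum.inl (corner f a) : Qubit L₁ L₂)) (pauli P' (Sum.inl (corner f b))) :=
    fun P P' {a b} h => pauli_comm P P' (fun e => corner_ne f h (Sum.inl.inj e))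
  have key : ∀ P P' : PauliLabel,
      pauli P (Sum.inl (corner f 0)) * pauli P' (Sum.inl (corner f 1)) * pauli .y (Sum.inr g) *
      (pauli P (Sum.inl (corner f 2)) * pauli P' (Sum.inl (corner f 1)) * pauli .x (Sum.inr g)) *
      (pauli P (Sum.inl (corner f 2)) * pauli P' (Sum.inl (corner f 3)) * pauli .y (Sum.inr g)) *
      (pauli P (Sum.inl (corner f 0)) * pauli P' (Sum.inl (corner f 3)) * pauli .x (Sum.inr g)) =
      -1 := by
    intro P P'
    rw [← pauli_yxyx (Sum.inr g : Qubit L₁ L₂)]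
    exact alternating_product (pauli_sq _ _) (pauli_sq _ _) (pauli_sq _ _) (pauli_sq _ _)
      (cv _ _ (by decide)) (cv _ _ (by decide)) (cf _ _ _) (cf _ _ _) (cf _ _ _) (cf _ _ _)
      (cf _ _ _) (cf _ _ _)
  -- In both orientations two edges are traversed backwards and exactly one arrow points up, a net
  -- sign `-1` that compensates `YXYX = -1`.
  obtain ⟨k01, k10, k23, k32, k12, k21, k03, k30⟩ := arrowCoef_corner f
  rw [faceLoop_eq]
  rcases arrow_odd_face cw f hf with ⟨h0, h1, h2, h3⟩ | ⟨h0, h1, h2, h3⟩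
  · rw [encEdge_of_arrow h0, encEdge_of_arrow' h1, encEdge_of_arrow h2, encEdge_of_arrow' h3,
      arrowOp_eq, arrowOp_eq, arrowOp_eq, arrowOp_eq, k01, k21, k23, k03,
      faceFactor_comm (corner f 2) (corner f 1), faceFactor_comm (corner f 0) (corner f 3), F0, F1,
      F2, F3]
    simp only [one_smul, neg_one_smul, neg_neg, mul_neg, neg_mul]
    rw [key, neg_neg]
  · rw [encEdge_of_arrow' h0, encEdge_of_arrow h1, encEdge_of_arrow' h2, encEdge_of_arrow h3,
      arrowOp_eq, arrowOp_eq, arrowOp_eq, arrowOp_eq, k10, k12, k32, k30,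
      faceFactor_comm (corner f 1) (corner f 0), faceFactor_comm (corner f 3) (corner f 2), F0, F1,
      F2, F3]
    simp only [one_smul, neg_one_smul, neg_neg, mul_neg, neg_mul]
    rw [(cv .x .y (a := 1) (b := 0) (by decide)).eq, (cv .x .y (a := 1) (b := 2) (by decide)).eq,
      (cv .x .y (a := 3) (b := 2) (by decide)).eq, (cv .x .y (a := 3) (b := 0) (by decide)).eq,
      key, neg_neg]

/-- Around a circulating face each corner carries one tail Pauli `a` and one head Pauli `b`.
Carrying `b 0` around to `a 0` pairs them up; the face factors keep their order. -/
theorem circulating_product {A : Type} [Monoid A] (a b F : Fin 4 → A)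
    (hFa : ∀ i j, Commute (F i) (a j)) (hFb : ∀ i j, Commute (F i) (b j))
    (hb : ∀ j, j ≠ 0 → Commute (b 0) (b j)) (ha : ∀ j, j ≠ 0 → Commute (b 0) (a j)) :
    a 0 * b 1 * F 0 * (a 1 * b 2 * F 1) * (a 2 * b 3 * F 2) * (a 3 * b 0 * F 3) =
      a 0 * b 0 * (b 1 * a 1) * (b 2 * a 2) * (b 3 * a 3) * (F 0 * F 1 * F 2 * F 3) := by
  have hF (i j k : Fin 4) : Commute (F i) (a j * b k) := (hFa i j).mul_right (hFb i k)
  have h0 : Commute (b 0) (b 1 * a 1 * (b 2 * a 2) * (b 3 * a 3)) :=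
    (((hb 1 (by decide)).mul_right (ha 1 (by decide))).mul_right
      ((hb 2 (by decide)).mul_right (ha 2 (by decide)))).mul_right
      ((hb 3 (by decide)).mul_right (ha 3 (by decide)))
  calc a 0 * b 1 * F 0 * (a 1 * b 2 * F 1) * (a 2 * b 3 * F 2) * (a 3 * b 0 * F 3)
      = a 0 * b 1 * (F 0 * (a 1 * b 2)) * (F 1 * (a 2 * b 3)) * (F 2 * (a 3 * b 0)) * F 3 := by
        simp only [mul_assoc]
    _ = a 0 * b 1 * (a 1 * b 2) * (F 0 * (a 2 * b 3)) * (F 1 * (a 3 * b 0)) * F 2 * F 3 := by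
        rw [(hF 0 1 2).eq, (hF 1 2 3).eq, (hF 2 3 0).eq]
        simp only [mul_assoc]
    _ = a 0 * b 1 * (a 1 * b 2) * (a 2 * b 3) * (F 0 * (a 3 * b 0)) * F 1 * F 2 * F 3 := by
        rw [(hF 0 2 3).eq, (hF 1 3 0).eq]
        simp only [mul_assoc]
    _ = a 0 * (b 1 * a 1 * (b 2 * a 2) * (b 3 * a 3) * b 0) * (F 0 * F 1 * F 2 * F 3) := by
        rw [(hF 0 3 0).eq]
        simp only [mul_assoc]
    _ = _ := by
        rw [← h0.eq]
        simp only [mul_assoc]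

/-- The loop operator of an even face is the product of `Z` over its corners and of the face Pauli
operators of its edges. -/
theorem faceLoop_even (cw : Bool) (f : Face L₁ L₂) (hf : ¬ IsOddFace f) : faceLoop cw f =
    encVertex (corner f 0) * encVertex (corner f 1) * encVertex (corner f 2) *
      encVertex (corner f 3) *
    (faceFactor (corner f 0) (corner f 1) * faceFactor (corner f 1) (corner f 2) *
      faceFactor (corner f 2) (corner f 3) * faceFactor (corner f 3) (corner f 0)) := by
  have cv : ∀ (P P' : PauliLabel) {a b : Fin 4}, a ≠ b →
      Commute (pauli P (Sum.inl (corner f a) : Qubit L₁ L₂)) (pauli P' (Sum.inl (corner f b))) :=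
    fun P P' {a b} h => pauli_comm P P' (fun e => corner_ne f h (Sum.inl.inj e))
  have key := fun P P' => circulating_product
    (fun a => pauli P (Sum.inl (corner f a) : Qubit L₁ L₂))
    (fun a => pauli P' (Sum.inl (corner f a) : Qubit L₁ L₂))
    (fun a => faceFactor (corner f a) (corner f (a + 1)))
    (fun _ _ => (pauli_vertex_faceFactor P _ _ _).symm)
    (fun _ _ => (pauli_vertex_faceFactor P' _ _ _).symm)
    (fun j h => cv P' P' h.symm) (fun j h => cv P' P h.symm)
  have hxy : ∀ v : Vertex L₁ L₂, pauli .x (Sum.inl v) * pauli .y (Sum.inl v) =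
      Complex.I • encVertex v := fun v => pauliX_mul_pauliY (Sum.inl v)
  have hyx : ∀ v : Vertex L₁ L₂, pauli .y (Sum.inl v) * pauli .x (Sum.inl v) =
      -Complex.I • encVertex v := fun v => pauliY_mul_pauliX (Sum.inl v)
  have key1 := key .x .y
  have key2 := key .y .x
  simp only [hxy, hyx, Fin.isValue, zero_add, Fin.reduceAdd, smul_mul_assoc, mul_smul_comm,
    smul_smul, neg_mul, mul_neg, neg_neg, Complex.I_mul_I, mul_one] at key1 key2
  -- The corners contribute `i (-i)³ = -1` or `(-i) i³ = -1`. The single upward arrow cancels this,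
  -- and four reversals have no effect.
  obtain ⟨k01, k10, k23, k32, k12, k21, k03, k30⟩ := arrowCoef_corner f
  rw [faceLoop_eq]
  rcases arrow_even_face cw f hf with ⟨h0, h1, h2, h3⟩ | ⟨h0, h1, h2, h3⟩
  · rw [encEdge_of_arrow h0, encEdge_of_arrow h1, encEdge_of_arrow h2, encEdge_of_arrow h3,
      arrowOp_eq, arrowOp_eq, arrowOp_eq, arrowOp_eq, k01, k12, k23, k30]
    simp only [one_smul, neg_one_smul, mul_neg, neg_mul]
    rw [key1, neg_one_smul, neg_neg]
  · rw [encEdge_of_arrow' h0, encEdge_of_arrow' h1, encEdge_of_arrow' h2, encEdge_of_arrow' h3,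
      arrowOp_eq, arrowOp_eq, arrowOp_eq, arrowOp_eq, k10, k21, k32, k03,
      faceFactor_comm (corner f 1) (corner f 0), faceFactor_comm (corner f 2) (corner f 1),
      faceFactor_comm (corner f 3) (corner f 2), faceFactor_comm (corner f 0) (corner f 3)]
    simp only [one_smul, neg_one_smul, neg_neg, mul_neg, neg_mul]
    rw [(cv .x .y (a := 1) (b := 0) (by decide)).eq, (cv .x .y (a := 2) (b := 1) (by decide)).eq,
      (cv .x .y (a := 3) (b := 2) (by decide)).eq, (cv .x .y (a := 0) (b := 3) (by decide)).eq,
      key2, neg_one_smul, neg_neg]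

theorem CommuteBy.sq_mul {H : Type} [NormedAddCommGroup H] [InnerProductSpace ℂ H] {s : ℂ}
    {A B : Op H} (h : CommuteBy s A B) (hs : s * s = 1) (hA : A * A = 1) :
    A * B * (A * B) = s • (B * B) := by
  have h' : B * A = s • (A * B) := h.symm hs
  calc A * B * (A * B) = A * (B * A) * B := by simp only [mul_assoc]
    _ = s • (A * A * (B * B)) := by
      rw [h', mul_smul_comm, smul_mul_assoc]
      simp only [mul_assoc]
    _ = _ := by rw [hA, one_mul]

/-- Opposite edges commute and consecutive ones anticommute; the four anticommuting pairs give an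
even number of signs. -/
theorem faceLoop_sq (cw : Bool) (f : Face L₁ L₂) : faceLoop cw f * faceLoop cw f = 1 := by
  have h := edgeRelations_enc (L₁ := L₁) (L₂ := L₂) cw
  have e : ∀ {a b : Fin 4}, a ≠ b → eqSign (corner f a) (corner f b) = 1 :=
    fun hab => eqSign_of_ne (corner_ne f hab)
  have a0 : (lattice L₁ L₂).Adj (corner f 0) (corner f 1) := corner_adj f 0
  have a1 : (lattice L₁ L₂).Adj (corner f 1) (corner f 2) := corner_adj f 1
  have a2 : (lattice L₁ L₂).Adj (corner f 2) (corner f 3) := corner_adj f 2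
  have a3 : (lattice L₁ L₂).Adj (corner f 3) (corner f 0) := corner_adj f 3
  have c01 := h.EE _ _ _ _ a0 a1
  have c02 := h.EE _ _ _ _ a0 a2
  have c03 := h.EE _ _ _ _ a0 a3
  have c12 := h.EE _ _ _ _ a1 a2
  have c13 := h.EE _ _ _ _ a1 a3
  have c23 := h.EE _ _ _ _ a2 a3
  simp only [eqSign_self, e (a := 0) (b := 1) (by decide), e (a := 0) (b := 2) (by decide),
    e (a := 0) (b := 3) (by decide), e (a := 1) (b := 2) (by decide),
    e (a := 1) (b := 3) (by decide), e (a := 2) (b := 3) (by decide),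
    e (a := 3) (b := 0) (by decide), e (a := 1) (b := 0) (by decide), e (a := 2) (b := 0) (by decide), mul_one, one_mul]
    at c01 c02 c03 c12 c13 c23
  have s2 := c23.sq_mul (by norm_num) (h.E_sq _ _ a2)
  have s1 := (c12.mul_right c13).sq_mul (by norm_num) (h.E_sq _ _ a1)
  have s0 := (c01.mul_right (c02.mul_right c03)).sq_mul (by norm_num) (h.E_sq _ _ a0)
  rw [s1, s2, h.E_sq _ _ a3] at s0
  have s : (-1 * (1 * -1) : ℂ) • (-1 * 1 : ℂ) • (-1 : ℂ) • (1 : Op (QubitSpace (Qubit L₁ L₂))) = 1 := by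
    simp
  rw [s] at s0
  rw [faceLoop_eq]
  simp only [mul_assoc] at s0 ⊢
  exact s0

end FaceLoops

/-! ### Independence of the stabilizers and the dimension of the code space. -/

section Syndromes

variable {L₁ L₂ : ℕ}

theorem corner_val (f : Face L₁ L₂) :
    (((corner f 0).1 : ℕ) = f.1 ∧ ((corner f 0).2 : ℕ) = f.2) ∧
    (((corner f 1).1 : ℕ) = f.1 + 1 ∧ ((corner f 1).2 : ℕ) = f.2) ∧
    (((corner f 2).1 : ℕ) = f.1 + 1 ∧ ((corner f 2).2 : ℕ) = f.2 + 1) ∧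
    (((corner f 3).1 : ℕ) = f.1 ∧ ((corner f 3).2 : ℕ) = f.2 + 1) := by
  simp [corner]

/-- A vertex equals at most one corner of a face. The monoid is general because both signs and
exponents are multiplied over corners. -/
theorem prod_ite_corners {A : Type} [CommMonoid A] (c : A) (p p' q q' : Prop) [Decidable p]
    [Decidable p'] [Decidable q] [Decidable q'] (hp : ¬ (p ∧ p')) (hq : ¬ (q ∧ q')) :
    (if p ∧ q then c else 1) * (if p' ∧ q then c else 1) * (if p' ∧ q' then c else 1) *
      (if p ∧ q' then c else 1) = if (p ∨ p') ∧ (q ∨ q') then c else 1 := by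
  by_cases hp0 : p <;> by_cases hp1 : p' <;> by_cases hq0 : q <;> by_cases hq1 : q' <;>
    simp_all

theorem pauliX_encVertex (v w : Vertex L₁ L₂) :
    CommuteBy (eqSign v w) (pauli .x (Sum.inl v)) (encVertex w) := by
  have := pauli_commuteBy .x .z (Sum.inl v : Qubit L₁ L₂) (Sum.inl w)
  rw [pauliSign_ne (by decide)] at this
  exact this

theorem pauli_vertex_faceFactors (P : PauliLabel) (v : Vertex L₁ L₂) (g : Face L₁ L₂) :
    Commute (pauli P (Sum.inl v)) (faceFactor (corner g 0) (corner g 1) *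
      faceFactor (corner g 1) (corner g 2) * faceFactor (corner g 2) (corner g 3) *
      faceFactor (corner g 3) (corner g 0)) :=
  (((pauli_vertex_faceFactor P v _ _).mul_right (pauli_vertex_faceFactor P v _ _)).mul_right
    (pauli_vertex_faceFactor P v _ _)).mul_right (pauli_vertex_faceFactor P v _ _)

theorem pauliX_faceLoop (cw : Bool) (v : Vertex L₁ L₂) (g : Face L₁ L₂) (hg : ¬ IsOddFace g) :
    CommuteBy (eqSign v (corner g 0) * eqSign v (corner g 1) * eqSign v (corner g 2) *
      eqSign v (corner g 3)) (pauli .x (Sum.inl v)) (faceLoop cw g) := by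
  have h := ((((pauliX_encVertex v (corner g 0)).mul_right
    (pauliX_encVertex v (corner g 1))).mul_right (pauliX_encVertex v (corner g 2))).mul_right
    (pauliX_encVertex v (corner g 3))).mul_right
    (CommuteBy.of_commute (pauli_vertex_faceFactors .x v g))
  rw [mul_one] at h
  rw [faceLoop_even cw g hg]
  exact h

theorem flip_vertex_faceLoop (cw : Bool) (v : Vertex L₁ L₂) (g : Face L₁ L₂)
    (hg : ¬ IsOddFace g) : CommuteBy
      (if ((v.1 : ℕ) = g.1 ∨ (v.1 : ℕ) = g.1 + 1) ∧ ((v.2 : ℕ) = g.2 ∨ (v.2 : ℕ) = g.2 + 1) then -1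
        else 1) (pauli .x (Sum.inl v)) (faceLoop cw g) := by
  have this := pauliX_faceLoop cw v g hg
  obtain ⟨h0, h1, h2, h3⟩ := corner_val g
  have e0 : eqSign v (corner g 0) = if (v.1 : ℕ) = g.1 ∧ (v.2 : ℕ) = g.2 then -1 else 1 :=
    if_congr (by rw [vertex_eq_iff, h0.1, h0.2]) rfl rfl
  have e1 : eqSign v (corner g 1) = if (v.1 : ℕ) = g.1 + 1 ∧ (v.2 : ℕ) = g.2 then -1 else 1 :=
    if_congr (by rw [vertex_eq_iff, h1.1, h1.2]) rfl rfl
  have e2 : eqSign v (corner g 2) = if (v.1 : ℕ) = g.1 + 1 ∧ (v.2 : ℕ) = g.2 + 1 then -1 else 1 :=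
    if_congr (by rw [vertex_eq_iff, h2.1, h2.2]) rfl rfl
  have e3 : eqSign v (corner g 3) = if (v.1 : ℕ) = g.1 ∧ (v.2 : ℕ) = g.2 + 1 then -1 else 1 :=
    if_congr (by rw [vertex_eq_iff, h3.1, h3.2]) rfl rfl
  rw [e0, e1, e2, e3, prod_ite_corners _ _ _ _ _ (by omega) (by omega)] at this
  exact this

/-- The product of the Pauli operators `X` along the diagonal from `(x, y)` down to the boundary. -/
def diagonalX : ∀ x y : ℕ, x < L₁ → y < L₂ → Op (QubitSpace (Qubit L₁ L₂))
  | 0, y, hx, hy => pauli .x (Sum.inl (⟨0, hx⟩, ⟨y, hy⟩))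
  | x + 1, 0, hx, hy => pauli .x (Sum.inl (⟨x + 1, hx⟩, ⟨0, hy⟩))
  | x + 1, y + 1, hx, hy => pauli .x (Sum.inl (⟨x + 1, hx⟩, ⟨y + 1, hy⟩)) *
      diagonalX x y (Nat.lt_of_succ_lt hx) (Nat.lt_of_succ_lt hy)

theorem norm_diagonalX : ∀ (x y : ℕ) (hx : x < L₁) (hy : y < L₂) (ψ),
    ‖diagonalX x y hx hy ψ‖ = ‖ψ‖
  | 0, _, _, _, _ => norm_pauli _ _ _
  | _ + 1, 0, _, _, _ => norm_pauli _ _ _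
  | x + 1, y + 1, hx, hy, ψ => by
    rw [diagonalX, Module.End.mul_apply, norm_pauli, norm_diagonalX]

/-- When `x + y` is even, the even faces touching `(x, y)` can only be those with lower left corners
`(x, y)` and `(x - 1, y - 1)`. Along the diagonal the flips cancel in consecutive pairs; at the
boundary the second face is absent, so only the face `(x, y)` stays flipped. -/
theorem diagonalX_faceLoop (cw : Bool) (g : Face L₁ L₂) (hg : ¬ IsOddFace g) :
    ∀ (x y : ℕ) (hx : x < L₁) (hy : y < L₂), (x + y) % 2 = 0 →
      CommuteBy (if (g.1 : ℕ) = x ∧ (g.2 : ℕ) = y then -1 else 1) (diagonalX x y hx hy)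
        (faceLoop cw g)
  | 0, y, hx, hy, hxy => by
    have h := flip_vertex_faceLoop cw (⟨0, hx⟩, ⟨y, hy⟩) g hg
    simp only [Nat.not_odd_iff] at hg
    rw [diagonalX]
    convert h using 1
    refine if_congr ?_ rfl rfl
    simp only
    omega
  | x + 1, 0, hx, hy, hxy => by
    have h := flip_vertex_faceLoop cw (⟨x + 1, hx⟩, ⟨0, hy⟩) g hg
    simp only [Nat.not_odd_iff] at hg
    rw [diagonalX]
    convert h using 1
    refine if_congr ?_ rfl rfl
    simp only
    omega
  | x + 1, y + 1, hx, hy, hxy => by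
    have h := flip_vertex_faceLoop cw (⟨x + 1, hx⟩, ⟨y + 1, hy⟩) g hg
    have ih := diagonalX_faceLoop cw g hg x y (Nat.lt_of_succ_lt hx) (Nat.lt_of_succ_lt hy)
      (by omega)
    rw [diagonalX]
    convert h.mul_left ih using 1
    simp only [Nat.not_odd_iff] at hg
    simp only
    split_ifs <;> first | omega | norm_num

/-- The operator that flips the sign of the loop operator of the even face `f` only. -/
def flipper (f : EvenFace L₁ L₂) : Op (QubitSpace (Qubit L₁ L₂)) :=
  diagonalX f.1.1 f.1.2 (by have := f.1.1.2; omega) (by have := f.1.2.2; omega)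

theorem flipper_injective (f : EvenFace L₁ L₂) : Function.Injective (flipper f) := by
  intro ψ φ h
  rw [← sub_eq_zero, ← map_sub, ← norm_eq_zero] at h
  rw [flipper, norm_diagonalX, norm_eq_zero, sub_eq_zero] at h
  exact h

theorem flipper_faceLoop (cw : Bool) (f g : EvenFace L₁ L₂) :
    CommuteBy (if f = g then -1 else 1) (flipper f) (faceLoop cw g.1) := by
  have hf := f.2
  simp only [Nat.not_odd_iff] at hf
  have := diagonalX_faceLoop cw g.1 g.2 f.1.1 f.1.2 (by have := f.1.1.2; omega)
    (by have := f.1.2.2; omega) hf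
  rw [flipper]
  convert this using 1
  refine if_congr ?_ rfl rfl
  rw [Subtype.ext_iff, face_eq_iff]
  omega

theorem faceLoop_ne_one (cw : Bool) (f : EvenFace L₁ L₂) : faceLoop cw f.1 ≠ 1 := by
  intro h
  have h1 := flipper_faceLoop cw f f
  rw [if_pos rfl, h] at h1
  have h2 : flipper f = -flipper f := by simpa using h1.anticommute
  have h3 : (2 : ℂ) • flipper f = 0 := by
    rw [two_smul]
    exact add_eq_zero_iff_eq_neg.2 h2
  have h4 := (smul_eq_zero.1 h3).resolve_left two_ne_zero
  have h5 := flipper_injective f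
  rw [h4] at h5
  obtain ⟨ψ, hψ⟩ := exists_ne (0 : QubitSpace (Qubit L₁ L₂))
  exact hψ (h5 rfl)

/-- `flipper f` anticommutes with the loop of `f` and commutes with that of any other even face. -/
theorem faceLoop_injective (cw : Bool) :
    Function.Injective fun f : EvenFace L₁ L₂ => faceLoop cw f.1 := by
  intro f g h
  by_contra hne
  have h1 := flipper_faceLoop cw f f
  have h2 := flipper_faceLoop cw f g
  simp only at h
  rw [if_neg hne, ← h] at h2
  rw [if_pos rfl] at h1
  have h3 : flipper f * faceLoop cw f.1 = -(flipper f * faceLoop cw f.1) := by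
    conv_lhs => rw [h1.anticommute, ← h2.commute]
  have h4 : (2 : ℂ) • (flipper f * faceLoop cw f.1) = 0 := by
    rw [two_smul]
    exact add_eq_zero_iff_eq_neg.2 h3
  have h5 := (smul_eq_zero.1 h4).resolve_left two_ne_zero
  have h6 : flipper f = 0 := by
    calc flipper f = flipper f * faceLoop cw f.1 * faceLoop cw f.1 := by
          rw [mul_assoc, faceLoop_sq, mul_one]
      _ = 0 := by rw [h5, zero_mul]
  have h7 := flipper_injective f
  rw [h6] at h7
  obtain ⟨ψ, hψ⟩ := exists_ne (0 : QubitSpace (Qubit L₁ L₂))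
  exact hψ (h7 rfl)

theorem stabilizers_eq_range (cw : Bool) :
    stabilizers L₁ L₂ cw = Set.range fun f : EvenFace L₁ L₂ => faceLoop cw f.1 := by
  ext S
  constructor
  · rintro ⟨h, f, rfl⟩
    exact ⟨⟨f, fun hf => h (faceLoop_odd cw f hf)⟩, rfl⟩
  · rintro ⟨f, rfl⟩
    exact ⟨faceLoop_ne_one cw f, f.1, rfl⟩

theorem ncard_stabilizers (cw : Bool) :
    (stabilizers L₁ L₂ cw).ncard = Fintype.card (EvenFace L₁ L₂) := by
  rw [stabilizers_eq_range, Set.ncard_range_of_injective (faceLoop_injective cw),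
    Nat.card_eq_fintype_card]

theorem two_pow_mul_finrank_codeSpace (cw : Bool) :
    2 ^ Fintype.card (EvenFace L₁ L₂) * Module.finrank ℂ (codeSpace L₁ L₂ cw) =
      2 ^ Fintype.card (Qubit L₁ L₂) := by
  have h := two_pow_mul_finrank_jointFixed (fun f : EvenFace L₁ L₂ => faceLoop cw f.1) flipper
    (Finset.univ : Finset (EvenFace L₁ L₂)).toList (Finset.nodup_toList _)
    (fun f g => (faceLoop_comm_faceLoop cw f.1 g.1).eq) (fun f => faceLoop_sq cw f.1)
    flipper_injective
    (fun f => by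
      have := flipper_faceLoop cw f f
      rw [if_pos rfl] at this
      exact this.anticommute)
    (fun f g hfg => by
      have := flipper_faceLoop cw f g
      rw [if_neg hfg] at this
      exact this.commute)
  have e : jointFixed (fun f : EvenFace L₁ L₂ => faceLoop cw f.1)
      (Finset.univ : Finset (EvenFace L₁ L₂)).toList = codeSpace L₁ L₂ cw := by
    ext ψ
    rw [mem_codeSpace_iff, mem_jointFixed]
    constructor
    · intro h f
      by_cases hf : IsOddFace f
      · rw [faceLoop_odd cw f hf]
        rfl
      · exact h ⟨f, hf⟩ (by simp)
    · intro h f _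
      exact h f.1
  rw [e, Finset.length_toList, Finset.card_univ, finrank_qubitSpace] at h
  exact h

theorem card_face : Fintype.card (Face L₁ L₂) = (L₁ - 1) * (L₂ - 1) := by
  rw [Fintype.card_prod, Fintype.card_fin, Fintype.card_fin]

theorem card_evenFace_add_card_oddFace :
    Fintype.card (EvenFace L₁ L₂) + Fintype.card (OddFace L₁ L₂) = (L₁ - 1) * (L₂ - 1) := by
  rw [Fintype.card_subtype_compl, ← card_face]
  exact Nat.sub_add_cancel (Fintype.card_subtype_le _)

/-- The difference of the two counts is the sum of `(-1) ^ (a + b)` over all faces, a product of two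
alternating sums of odd length, each equal to `1`. -/
theorem card_evenFace_eq (hodd : Odd ((L₁ - 1) * (L₂ - 1))) :
    Fintype.card (EvenFace L₁ L₂) = Fintype.card (OddFace L₁ L₂) + 1 := by
  rw [Nat.odd_mul] at hodd
  have h1 : ∑ f : Face L₁ L₂, (-1 : ℤ) ^ ((f.1 : ℕ) + (f.2 : ℕ)) = 1 := by
    rw [Fintype.sum_prod_type]
    simp only [pow_add]
    rw [← Finset.sum_mul_sum, Fin.sum_univ_eq_sum_range (fun n => (-1 : ℤ) ^ n),
      Fin.sum_univ_eq_sum_range (fun n => (-1 : ℤ) ^ n), neg_one_geom_sum, neg_one_geom_sum,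
      if_neg (Nat.not_even_iff_odd.2 hodd.1), if_neg (Nat.not_even_iff_odd.2 hodd.2), one_mul]
  rw [← Fintype.sum_subtype_add_sum_subtype (fun f : Face L₁ L₂ => IsOddFace f)] at h1
  have h2 : ∑ f : OddFace L₁ L₂, (-1 : ℤ) ^ ((f.1.1 : ℕ) + (f.1.2 : ℕ)) =
      -(Fintype.card (OddFace L₁ L₂) : ℤ) := by
    rw [Finset.sum_congr rfl fun f _ => f.2.neg_one_pow]
    simp
  have h3 : ∑ f : EvenFace L₁ L₂, (-1 : ℤ) ^ ((f.1.1 : ℕ) + (f.1.2 : ℕ)) =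
      (Fintype.card (EvenFace L₁ L₂) : ℤ) := by
    rw [Finset.sum_congr rfl fun f _ => (Nat.not_odd_iff_even.1 f.2).neg_one_pow]
    simp
  have h4 := h1
  rw [h2, h3] at h4
  omega

theorem card_qubit : Fintype.card (Qubit L₁ L₂) = L₁ * L₂ + Fintype.card (OddFace L₁ L₂) := by
  rw [Fintype.card_sum, Fintype.card_prod, Fintype.card_fin, Fintype.card_fin]

theorem finrank_codeSpace (cw : Bool) (hodd : Odd ((L₁ - 1) * (L₂ - 1))) (hL₁ : 0 < L₁)
    (hL₂ : 0 < L₂) : Module.finrank ℂ (codeSpace L₁ L₂ cw) = 2 ^ (L₁ * L₂ - 1) := by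
  have h := two_pow_mul_finrank_codeSpace (L₁ := L₁) (L₂ := L₂) cw
  have hpos : 0 < L₁ * L₂ := Nat.mul_pos hL₁ hL₂
  have e : Fintype.card (Qubit L₁ L₂) = Fintype.card (EvenFace L₁ L₂) + (L₁ * L₂ - 1) := by
    rw [card_qubit, card_evenFace_eq hodd]
    omega
  rw [e, pow_add] at h
  exact Nat.eq_of_mul_eq_mul_left (by positivity) h

end Syndromes

/-! ### The parity constraint on the code space. -/

section EncodedParity

variable {L₁ L₂ : ℕ}

/-- Labels of a maximal set of commuting single-qubit Pauli operators: `Z` at the vertices, `Y` or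
`X` at the odd faces in even or odd columns. -/
def commLabel : Qubit L₁ L₂ → PauliLabel
  | Sum.inl _ => .z
  | Sum.inr g => if (g.1.1 : ℕ) % 2 = 0 then .y else .x

theorem commLabel_pairwise : Pairwise fun q r : Qubit L₁ L₂ => ∀ x y : Multiplicative ℕ,
    Commute (powersHom (Op (QubitSpace (Qubit L₁ L₂))) (pauli (commLabel q) q) x)
      (powersHom (Op (QubitSpace (Qubit L₁ L₂))) (pauli (commLabel r) r) y) := by
  intro q r hqr x y
  rw [powersHom_apply, powersHom_apply]
  exact (pauli_comm _ _ hqr).pow_pow _ _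

/-- The product of the commuting Pauli operators with given exponents. -/
def pauliMonomial : (Qubit L₁ L₂ → Multiplicative ℕ) →* Op (QubitSpace (Qubit L₁ L₂)) :=
  -- Only commuting Paulis enter the products below, so they are images of exponent vectors, and an
  -- operator identity reduces to counting exponents.
  MonoidHom.noncommPiCoprod
    (fun q => powersHom (Op (QubitSpace (Qubit L₁ L₂))) (pauli (commLabel q) q))
    commLabel_pairwise

theorem pauliMonomial_single (q : Qubit L₁ L₂) (n : ℕ) :
    pauliMonomial (Pi.mulSingle q (Multiplicative.ofAdd n)) = pauli (commLabel q) q ^ n := by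
  rw [pauliMonomial, MonoidHom.noncommPiCoprod_mulSingle, powersHom_apply, toAdd_ofAdd]

open Classical in
/-- The exponents of the face Pauli operator of an edge. -/
def edgeExponent (i j : Vertex L₁ L₂) : Qubit L₁ L₂ → Multiplicative ℕ
  | Sum.inl _ => 1
  | Sum.inr g => if FaceContains g i j then Multiplicative.ofAdd 1 else 1

theorem faceFactor_eq_pauliMonomial {i j : Vertex L₁ L₂} (hij : (lattice L₁ L₂).Adj i j)
    (h : ∀ g : OddFace L₁ L₂, FaceContains g i j → commLabel (Sum.inr g) = edgeLabel i j) :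
    faceFactor i j = pauliMonomial (edgeExponent i j) := by
  by_cases hex : ∃ g : OddFace L₁ L₂, FaceContains g i j
  · obtain ⟨g, hg⟩ := hex
    have e : edgeExponent i j = Pi.mulSingle (Sum.inr g) (Multiplicative.ofAdd 1) := by
      funext q
      rcases q with v | g'
      · simp [edgeExponent]
      · rw [Pi.mulSingle_apply, edgeExponent]
        refine if_congr ⟨fun h' => ?_, fun h' => ?_⟩ rfl rfl
        · rw [FaceContains.unique hij h' hg]
        · rw [Sum.inr.inj h']
          exact hg
    rw [e, pauliMonomial_single, pow_one, h g hg, faceFactor, facePauli_of_contains _ hij hg]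
  · push Not at hex
    have e : edgeExponent i j = 1 := by
      funext q
      rcases q with v | g'
      · rfl
      · exact if_neg (hex g')
    rw [e, map_one, faceFactor, facePauli_of_forall_not _ hex]

/-- The faces in even rows and even columns. -/
def evenEvenFaces (L₁ L₂ : ℕ) : Finset (Face L₁ L₂) :=
  Finset.univ.filter fun f => (f.1 : ℕ) % 2 = 0 ∧ (f.2 : ℕ) % 2 = 0

theorem mem_evenEvenFaces (f : Face L₁ L₂) :
    f ∈ evenEvenFaces L₁ L₂ ↔ (f.1 : ℕ) % 2 = 0 ∧ (f.2 : ℕ) % 2 = 0 := by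
  simp [evenEvenFaces]

/-- The exponents of the loop operator of a face in an even row and an even column. -/
def loopExponent (f : Face L₁ L₂) : Qubit L₁ L₂ → Multiplicative ℕ :=
  Pi.mulSingle (Sum.inl (corner f 0)) (Multiplicative.ofAdd 1) *
  Pi.mulSingle (Sum.inl (corner f 1)) (Multiplicative.ofAdd 1) *
  Pi.mulSingle (Sum.inl (corner f 2)) (Multiplicative.ofAdd 1) *
  Pi.mulSingle (Sum.inl (corner f 3)) (Multiplicative.ofAdd 1) *
  (edgeExponent (corner f 0) (corner f 1) * edgeExponent (corner f 1) (corner f 2) *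
    edgeExponent (corner f 2) (corner f 3) * edgeExponent (corner f 3) (corner f 0))

theorem faceContains_corner (f : Face L₁ L₂) (hf : ¬ IsOddFace f) (g : OddFace L₁ L₂) :
    (FaceContains g (corner f 0) (corner f 1) ↔
      (g.1.1 : ℕ) = f.1 ∧ (g.1.2 : ℕ) + 1 = f.2) ∧
    (FaceContains g (corner f 1) (corner f 2) ↔
      (g.1.1 : ℕ) = f.1 + 1 ∧ (g.1.2 : ℕ) = f.2) ∧
    (FaceContains g (corner f 2) (corner f 3) ↔
      (g.1.1 : ℕ) = f.1 ∧ (g.1.2 : ℕ) = f.2 + 1) ∧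
    (FaceContains g (corner f 3) (corner f 0) ↔
      (g.1.1 : ℕ) + 1 = f.1 ∧ (g.1.2 : ℕ) = f.2) := by
  obtain ⟨h0, h1, h2, h3⟩ := corner_val f
  have hg := g.2
  rw [IsOddFace, Nat.odd_iff] at hf hg
  simp only [FaceContains, mem_range_corner, h0, h1, h2, h3]
  refine ⟨?_, ?_, ?_, ?_⟩ <;> omega

theorem faceLoop_eq_pauliMonomial (cw : Bool) {f : Face L₁ L₂} (hf : f ∈ evenEvenFaces L₁ L₂) :
    faceLoop cw f = pauliMonomial (loopExponent f) := by
  rw [mem_evenEvenFaces] at hf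
  have hf' : ¬ IsOddFace f := by
    rw [IsOddFace, Nat.odd_iff]
    omega
  obtain ⟨l0, l1, l2, l3⟩ := edgeLabel_corner f
  have a0 : (lattice L₁ L₂).Adj (corner f 0) (corner f 1) := corner_adj f 0
  have a1 : (lattice L₁ L₂).Adj (corner f 1) (corner f 2) := corner_adj f 1
  have a2 : (lattice L₁ L₂).Adj (corner f 2) (corner f 3) := corner_adj f 2
  have a3 : (lattice L₁ L₂).Adj (corner f 3) (corner f 0) := corner_adj f 3
  have hz : ∀ v : Vertex L₁ L₂,
      encVertex v = pauliMonomial (Pi.mulSingle (Sum.inl v) (Multiplicative.ofAdd 1)) := by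
    intro v
    rw [pauliMonomial_single, pow_one]
    rfl
  have F0 := faceFactor_eq_pauliMonomial a0 fun g hg => by
    have := (faceContains_corner f hf' g).1.1 hg
    rw [l0, commLabel, if_pos (by omega)]
  have F1 := faceFactor_eq_pauliMonomial a1 fun g hg => by
    have := (faceContains_corner f hf' g).2.1.1 hg
    rw [l1, commLabel, if_neg (by omega)]
  have F2 := faceFactor_eq_pauliMonomial a2 fun g hg => by
    have := (faceContains_corner f hf' g).2.2.1.1 hg
    rw [l2, commLabel, if_pos (by omega)]
  have F3 := faceFactor_eq_pauliMonomial a3 fun g hg => by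
    have := (faceContains_corner f hf' g).2.2.2.1 hg
    rw [l3, commLabel, if_neg (by omega)]
  rw [faceLoop_even cw f hf', hz, hz, hz, hz, F0, F1, F2, F3, loopExponent]
  simp only [map_mul]

theorem prod_evenEvenFaces_ite {A : Type} [CommMonoid A] (c : A) (p : Face L₁ L₂ → Prop)
    [DecidablePred p] (f₀ : Face L₁ L₂) (h₀ : f₀ ∈ evenEvenFaces L₁ L₂)
    (hp : ∀ f ∈ evenEvenFaces L₁ L₂, p f ↔ f = f₀) :
    ∏ f ∈ evenEvenFaces L₁ L₂, (if p f then c else 1) = c := by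
  rw [Finset.prod_eq_single f₀, if_pos ((hp f₀ h₀).2 rfl)]
  · intro f hf hne
    rw [if_neg fun h => hne ((hp f hf).1 h)]
  · exact fun h => absurd h₀ h

theorem prod_loopExponent_vertex (h₁ : L₁ % 2 = 0) (h₂ : L₂ % 2 = 0) (v : Vertex L₁ L₂) :
    (∏ f ∈ evenEvenFaces L₁ L₂, loopExponent f) (Sum.inl v) = Multiplicative.ofAdd 1 := by
  have e : ∀ f : Face L₁ L₂, loopExponent f (Sum.inl v) =
      if ((v.1 : ℕ) = f.1 ∨ (v.1 : ℕ) = f.1 + 1) ∧ ((v.2 : ℕ) = f.2 ∨ (v.2 : ℕ) = f.2 + 1)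
      then Multiplicative.ofAdd 1 else 1 := by
    intro f
    obtain ⟨h0, h1, h2, h3⟩ := corner_val f
    rw [← prod_ite_corners (Multiplicative.ofAdd 1) _ _ _ _ (by omega) (by omega)]
    simp only [loopExponent, Pi.mul_apply, edgeExponent, mul_one, Pi.mulSingle_apply,
      Sum.inl.injEq, vertex_eq_iff, h0, h1, h2, h3]
  have hx := v.1.2
  have hy := v.2.2
  rw [Finset.prod_apply]
  simp only [e]
  -- The faces in even columns and even rows partition the vertices into `2 × 2` blocks because `L₁`
  -- and `L₂` are even; halving finds the block of `v`.
  refine prod_evenEvenFaces_ite _ _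
    (⟨2 * ((v.1 : ℕ) / 2), by omega⟩, ⟨2 * ((v.2 : ℕ) / 2), by omega⟩) ?_ ?_
  · rw [mem_evenEvenFaces]
    simp
  · intro f hf
    rw [mem_evenEvenFaces] at hf
    rw [face_eq_iff]
    simp only
    omega

theorem prod_loopExponent_face (h₁ : L₁ % 2 = 0) (h₂ : L₂ % 2 = 0) (g : OddFace L₁ L₂) :
    (∏ f ∈ evenEvenFaces L₁ L₂, loopExponent f) (Sum.inr g) = Multiplicative.ofAdd 2 := by
  have e : ∀ f ∈ evenEvenFaces L₁ L₂, loopExponent f (Sum.inr g) =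
      (if (g.1.1 : ℕ) = f.1 ∧ (g.1.2 : ℕ) + 1 = f.2 then Multiplicative.ofAdd 1 else 1) *
      (if (g.1.1 : ℕ) = f.1 + 1 ∧ (g.1.2 : ℕ) = f.2 then Multiplicative.ofAdd 1 else 1) *
      (if (g.1.1 : ℕ) = f.1 ∧ (g.1.2 : ℕ) = f.2 + 1 then Multiplicative.ofAdd 1 else 1) *
      (if (g.1.1 : ℕ) + 1 = f.1 ∧ (g.1.2 : ℕ) = f.2 then Multiplicative.ofAdd 1 else 1) := by
    intro f hf
    rw [mem_evenEvenFaces] at hf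
    obtain ⟨h0, h1, h2, h3⟩ := faceContains_corner f (by rw [IsOddFace, Nat.odd_iff]; omega) g
    simp only [loopExponent, Pi.mul_apply, edgeExponent, Pi.mulSingle_apply, reduceCtorEq,
      if_false, one_mul, h0, h1, h2, h3]
  have hg := g.2
  rw [IsOddFace, Nat.odd_iff] at hg
  have hx := g.1.1.2
  have hy := g.1.2.2
  rw [Finset.prod_apply, Finset.prod_congr rfl e]
  simp only [Finset.prod_mul_distrib]
  -- An odd face in an even column lies in an odd row and meets even-even faces only below and
  -- above, across horizontal edges; in an odd column it meets them left and right. Both neighbours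
  -- exist because the last row and last column of faces have even index.
  rcases Nat.mod_two_eq_zero_or_one (g.1.1 : ℕ) with hm | hm
  · rw [prod_evenEvenFaces_ite _ (fun f => (g.1.1 : ℕ) = f.1 ∧ (g.1.2 : ℕ) + 1 = f.2)
        (g.1.1, ⟨(g.1.2 : ℕ) + 1, by omega⟩),
      prod_evenEvenFaces_ite _ (fun f => (g.1.1 : ℕ) = f.1 ∧ (g.1.2 : ℕ) = f.2 + 1)
        (g.1.1, ⟨(g.1.2 : ℕ) - 1, by omega⟩),
      Finset.prod_eq_one, Finset.prod_eq_one]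
    · rfl
    all_goals simp only [mem_evenEvenFaces, face_eq_iff]
    · intro f hf
      rw [if_neg (by omega)]
    · intro f hf
      rw [if_neg (by omega)]
    · omega
    · intro f hf
      omega
    · omega
    · intro f hf
      omega
  · rw [prod_evenEvenFaces_ite _ (fun f => (g.1.1 : ℕ) = f.1 + 1 ∧ (g.1.2 : ℕ) = f.2)
        (⟨(g.1.1 : ℕ) - 1, by omega⟩, g.1.2),
      prod_evenEvenFaces_ite _ (fun f => (g.1.1 : ℕ) + 1 = f.1 ∧ (g.1.2 : ℕ) = f.2)
        (⟨(g.1.1 : ℕ) + 1, by omega⟩, g.1.2),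
      Finset.prod_eq_one, Finset.prod_eq_one]
    · rfl
    all_goals simp only [mem_evenEvenFaces, face_eq_iff]
    · intro f hf
      rw [if_neg (by omega)]
    · intro f hf
      rw [if_neg (by omega)]
    · omega
    · intro f hf
      omega
    · omega
    · intro f hf
      omega

theorem prod_loopExponent (h₁ : L₁ % 2 = 0) (h₂ : L₂ % 2 = 0) :
    ∏ f ∈ evenEvenFaces L₁ L₂, loopExponent f =
      ((Finset.univ : Finset (Vertex L₁ L₂)).toList.map fun v =>
        Pi.mulSingle (Sum.inl v) (Multiplicative.ofAdd 1)).prod *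
      ((Finset.univ : Finset (OddFace L₁ L₂)).toList.map fun g =>
        Pi.mulSingle (Sum.inr g) (Multiplicative.ofAdd 2)).prod := by
  funext q
  rw [Pi.mul_apply, Finset.prod_map_toList, Finset.prod_map_toList, Finset.prod_apply q Finset.univ,
    Finset.prod_apply q Finset.univ]
  rcases q with v | g
  · rw [prod_loopExponent_vertex h₁ h₂]
    simp [Pi.mulSingle_apply]
  · rw [prod_loopExponent_face h₁ h₂]
    simp [Pi.mulSingle_apply]

/-- The loops of the even-even faces fix `ψ`. In their product every vertex contributes one `Z`, and
every odd face contributes the square of a Pauli, which is the identity. -/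
theorem prod_encVertex (h₁ : L₁ % 2 = 0) (h₂ : L₂ % 2 = 0) (cw : Bool)
    (ψ : QubitSpace (Qubit L₁ L₂)) (hψ : ψ ∈ codeSpace L₁ L₂ cw) :
    ((Finset.univ : Finset (Vertex L₁ L₂)).toList.map encVertex).prod ψ = ψ := by
  rw [mem_codeSpace_iff] at hψ
  have h : ∀ s ⊆ evenEvenFaces L₁ L₂, pauliMonomial (∏ f ∈ s, loopExponent f) ψ = ψ := by
    intro s
    induction s using Finset.induction_on with
    | empty => simp
    | insert f s hf ih =>
      intro hs
      rw [Finset.insert_subset_iff] at hs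
      rw [Finset.prod_insert hf, map_mul, Module.End.mul_apply, ih hs.2,
        ← faceLoop_eq_pauliMonomial cw hs.1, hψ]
  have h' := h _ subset_rfl
  rw [prod_loopExponent h₁ h₂, map_mul, map_list_prod, map_list_prod, List.map_map, List.map_map]
    at h'
  have e1 : (((Finset.univ : Finset (OddFace L₁ L₂)).toList.map
      (pauliMonomial ∘ fun g => Pi.mulSingle (Sum.inr g) (Multiplicative.ofAdd 2))).prod) = 1 := by
    apply List.prod_eq_one
    intro T hT
    obtain ⟨g, -, rfl⟩ := List.mem_map.1 hT
    rw [Function.comp_apply, pauliMonomial_single, pow_two, pauli_sq]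
  have e2 : (pauliMonomial ∘ fun v : Vertex L₁ L₂ =>
      Pi.mulSingle (Sum.inl v) (Multiplicative.ofAdd 1)) = encVertex := by
    funext v
    rw [Function.comp_apply, pauliMonomial_single, pow_one]
    rfl
  rw [e1, mul_one, e2] at h'
  exact h'

end EncodedParity

/-! ### Conjugation by unitaries, and uniqueness of `μ` and `J`. -/

section Conjugation

variable {E F : Type} [NormedAddCommGroup E] [InnerProductSpace ℂ E] [FiniteDimensional ℂ E]
  [NormedAddCommGroup F] [InnerProductSpace ℂ F] [FiniteDimensional ℂ F]

/-- Conjugation by a unitary map as an isomorphism of `*`-algebras. -/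
def conjStar (J : E ≃ₗᵢ[ℂ] F) : Op E ≃⋆ₐ[ℂ] Op F :=
  StarAlgEquiv.ofAlgEquiv (J.toLinearEquiv.conjAlgEquiv ℂ) (by
    intro A
    rw [LinearMap.star_eq_adjoint, LinearMap.star_eq_adjoint, LinearMap.eq_adjoint_iff]
    intro x y
    change inner ℂ (J (LinearMap.adjoint A (J.symm x))) y = inner ℂ x (J (A (J.symm y)))
    conv_lhs => rw [← J.apply_symm_apply y]
    conv_rhs => rw [← J.apply_symm_apply x]
    rw [J.inner_map_map, J.inner_map_map, LinearMap.adjoint_inner_left])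

theorem conjStar_apply (J : E ≃ₗᵢ[ℂ] F) (A : Op E) (y : F) :
    conjStar J A y = J (A (J.symm y)) := rfl

theorem adjoint_toLinearMap (J : E ≃ₗᵢ[ℂ] F) (y : F) :
    LinearMap.adjoint J.toLinearIsometry.toLinearMap y = J.symm y := by
  refine ext_inner_left ℂ fun x => ?_
  rw [LinearMap.adjoint_inner_right]
  change inner ℂ (J x) y = _
  conv_lhs => rw [← J.apply_symm_apply y]
  rw [J.inner_map_map]

theorem conjStar_eq_conjBy (J : E ≃ₗᵢ[ℂ] F) (A : Op E) :
    conjStar J A = conjBy J.toLinearIsometry A := by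
  refine LinearMap.ext fun y => ?_
  change _ = J (A (LinearMap.adjoint J.toLinearIsometry.toLinearMap y))
  rw [adjoint_toLinearMap, conjStar_apply]

theorem adjoint_comp_self (J : E →ₗᵢ[ℂ] F) (x : E) :
    LinearMap.adjoint J.toLinearMap (J x) = x := by
  refine ext_inner_left ℂ fun y => ?_
  rw [LinearMap.adjoint_inner_right]
  exact J.inner_map_map y x

/-- An isometry that implements conjugation by a unitary map is a multiple of that map. -/
theorem eq_smul_of_conjBy_eq [Nontrivial E] (J : E ≃ₗᵢ[ℂ] F) (J' : E →ₗᵢ[ℂ] F)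
    (h : ∀ A : Op E, conjStar J A = conjBy J' A) : ∃ z : ℂ, ‖z‖ = 1 ∧ ∀ ψ, J' ψ = z • J ψ := by
  set X : Op E := J.symm.toLinearEquiv.toLinearMap ∘ₗ J'.toLinearMap with hX
  have hcomm : ∀ A : Op E, A * X = X * A := by
    intro A
    refine LinearMap.ext fun ψ => ?_
    have e := LinearMap.congr_fun (h A) (J' ψ)
    have e2 : conjBy J' A (J' ψ) = J' (A ψ) := by
      change J' (A (LinearMap.adjoint J'.toLinearMap (J' ψ))) = _
      rw [adjoint_comp_self]
    rw [e2, conjStar_apply] at e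
    have e3 := congrArg J.symm e
    rw [J.symm_apply_apply] at e3
    exact e3
  -- `J⁻¹ J'` commutes with every operator, and the centre of the operator algebra is scalar.
  obtain ⟨c, hc⟩ := Algebra.IsCentral.mem_center_iff ℂ |>.1
    (Subalgebra.mem_center_iff.2 hcomm : X ∈ Subalgebra.center ℂ (Op E))
  have hJ' : ∀ ψ, J' ψ = c • J ψ := by
    intro ψ
    have e : X ψ = c • ψ := by
      rw [hc]
      rfl
    have e2 := congrArg J e
    rw [map_smul] at e2
    rw [← e2]
    exact (J.apply_symm_apply (J' ψ)).symm
  refine ⟨c, ?_, hJ'⟩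
  obtain ⟨ψ, hψ⟩ := exists_ne (0 : E)
  have e := congrArg norm (hJ' ψ)
  rw [J'.norm_map, norm_smul, J.norm_map] at e
  have h0 : ‖ψ‖ ≠ 0 := norm_ne_zero_iff.2 hψ
  exact mul_right_cancel₀ h0 (by rw [one_mul, ← e])

/-- An isomorphism of operator algebras is determined by its values on a set of operators whose
commutant is trivial. -/
theorem algEquiv_eq_of_commutant {s : Set (Op E)}
    (hs : ∀ X : Op E, (∀ A ∈ s, X * A = A * X) → ∃ c : ℂ, ∀ ψ, X ψ = c • ψ)
    (μ ν : Op E ≃⋆ₐ[ℂ] Op F) (h : ∀ A ∈ s, ν A = μ A) : ν = μ := by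
  -- Skolem–Noether: the automorphism `μ⁻¹ ∘ ν` is conjugation by some `T`. It fixes `s` pointwise,
  -- so `T` lies in the commutant of `s` and is a scalar.
  obtain ⟨T, hT⟩ := LinearEquiv.conjAlgEquiv_surjective ℂ E E
    (ν.toAlgEquiv.trans μ.toAlgEquiv.symm)
  have hT' : ∀ A ψ, T (A (T.symm ψ)) = (μ.symm (ν A)) ψ := by
    intro A ψ
    exact LinearMap.congr_fun (AlgEquiv.congr_fun hT A) ψ
  obtain ⟨c, hc⟩ := hs T.toLinearMap (fun A hA => by
    refine LinearMap.ext fun ψ => ?_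
    have e := hT' A (T ψ)
    rw [T.symm_apply_apply, h A hA, StarAlgEquiv.symm_apply_apply] at e
    exact e)
  refine StarAlgEquiv.ext fun A => ?_
  have e : μ.symm (ν A) = A := by
    refine LinearMap.ext fun ψ => ?_
    have hc' : ∀ ψ, T ψ = c • ψ := hc
    rw [← hT', hc', ← map_smul, ← hc', T.apply_symm_apply]
  rw [← e, StarAlgEquiv.apply_symm_apply, e]

end Conjugation

/-! ### Restriction of the relations to invariant subspaces. -/

section Restriction

variable {L₁ L₂ : ℕ} {H : Type} [NormedAddCommGroup H] [InnerProductSpace ℂ H]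
  [FiniteDimensional ℂ H]

theorem coe_restrictTo (S : Submodule ℂ H) (T : Op H) (h : ∀ ψ ∈ S, T ψ ∈ S) (ψ : S) :
    (restrictTo S T h ψ : H) = T ψ := rfl

theorem CommuteBy.restrictTo {s : ℂ} {A B : Op H} (h : CommuteBy s A B) (S : Submodule ℂ H)
    (hA : ∀ ψ ∈ S, A ψ ∈ S) (hB : ∀ ψ ∈ S, B ψ ∈ S) :
    CommuteBy s (CompactEncoding.restrictTo S A hA) (CompactEncoding.restrictTo S B hB) := by
  refine LinearMap.ext fun ψ => Subtype.ext ?_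
  exact LinearMap.congr_fun h ψ

theorem EdgeRelations.restrictTo {E : Vertex L₁ L₂ → Vertex L₁ L₂ → Op H}
    {V : Vertex L₁ L₂ → Op H} (h : EdgeRelations E V) (S : Submodule ℂ H)
    (hE : ∀ i j, ∀ ψ ∈ S, E i j ψ ∈ S) (hV : ∀ i, ∀ ψ ∈ S, V i ψ ∈ S) :
    EdgeRelations (fun i j => CompactEncoding.restrictTo S (E i j) (hE i j))
      (fun i => CompactEncoding.restrictTo S (V i) (hV i)) where
  E_sq i j hij := LinearMap.ext fun ψ => Subtype.ext (LinearMap.congr_fun (h.E_sq i j hij) ψ)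
  E_anti i j hij := LinearMap.ext fun ψ => Subtype.ext (LinearMap.congr_fun (h.E_anti i j hij) ψ)
  E_norm i j hij ψ := h.E_norm i j hij ψ
  V_sq i := LinearMap.ext fun ψ => Subtype.ext (LinearMap.congr_fun (h.V_sq i) ψ)
  V_symm i ψ φ := h.V_symm i ψ φ
  V_comm i j := LinearMap.ext fun ψ => Subtype.ext (LinearMap.congr_fun (h.V_comm i j) ψ)
  EE i j k l hij hkl := (h.EE i j k l hij hkl).restrictTo S _ _
  EV i j k hij := (h.EV i j k hij).restrictTo S _ _

theorem prod_restrictTo {ι : Type} (S : Submodule ℂ H) (V : ι → Op H)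
    (hV : ∀ i, ∀ ψ ∈ S, V i ψ ∈ S) (l : List ι) (ψ : S) :
    (((l.map fun i => restrictTo S (V i) (hV i)).prod ψ : S) : H) = (l.map V).prod ψ := by
  induction l with
  | nil => simp
  | cons i l ih =>
    rw [List.map_cons, List.prod_cons, Module.End.mul_apply, coe_restrictTo, ih, List.map_cons,
      List.prod_cons, Module.End.mul_apply]

end Restriction

end CompactEncoding

end

open CompactEncoding in
theorem mainTheorem2 (L₁ L₂ : ℕ) (hodd : Odd ((L₁ - 1) * (L₂ - 1))) (cw : Bool) :
    -- the faces: one more even face than odd faces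
    Fintype.card (Face L₁ L₂) = (L₁ - 1) * (L₂ - 1) ∧
    Fintype.card (EvenFace L₁ L₂) = Fintype.card (OddFace L₁ L₂) + 1 ∧
    -- the numbers of qubits and of non-trivial stabilizers, and the dimensions
    Fintype.card (Qubit L₁ L₂) = L₁ * L₂ + (L₁ - 1) * (L₂ - 1) / 2 ∧
    (stabilizers L₁ L₂ cw).ncard = ((L₁ - 1) * (L₂ - 1) + 1) / 2 ∧
    Module.finrank ℂ (codeSpace L₁ L₂ cw) = 2 ^ (L₁ * L₂ - 1) ∧
    Module.finrank ℂ (evenFock (Vertex L₁ L₂)) = 2 ^ (L₁ * L₂ - 1) ∧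
    -- the constraint `∏ V_i = 1`, on both sides
    (∀ ψ ∈ evenFock (Vertex L₁ L₂),
      ((Finset.univ : Finset (Vertex L₁ L₂)).toList.map vertexOp).prod ψ = ψ) ∧
    (∀ ψ ∈ codeSpace L₁ L₂ cw,
      ((Finset.univ : Finset (Vertex L₁ L₂)).toList.map encVertex).prod ψ = ψ) ∧
    -- edge and vertex operators restrict to the even Fock space, encoded ones to the code space
    ∃ (hE : ∀ i j, (lattice L₁ L₂).Adj i j →
          ∀ ψ ∈ evenFock (Vertex L₁ L₂), edgeOp i j ψ ∈ evenFock (Vertex L₁ L₂))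
      (hV : ∀ i, ∀ ψ ∈ evenFock (Vertex L₁ L₂), vertexOp i ψ ∈ evenFock (Vertex L₁ L₂))
      (hE' : ∀ i j, (lattice L₁ L₂).Adj i j →
          ∀ ψ ∈ codeSpace L₁ L₂ cw, encEdge cw i j ψ ∈ codeSpace L₁ L₂ cw)
      (hV' : ∀ i, ∀ ψ ∈ codeSpace L₁ L₂ cw, encVertex i ψ ∈ codeSpace L₁ L₂ cw)
      -- the `*`-isomorphism `μ : L(F_m^E) → L(𝓛)`
      (μ : Op (evenFock (Vertex L₁ L₂)) ≃⋆ₐ[ℂ] Op (codeSpace L₁ L₂ cw)),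
      (∀ i j (h : (lattice L₁ L₂).Adj i j),
        μ (restrictTo _ (edgeOp i j) (hE i j h)) = restrictTo _ (encEdge cw i j) (hE' i j h)) ∧
      (∀ i, μ (restrictTo _ (vertexOp i) (hV i)) = restrictTo _ (encVertex i) (hV' i)) ∧
      -- `μ` is determined by these values
      (∀ ν : Op (evenFock (Vertex L₁ L₂)) ≃⋆ₐ[ℂ] Op (codeSpace L₁ L₂ cw),
        (∀ i j (h : (lattice L₁ L₂).Adj i j),
          ν (restrictTo _ (edgeOp i j) (hE i j h)) = restrictTo _ (encEdge cw i j) (hE' i j h)) →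
        (∀ i, ν (restrictTo _ (vertexOp i) (hV i)) = restrictTo _ (encVertex i) (hV' i)) → ν = μ) ∧
      -- the isometry `J : F_m^E → 𝓛` with `μ(A) = J A J†`, unique up to a phase
      ∃ J : evenFock (Vertex L₁ L₂) →ₗᵢ[ℂ] codeSpace L₁ L₂ cw,
        Function.Surjective J ∧
        (∀ A, μ A = conjBy J A) ∧
        (∀ J' : evenFock (Vertex L₁ L₂) →ₗᵢ[ℂ] codeSpace L₁ L₂ cw,
          (∀ A, μ A = conjBy J' A) →
          ∃ z : ℂ, ‖z‖ = 1 ∧ ∀ ψ, J' ψ = z • J ψ) := by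
  -- An odd product has odd factors; with truncated subtraction this also forces `L₁` to be
  -- positive.
  have hL₁ : L₁ % 2 = 0 ∧ 0 < L₁ := by
    have := Nat.odd_iff.1 (Nat.odd_mul.1 hodd).1
    omega
  have hL₂ : L₂ % 2 = 0 ∧ 0 < L₂ := by
    have := Nat.odd_iff.1 (Nat.odd_mul.1 hodd).2
    omega
  have : Nonempty (Vertex L₁ L₂) := ⟨(⟨0, hL₁.2⟩, ⟨0, hL₂.2⟩)⟩
  have hcard := card_evenFace_eq hodd
  have hsum := card_evenFace_add_card_oddFace (L₁ := L₁) (L₂ := L₂)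
  have hdim' := finrank_codeSpace cw hodd hL₁.2 hL₂.2
  have hdim : Module.finrank ℂ (evenFock (Vertex L₁ L₂)) = 2 ^ (L₁ * L₂ - 1) := by
    rw [finrank_evenFock, Fintype.card_prod, Fintype.card_fin, Fintype.card_fin]
  have hp := fun ψ => (mem_evenFock_iff (ι := Vertex L₁ L₂) ψ).1
  have hp' := prod_encVertex hL₁.1 hL₂.1 cw
  refine ⟨card_face, hcard, ?_, ?_, hdim', hdim, hp, hp', ?_⟩
  · rw [card_qubit]
    omega
  · rw [ncard_stabilizers]
    omega
  have r := edgeRelations_fock.restrictTo (evenFock (Vertex L₁ L₂)) edgeOp_mem_evenFock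
    vertexOp_mem_evenFock
  have r' := (edgeRelations_enc cw).restrictTo (codeSpace L₁ L₂ cw) (encEdge_mem_codeSpace cw)
    (encVertex_mem_codeSpace cw)
  -- Loops are trivial identically on the Fock side and by definition of the code space on the qubit
  -- side. Parity holds on both restricted spaces, so the equivalence theorem applies.
  obtain ⟨J, hJE, hJV⟩ := r.exists_intertwiner r'
    (fun f => LinearMap.ext fun ψ => Subtype.ext (LinearMap.congr_fun (trivialLoops_fock f) ψ))
    (fun f => LinearMap.ext fun ψ => Subtype.ext (by
      have := (mem_codeSpace_iff cw ψ).1 ψ.2 f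
      rw [faceLoop_eq] at this
      exact this))
    (LinearMap.ext fun ψ => Subtype.ext (by
      rw [prod_restrictTo]
      exact hp ψ ψ.2))
    (LinearMap.ext fun ψ => Subtype.ext (by
      rw [prod_restrictTo]
      exact hp' ψ ψ.2)) hdim hdim' hL₁.2 hL₂.2
  have : Nontrivial (evenFock (Vertex L₁ L₂)) :=
    Module.nontrivial_of_finrank_pos (R := ℂ) (by rw [hdim]; positivity)
  have hE : ∀ i j, (lattice L₁ L₂).Adj i j →
      conjStar J (restrictTo _ (edgeOp i j) (edgeOp_mem_evenFock i j)) =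
        restrictTo _ (encEdge cw i j) (encEdge_mem_codeSpace cw i j) :=
    fun i j h => LinearMap.ext fun φ => by
      rw [conjStar_apply, hJE i j h, J.apply_symm_apply]
  have hV : ∀ i, conjStar J (restrictTo _ (vertexOp i) (vertexOp_mem_evenFock i)) =
      restrictTo _ (encVertex i) (encVertex_mem_codeSpace cw i) :=
    fun i => LinearMap.ext fun φ => by
      rw [conjStar_apply, hJV, J.apply_symm_apply]
  refine ⟨fun i j _ => edgeOp_mem_evenFock i j, vertexOp_mem_evenFock,
    fun i j _ => encEdge_mem_codeSpace cw i j, encVertex_mem_codeSpace cw, conjStar J, hE, hV, ?_,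
    J.toLinearIsometry, J.surjective, conjStar_eq_conjBy J, eq_smul_of_conjBy_eq J⟩
  intro ν hνE hνV
  refine algEquiv_eq_of_commutant
    (s := {A | (∃ i j, (lattice L₁ L₂).Adj i j ∧
      A = restrictTo _ (edgeOp i j) (edgeOp_mem_evenFock i j)) ∨
      ∃ i, A = restrictTo _ (vertexOp i) (vertexOp_mem_evenFock i)}) ?_ _ _ ?_
  · intro X hX
    exact r.commutant hdim hL₁.2 hL₂.2 X
      (fun i j hij => hX _ (Or.inl ⟨i, j, hij, rfl⟩)) fun i => hX _ (Or.inr ⟨i, rfl⟩)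
  · rintro _ (⟨i, j, hij, rfl⟩ | ⟨i, rfl⟩)
    · rw [hνE i j hij, hE i j hij]
    · rw [hνV i, hV i]
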